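/- Let $X, X_1, X_2, \dots$ be independent and identically distributed real random variables with $E(X)=0$ whose distribution is in the domain of attraction of the normal law; that is, there are constants $a_n>0$ and $c_n$ such that $(\sum_{i\le n}X_i-c_n)/a_n$ converges in distribution to the standard normal law. Write $\Phi$ and $\phi$ for the standard normal distribution function and density, and put $$b_n=\sup\{x: n x^{-2}E[X^2 I(|X|\le x)]\ge 1\},\qquad \sigma_n^2=E\{X^2I(|X|\le b_n)\},$$ $$\delta_n=nP(|X|>b_n)+nb_n^{-1}|E\{XI(|X|\le b_n)\}|+nb_n^{-3}|E\{X^3I(|X|\le b_n)\}|+nb_n^{-4}E\{X^4I(|X|\le b_n)\}.$$ Let $$S_1=b_n^{-1}\sum_{i\le n}X_i,\qquad L_{n1}(x)=nE\{\Phi(x-X/b_n)-\Phi(x)\}-\tfrac12\,n\,b_n^{-2}\sigma_n^2\,\phi'(x).$$ Then, as $n\to\infty$, $$\sup_{-\infty<x<\infty}|L_{n1}(x)|\asymp\delta_n,$$ $$\sup_{-\infty<x<\infty}|P(S_1\le x)-\{\Phi(x)+L_{n1}(x)\}|=o(\delta_n)+O(n^{-1/2}),$$ where $u_n\asymp v_n$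 means $0<\liminf_{n\to\infty}u_n/v_n\le\limsup_{n\to\infty}u_n/v_n<\infty$. Both statements also hold, with the same $\delta_n$, when $S_1$ and $L_{n1}$ are replaced by $S_2$ and $L_{n2}$, which are obtained from $S_1$ and $L_{n1}$ by replacing $b_n$ with $n^{1/2}\sigma_n$ (and leaving $\sigma_n$ unchanged). -/

import Mathlib

open MeasureTheory ProbabilityTheory Filter Topology Asymptotics

namespace NormalApprox

noncomputable section

variable {Ω : Type*} [MeasurableSpace Ω]

/-- The standard normal distribution function. -/
def Phi (x : ℝ) : ℝ := cdf (gaussianReal 0 1) x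

/-- The standard normal density. -/
def phi (x : ℝ) : ℝ := gaussianPDFReal 0 1 x

/-- The common distribution of the independent, identically distributed variables
`X 0, X 1, …` is in the domain of attraction of the normal law: for some norming constants
`a n > 0` and centering constants `c n`, the variables `(X 0 + ⋯ + X (n - 1) - c n) / a n`
converge in distribution to the standard normal law. -/
def InNormalDomainOfAttraction (P : Measure Ω) [IsProbabilityMeasure P] (X : ℕ → Ω → ℝ) : Prop :=
  ∃ a c : ℕ → ℝ, (∀ n, 0 < a n) ∧
    TendstoInDistribution (fun n ω => ((∑ i ∈ Finset.range n, X i ω) - c n) / a n) atTop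
      (fun z : ℝ => z) (fun _ => P) (gaussianReal 0 1)

/-- The truncated moment `E{Y ^ k I(|Y| ≤ t)}`. -/
def truncMoment (P : Measure Ω) (Y : Ω → ℝ) (k : ℕ) (t : ℝ) : ℝ :=
  ∫ ω, {ω | |Y ω| ≤ t}.indicator (fun ω => Y ω ^ k) ω ∂P

/-- `b_n = sup {x : n x⁻² E{Y² I(|Y| ≤ x)} ≥ 1}`. Every element of this set is positive and the
set is bounded above. -/
def bScale (P : Measure Ω) (Y : Ω → ℝ) (n : ℕ) : ℝ :=
  sSup {x : ℝ | 1 ≤ n * (x ^ 2)⁻¹ * truncMoment P Y 2 x}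

/-- `σ_n = (E{Y² I(|Y| ≤ b_n)})^{1/2}`. -/
def sigma (P : Measure Ω) (Y : Ω → ℝ) (n : ℕ) : ℝ :=
  √(truncMoment P Y 2 (bScale P Y n))

/-- The rate `δ_n`. -/
def delta (P : Measure Ω) (Y : Ω → ℝ) (n : ℕ) : ℝ :=
  n * P.real {ω | bScale P Y n < |Y ω|}
    + n * (bScale P Y n)⁻¹ * |truncMoment P Y 1 (bScale P Y n)|
    + n * (bScale P Y n ^ 3)⁻¹ * |truncMoment P Y 3 (bScale P Y n)|
    + n * (bScale P Y n ^ 4)⁻¹ * truncMoment P Y 4 (bScale P Y n)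

/-- `P(s⁻¹ (X 0 + ⋯ + X (n - 1)) ≤ x)`, the distribution function of the sum of the first `n`
variables under the scaling `s`. -/
def sumCDF (P : Measure Ω) (X : ℕ → Ω → ℝ) (n : ℕ) (s x : ℝ) : ℝ :=
  P.real {ω | s⁻¹ * ∑ i ∈ Finset.range n, X i ω ≤ x}

/-- The leading term under the scaling `s`:
`n E{Φ(x - Y / s) - Φ(x)} - (1/2) n s⁻² σ_n² φ'(x)`. -/
def leadingTerm (P : Measure Ω) (Y : Ω → ℝ) (n : ℕ) (s x : ℝ) : ℝ :=
  n * ∫ ω, (Phi (x - Y ω / s) - Phi x) ∂P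
    - 1 / 2 * n * (s ^ 2)⁻¹ * sigma P Y n ^ 2 * deriv phi x

/-- `a_n ≍ d_n`: `0 < liminf a_n / d_n ≤ limsup a_n / d_n < ∞`, with the limits taken in the
extended reals. -/
def SameOrder (a d : ℕ → ℝ) : Prop :=
  0 < liminf (fun n => ((a n / d n : ℝ) : EReal)) atTop ∧
    limsup (fun n => ((a n / d n : ℝ) : EReal)) atTop < ⊤

/-- For a sequence of functions `f n : ℝ → ℝ`: each `f n` is bounded and
`sup_x |f n x| ≍ d n`. -/
def SupSameOrder (f : ℕ → ℝ → ℝ) (d : ℕ → ℝ) : Prop :=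
  (∀ n, BddAbove (Set.range fun x => |f n x|)) ∧ SameOrder (fun n => ⨆ x, |f n x|) d

/-- For a sequence of functions `f n : ℝ → ℝ`: each `f n` is bounded and
`sup_x |f n x| = o(d n) + O(e n)`. -/
def SupLittleOAddBigO (f : ℕ → ℝ → ℝ) (d e : ℕ → ℝ) : Prop :=
  (∀ n, BddAbove (Set.range fun x => |f n x|)) ∧
    ∃ r t : ℕ → ℝ, r =o[atTop] d ∧ t =O[atTop] e ∧ ∀ n, ⨆ x, |f n x| = r n + t n

end

end NormalApprox

/-!
The norming constant satisfies `n E{X² I(|X| ≤ b_n)} = b_n²` exactly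
(`mul_truncSecond_normScale`). Hence `n^{1/2} σ_n = b_n` for every `n`, the two scalings coincide,
and in terms of the law `ν` of `X / b_n` the truncated second moment is normalised by
`n ∫_{|u| ≤ 1} u² dν = 1`. The rate and the leading term become `scaledRate ν n` and
`scaledLeading ν n`.

*Order of the leading term.* The upper bound `abs_scaledLeading_le` is a fourth order Taylor
expansion of `Phi`. For the lower bound (`exists_scaledRate_le`), integrating the leading term
against a combination of derivatives of Gaussian functions, chosen to annihilate the term with
`φ'`, produces `n ∫ (1 - exp(-u² / 8))² dν`, which dominates the truncated fourth moment and the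
tail. The third derivative of `Phi` vanishes at `1` but not at `0`, so the values of the leading
term at these two points then bound the truncated moments of order one and three.

*Error of the expansion.* The difference between the distribution function of the normalised sum
and `Phi + scaledLeading ν n` is a difference of distribution functions of two finite positive
measures of equal mass (`leftMeasure`, `rightMeasure`). The smoothing inequality
`exists_abs_measureReal_Iic_sub_le`, proved with the Fejér kernel, bounds it by the
integral of the difference of characteristic functions over `(0, T]`, divided by the frequency,
plus a term of order `1 / T`. With `ψ = charFun ν s` and the defect `d = n (ψ - 1) + s² / 2`, the
difference is `ψ ^ n - exp(-s² / 2) (1 + d)`, which is of order `1 / n + |d|²` up to an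
exponentially decaying factor (`norm_pow_sub_exp_mul_le`). One factor `|d|` is of the order of
the rate (`norm_defect_le_scaledRate`), and the other is `o(1)` and vanishes at the origin
(`norm_defect_le_mul`), so that `|d|²` contributes `o(δ_n)`; taking `T` proportional to `√n` makes
the remaining terms `O(n^{-1/2})`.

*Consequences of the domain of attraction.* What is used about the law of `X` is that
`x² P(|X| > x)` is negligible compared with `V(x) = E{X² I(|X| ≤ x)}`
(`InNormalDomainOfAttraction.tail`). It follows by symmetrising: the characteristic functions
converge, so `n E{1 - cos(t U / a_n)} → t²` for the symmetrised variable `U`, the identity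
`2 (1 - cos t) - (1 - cos 2t) / 2 = (1 - cos t)²` shows that the mass away from the origin
disappears, and the norming constants grow slowly enough to fill in all `x`. This makes `V`
slowly varying, and thereby controls the tail first moment, the truncated third moment, and the
real part of `ψ - 1` (`eventually_charFun_bounds`).
-/

namespace NormalApprox

/-! ### A smoothing inequality -/

/-- The Fejér kernel `(1 - cos y) / y ^ 2` (up to normalisation), written as a cosine integral so
that it is visibly continuous with Fourier transform supported in `[-1, 1]`. -/
noncomputable def fejer (y : ℝ) : ℝ := ∫ t in (0 : ℝ)..1, (1 - t) * Real.cos (t * y)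

lemma fejer_eq {y : ℝ} (hy : y ≠ 0) : fejer y = (1 - Real.cos y) / y ^ 2 := by
  have h : ∀ t ∈ Set.uIcc (0 : ℝ) 1, HasDerivAt
      (fun t => (1 - t) * (Real.sin (t * y) / y) - Real.cos (t * y) / y ^ 2)
      ((1 - t) * Real.cos (t * y)) t := by
    intro t _
    have h1 : HasDerivAt (fun t : ℝ => t * y) y t := by simpa using (hasDerivAt_id t).mul_const y
    have h2 := ((hasDerivAt_id t).const_sub 1).mul (h1.sin.div_const y)
    have h3 := h1.cos.div_const (y ^ 2)
    refine (h2.sub h3).congr_deriv ?_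
    field_simp
    simp
    ring
  rw [fejer, intervalIntegral.integral_eq_sub_of_hasDerivAt h
    (Continuous.intervalIntegrable (by fun_prop) _ _)]
  simp
  ring

lemma continuous_fejer : Continuous fejer := by
  unfold fejer
  apply intervalIntegral.continuous_parametric_intervalIntegral_of_continuous'
  fun_prop

lemma fejer_neg (y : ℝ) : fejer (-y) = fejer y := by
  simp [fejer]

lemma fejer_zero : fejer 0 = 1 / 2 := by
  simp only [fejer, mul_zero, Real.cos_zero, mul_one]
  rw [intervalIntegral.integral_sub (by simp) (by simp)]
  norm_num

lemma fejer_nonneg (y : ℝ) : 0 ≤ fejer y := by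
  by_cases hy : y = 0
  · subst hy
    rw [fejer_zero]
    norm_num
  · rw [fejer_eq hy]
    have := Real.cos_le_one y
    exact div_nonneg (by linarith) (by positivity)

lemma fejer_le (y : ℝ) : fejer y ≤ 4 * (1 + y ^ 2)⁻¹ := by
  by_cases hy : y = 0
  · subst hy
    rw [fejer_zero]
    norm_num
  · rw [fejer_eq hy, ← div_eq_mul_inv, div_le_div_iff₀ (by positivity) (by positivity)]
    have h1 := Real.one_sub_sq_div_two_le_cos (x := y)
    have h2 := Real.neg_one_le_cos y
    nlinarith [sq_nonneg y, mul_nonneg (sq_nonneg y) (by linarith : 0 ≤ 1 + Real.cos y)]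

lemma integrable_fejer : Integrable fejer := by
  refine Integrable.mono' ((integrable_inv_one_add_sq).const_mul 4)
    continuous_fejer.aestronglyMeasurable (ae_of_all _ fun y => ?_)
  rw [Real.norm_of_nonneg (fejer_nonneg y)]
  exact fejer_le y

lemma integral_fejer_pos : 0 < ∫ y, fejer y :=
  integral_pos_of_integrable_nonneg_nonzero continuous_fejer integrable_fejer
    (fun y => fejer_nonneg y) (x := 0) (by rw [fejer_zero]; norm_num)

lemma integral_fejer_interval (z : ℝ) :
    ∫ y in (0 : ℝ)..z, fejer y = ∫ t in (0 : ℝ)..1, (1 - t) * (Real.sin (t * z) / t) := by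
  unfold fejer
  rw [intervalIntegral_intervalIntegral_swap]
  · refine intervalIntegral.integral_congr_ae ?_
    filter_upwards [compl_mem_ae_iff.mpr (measure_singleton (0 : ℝ))] with t ht _
    have ht : t ≠ 0 := ht
    rw [intervalIntegral.integral_const_mul, intervalIntegral.integral_comp_mul_left _ ht]
    simp [div_eq_inv_mul]
  · refine IntegrableOn.mono_set (Continuous.continuousOn ?_ |>.integrableOn_compact
      (isCompact_uIcc.prod isCompact_uIcc))
      (Set.prod_mono Set.uIoc_subset_uIcc Set.uIoc_subset_uIcc)
    fun_prop

/-- The convolution of a distribution function with the rescaled Fejér kernel, as an integral of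
the characteristic function of the measure over a bounded interval. -/
lemma integral_Iic_mul_fejer (μ : Measure ℝ) [IsFiniteMeasure μ] (hμ : Integrable id μ)
    {T : ℝ} (hT : 0 < T) (x : ℝ) :
    IntervalIntegrable (fun t => (1 - t) / t * ∫ w, Real.sin (t * (T * (x - w))) ∂μ) volume 0 1 ∧
    ∫ y, μ.real (Set.Iic (x - y / T)) * fejer y = (∫ y in Set.Iic 0, fejer y) * μ.real Set.univ +
      ∫ t in (0 : ℝ)..1, (1 - t) / t * ∫ w, Real.sin (t * (T * (x - w))) ∂μ := by
  have hK (z : ℝ) : ∫ y in Set.Iic z, fejer y = (∫ y in Set.Iic 0, fejer y) +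
      ∫ t in (0 : ℝ)..1, (1 - t) / t * Real.sin (t * z) := by
    have := intervalIntegral.integral_Iic_sub_Iic (a := 0) (b := z) (f := fejer) (μ := volume)
      integrable_fejer.integrableOn integrable_fejer.integrableOn
    rw [integral_fejer_interval] at this
    rw [← sub_eq_iff_eq_add', this]
    refine intervalIntegral.integral_congr fun t _ => ?_
    ring
  have : IsFiniteMeasure ((volume : Measure ℝ).restrict (Set.uIoc 0 1)) := by
    rw [Set.uIoc_of_le zero_le_one]
    infer_instance
  have hfub : Integrable
      (Function.uncurry fun (t w : ℝ) => (1 - t) / t * Real.sin (t * (T * (x - w))))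
      ((volume.restrict (Set.uIoc 0 1)).prod μ) := by
    have hdom : Integrable (fun p : ℝ × ℝ => T * (|x| + |p.2|))
        ((volume.restrict (Set.uIoc (0 : ℝ) 1)).prod μ) := by
      have h : Integrable (fun w : ℝ => T * (|x| + |w|)) μ :=
        ((integrable_const _).add hμ.abs).const_mul T
      exact h.comp_snd _
    refine hdom.mono' (Measurable.aestronglyMeasurable (by unfold Function.uncurry; fun_prop)) ?_
    have hae : ∀ᵐ p ∂((volume.restrict (Set.uIoc (0 : ℝ) 1)).prod μ), p.1 ∈ Set.uIoc (0 : ℝ) 1 :=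
      Measure.quasiMeasurePreserving_fst.ae (ae_restrict_mem measurableSet_uIoc)
    filter_upwards [hae] with p hp
    rw [Set.uIoc_of_le zero_le_one] at hp
    obtain ⟨h0, h1⟩ := hp
    have h2 : |Real.sin (p.1 * (T * (x - p.2)))| ≤ p.1 * (T * (|x| + |p.2|)) := by
      refine (Real.abs_sin_le_abs).trans ?_
      rw [abs_mul, abs_mul, abs_of_pos h0, abs_of_pos hT]
      gcongr
      exact abs_sub _ _
    simp only [Function.uncurry, Real.norm_eq_abs, abs_mul, abs_div, abs_of_pos h0]
    rw [abs_of_nonneg (by linarith : 0 ≤ 1 - p.1)]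
    calc (1 - p.1) / p.1 * |Real.sin (p.1 * (T * (x - p.2)))|
        ≤ 1 / p.1 * (p.1 * (T * (|x| + |p.2|))) := by gcongr; linarith
      _ = T * (|x| + |p.2|) := by field_simp
  have hI := hfub.integral_prod_left
  refine ⟨?_, ?_⟩
  · rw [intervalIntegrable_iff]
    refine hI.congr (ae_of_all _ fun t => ?_)
    simp only [Function.uncurry]
    rw [integral_const_mul]
  have hswap := intervalIntegral_integral_swap hfub
  have h1 : ∫ y, μ.real (Set.Iic (x - y / T)) * fejer y =
      ∫ y, ∫ w, (Set.Iic (T * (x - w))).indicator fejer y ∂μ := by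
    refine integral_congr_ae (ae_of_all _ fun y => ?_)
    have : (fun w => (Set.Iic (T * (x - w))).indicator fejer y) =
        (Set.Iic (x - y / T)).indicator (fun _ => fejer y) := by
      ext w
      have : y ≤ T * (x - w) ↔ w ≤ x - y / T := by
        rw [le_sub_comm, div_le_iff₀ hT, mul_comm]
      simp [Set.indicator, this]
    simp only [this]
    rw [integral_indicator_const _ measurableSet_Iic, smul_eq_mul]
  rw [h1, integral_integral_swap]
  · simp_rw [integral_indicator (measurableSet_Iic)]
    rw [integral_congr_ae (ae_of_all _ fun w => hK (T * (x - w)))]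
    rw [integral_add (integrable_const _)]
    · rw [integral_const, smul_eq_mul, mul_comm, ← hswap]
      simp_rw [integral_const_mul]
    · have := hfub.integral_prod_right
      refine this.congr (ae_of_all _ fun w => ?_)
      simp only [Function.uncurry]
      rw [intervalIntegral.integral_of_le zero_le_one, Set.uIoc_of_le zero_le_one]
  · have hdom : Integrable (fun p : ℝ × ℝ => fejer p.1) (volume.prod μ) :=
      integrable_fejer.comp_fst μ
    have hm : MeasurableSet {p : ℝ × ℝ | p.1 ≤ T * (x - p.2)} :=
      measurableSet_le (by fun_prop) (by fun_prop)
    refine (hdom.indicator hm).congr (ae_of_all _ fun p => ?_)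
    simp [Set.indicator, Function.uncurry]

lemma integral_sin_eq_im_charFun (μ : Measure ℝ) [IsFiniteMeasure μ] (s x : ℝ) :
    ∫ w, Real.sin (s * (x - w)) ∂μ =
      (Complex.exp (s * x * Complex.I) * (starRingEnd ℂ) (charFun μ s)).im := by
  rw [← charFun_neg, charFun_apply_real, ← integral_const_mul]
  have hint : Integrable (fun w : ℝ => Complex.exp (s * x * Complex.I) *
      Complex.exp (((-s : ℝ) : ℂ) * w * Complex.I)) μ := by
    refine Integrable.of_bound (C := 1) (Continuous.aestronglyMeasurable (by fun_prop))
      (ae_of_all _ fun w => ?_)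
    rw [norm_mul]
    norm_cast
    rw [Complex.norm_exp_ofReal_mul_I, Complex.norm_exp_ofReal_mul_I, one_mul]
  rw [← Complex.imCLM_apply, ← ContinuousLinearMap.integral_comp_comm _ hint]
  refine integral_congr_ae (ae_of_all _ fun w => ?_)
  simp only [Complex.imCLM_apply]
  rw [← Complex.exp_add, ← add_mul]
  norm_cast
  rw [Complex.exp_ofReal_mul_I_im]
  congr 1
  ring

lemma abs_integral_sin_sub_le (μ₁ μ₂ : Measure ℝ) [IsFiniteMeasure μ₁] [IsFiniteMeasure μ₂]
    (s x : ℝ) :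
    |(∫ w, Real.sin (s * (x - w)) ∂μ₁) - ∫ w, Real.sin (s * (x - w)) ∂μ₂| ≤
      ‖charFun μ₁ s - charFun μ₂ s‖ := by
  rw [integral_sin_eq_im_charFun, integral_sin_eq_im_charFun, ← Complex.sub_im, ← mul_sub,
    ← map_sub]
  refine (Complex.abs_im_le_norm _).trans ?_
  rw [norm_mul, RCLike.norm_conj]
  norm_cast
  rw [Complex.norm_exp_ofReal_mul_I, one_mul]

/-- Half of the argument for `exists_abs_le_of_abs_integral_fejer_le`: an upper bound at a point,
using that a function which decreases at rate at most `m` stays large to the right of a point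
where it is large. -/
lemma le_of_integral_fejer_le {D : ℝ → ℝ} {M m a T η : ℝ} (hm : 0 ≤ m) (hT : 0 < T)
    (hD : Measurable D) (hM : ∀ x, |D x| ≤ M) (hlip : ∀ x y, 0 ≤ y → D x - m * y ≤ D (x + y))
    (ha : 0 ≤ a) (hc : 3 / 4 * (∫ y, fejer y) ≤ ∫ y in Set.Icc (-a) a, fejer y)
    (hη : ∀ x, ∫ y, D (x - y / T) * fejer y ≤ η) (x : ℝ) :
    D x ≤ M / 3 + 4 / 3 * (η / (∫ y, fejer y) + 2 * m * a / T) := by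
  set c := ∫ y, fejer y with hcdef
  have hcpos : 0 < c := integral_fejer_pos
  set ca := ∫ y in Set.Icc (-a) a, fejer y with hca
  have hcac : ca ≤ c :=
    setIntegral_le_integral integrable_fejer (ae_of_all _ fejer_nonneg)
  have hInd : Integrable ((Set.Icc (-a) a).indicator fejer) :=
    integrable_fejer.indicator measurableSet_Icc
  have key : ∫ y, ((D x - 2 * m * a / T + M) * (Set.Icc (-a) a).indicator fejer y - M * fejer y) ≤
      ∫ y, D ((x + a / T) - y / T) * fejer y := by
    refine integral_mono ((hInd.const_mul _).sub (integrable_fejer.const_mul _)) ?_ ?_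
    · refine integrable_fejer.bdd_mul (c := M) (Measurable.aestronglyMeasurable (by fun_prop))
        (ae_of_all _ fun y => hM _)
    · intro y
      have hk := fejer_nonneg y
      by_cases hy : y ∈ Set.Icc (-a) a
      · simp only [Set.indicator_of_mem hy]
        have h1 := hlip x ((a - y) / T) (div_nonneg (by linarith [hy.2]) hT.le)
        have h2 : m * ((a - y) / T) ≤ 2 * m * a / T := by
          rw [mul_div_assoc', div_le_div_iff_of_pos_right hT]
          nlinarith [hy.1]
        have h3 : x + (a - y) / T = x + a / T - y / T := by ring
        rw [h3] at h1
        nlinarith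
      · simp only [Set.indicator_of_notMem hy]
        have := (abs_le.mp (hM (x + a / T - y / T))).1
        nlinarith
  rw [integral_sub (hInd.const_mul _) (integrable_fejer.const_mul _), integral_const_mul,
    integral_const_mul, integral_indicator measurableSet_Icc, ← hca, ← hcdef] at key
  have h1 := key.trans (hη _)
  have h2 : 0 ≤ D x + M := by linarith [(abs_le.mp (hM x)).1]
  have h3 : 0 ≤ 2 * m * a / T := by positivity
  have h4 : (D x + M) * (3 / 4 * c) - 2 * m * a / T * c - M * c ≤ η := by
    nlinarith [mul_le_mul_of_nonneg_left hc h2, mul_le_mul_of_nonneg_left hcac h3]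
  have h5 : η / c * c = η := div_mul_cancel₀ _ hcpos.ne'
  have h6 : (D x + M) * (3 / 4) - 2 * m * a / T - M ≤ η / c := by
    rw [le_div_iff₀ hcpos]
    linarith
  linarith

/-- A bounded function that decreases at rate at most `m` is uniformly bounded in terms of its
convolution with a rescaled Fejér kernel. -/
lemma exists_abs_le_of_abs_integral_fejer_le : ∃ C : ℝ, 0 < C ∧
    ∀ (D : ℝ → ℝ) (m T η : ℝ), 0 ≤ m → 0 < T → Measurable D → (∃ M, ∀ x, |D x| ≤ M) →
      (∀ x y, 0 ≤ y → D x - m * y ≤ D (x + y)) →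
      (∀ x, |∫ y, D (x - y / T) * fejer y| ≤ η) → ∀ x, |D x| ≤ C * (η + m / T) := by
  obtain ⟨a, ha, hc⟩ : ∃ a : ℝ, 0 ≤ a ∧
      3 / 4 * (∫ y, fejer y) ≤ ∫ y in Set.Icc (-a) a, fejer y := by
    have h1 : Tendsto (fun a : ℝ => ∫ y in (-a)..a, fejer y) atTop (𝓝 (∫ y, fejer y)) :=
      intervalIntegral_tendsto_integral integrable_fejer tendsto_neg_atTop_atBot tendsto_id
    have h2 := h1.eventually_const_le (u := 3 / 4 * ∫ y, fejer y)
      (by linarith [integral_fejer_pos])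
    obtain ⟨a, h3, h4⟩ := (h2.and (eventually_ge_atTop 0)).exists
    refine ⟨a, h4, ?_⟩
    rwa [integral_Icc_eq_integral_Ioc, ← intervalIntegral.integral_of_le (by linarith)]
  have hcpos := integral_fejer_pos
  refine ⟨2 / (∫ y, fejer y) + 4 * a, by positivity, ?_⟩
  intro D m T η hm hT hD ⟨M₀, hM₀⟩ hlip hη
  have hbdd : BddAbove (Set.range fun x => |D x|) := ⟨M₀, by rintro _ ⟨x, rfl⟩; exact hM₀ x⟩
  set M := ⨆ x, |D x| with hMdef
  have hM (x : ℝ) : |D x| ≤ M := le_ciSup hbdd x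
  have h1 := le_of_integral_fejer_le hm hT hD hM hlip ha hc (fun x => (abs_le.mp (hη x)).2)
  have h2 := le_of_integral_fejer_le (D := fun x => -D (-x)) (M := M) (η := η) hm hT
    (hD.comp measurable_neg).neg
    (fun x => by rw [abs_neg]; exact hM _) (fun x y hy => by
      have := hlip (-(x + y)) y hy
      rw [neg_add, neg_add_cancel_right] at this
      rw [neg_add]
      linarith) ha hc (fun x => by
      have h3 := (abs_le.mp (hη (-x))).1
      rw [← integral_neg_eq_self] at h3
      simp only [fejer_neg] at h3
      simp only [neg_mul, integral_neg]
      have h4 : ∀ y : ℝ, -x - -y / T = -(x - y / T) := fun y => by ring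
      simp only [h4] at h3
      linarith)
  set R := 4 / 3 * (η / (∫ y, fejer y) + 2 * m * a / T) with hR
  have h3 : M ≤ M / 3 + R := by
    refine ciSup_le fun x => ?_
    rw [abs_le]
    have := h2 (-x)
    simp only [neg_neg] at this
    exact ⟨by linarith, h1 x⟩
  have hη0 : 0 ≤ η := (abs_nonneg _).trans (hη 0)
  intro x
  refine (hM x).trans ?_
  have h4 : M ≤ 3 / 2 * R := by linarith
  refine h4.trans ?_
  have h5 : 0 ≤ 2 / (∫ y, fejer y) * (m / T) := by positivity
  have h6 : 0 ≤ 4 * a * η := by positivity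
  have h7 : 3 / 2 * R = 2 / (∫ y, fejer y) * η + 4 * a * (m / T) := by rw [hR]; ring
  rw [h7]
  nlinarith

/-- **Smoothing inequality** of Esseen type for two finite measures of the same mass. -/
theorem exists_abs_measureReal_Iic_sub_le : ∃ C : ℝ, 0 < C ∧
    ∀ (μ₁ μ₂ : Measure ℝ) [IsFiniteMeasure μ₁] [IsFiniteMeasure μ₂] (m T η : ℝ) (h : ℝ → ℝ),
      Integrable id μ₁ → Integrable id μ₂ → μ₁.real Set.univ = μ₂.real Set.univ →
      0 ≤ m → 0 < T →
      (∀ x y, 0 ≤ y → (μ₁.real (Set.Iic x) - μ₂.real (Set.Iic x)) - m * y ≤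
        μ₁.real (Set.Iic (x + y)) - μ₂.real (Set.Iic (x + y))) →
      IntervalIntegrable h volume 0 T →
      (∀ s ∈ Set.Ioc 0 T, ‖charFun μ₁ s - charFun μ₂ s‖ ≤ s * h s) →
      ∫ s in (0 : ℝ)..T, h s ≤ η →
      ∀ x, |μ₁.real (Set.Iic x) - μ₂.real (Set.Iic x)| ≤ C * (η + m / T) := by
  obtain ⟨C, hC, H⟩ := exists_abs_le_of_abs_integral_fejer_le
  refine ⟨C, hC, ?_⟩
  intro μ₁ μ₂ _ _ m T η h hi₁ hi₂ hmass hm hT hlip hh hle hη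
  have hmon (μ : Measure ℝ) [IsFiniteMeasure μ] : Measurable fun x => μ.real (Set.Iic x) :=
    Monotone.measurable fun x y hxy => measureReal_mono (Set.Iic_subset_Iic.mpr hxy)
  refine H _ m T η hm hT ((hmon μ₁).sub (hmon μ₂))
    ⟨μ₁.real Set.univ + μ₂.real Set.univ, fun x => ?_⟩ hlip fun x => ?_
  · refine (abs_sub _ _).trans ?_
    rw [abs_of_nonneg measureReal_nonneg, abs_of_nonneg measureReal_nonneg]
    exact add_le_add (measureReal_mono (Set.subset_univ _)) (measureReal_mono (Set.subset_univ _))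
  · obtain ⟨i₁, e₁⟩ := integral_Iic_mul_fejer μ₁ hi₁ hT x
    obtain ⟨i₂, e₂⟩ := integral_Iic_mul_fejer μ₂ hi₂ hT x
    have hint (μ : Measure ℝ) [IsFiniteMeasure μ] :
        Integrable fun y => μ.real (Set.Iic (x - y / T)) * fejer y := by
      refine integrable_fejer.bdd_mul (c := μ.real Set.univ)
        ((hmon μ).comp (by fun_prop)).aestronglyMeasurable (ae_of_all _ fun y => ?_)
      rw [Real.norm_of_nonneg measureReal_nonneg]
      exact measureReal_mono (Set.subset_univ _)
    simp_rw [sub_mul]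
    rw [integral_sub (hint μ₁) (hint μ₂), e₁, e₂, hmass, add_sub_add_left_eq_sub,
      ← intervalIntegral.integral_sub i₁ i₂]
    have hsub : ∫ t in (0 : ℝ)..1, T * h (t * T) = ∫ s in (0 : ℝ)..T, h s := by
      rw [intervalIntegral.integral_const_mul, intervalIntegral.integral_comp_mul_right _ hT.ne']
      simp [hT.ne']
    rw [← Real.norm_eq_abs]
    refine (intervalIntegral.norm_integral_le_of_norm_le zero_le_one
      (g := fun t => T * h (t * T)) (ae_of_all _ fun t ht => ?_) ?_).trans (hsub.trans_le hη)
    · obtain ⟨h0, h1⟩ := ht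
      have hs : t * T ∈ Set.Ioc 0 T := ⟨by positivity, by nlinarith⟩
      simp only [← mul_assoc]
      rw [← mul_sub, norm_mul, Real.norm_eq_abs, Real.norm_eq_abs,
        abs_of_nonneg (div_nonneg (by linarith) h0.le)]
      have h2 := (abs_integral_sin_sub_le μ₁ μ₂ (t * T) x).trans (hle _ hs)
      calc (1 - t) / t * _ ≤ 1 / t * (t * T * h (t * T)) := by
            gcongr
            linarith
        _ = T * h (t * T) := by field_simp
    · have := (hh.comp_mul_right (c := T)).const_mul T
      simpa [hT.ne'] using this

/-! ### The normal distribution function and its derivatives -/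

lemma phi_eq (x : ℝ) : phi x = (√(2 * Real.pi))⁻¹ * Real.exp (-x ^ 2 / 2) := by
  simp [phi, gaussianPDFReal]

lemma phi_pos (x : ℝ) : 0 < phi x := gaussianPDFReal_pos _ _ _ one_ne_zero

lemma integrable_phi : Integrable phi := integrable_gaussianPDFReal 0 1

lemma hasDerivAt_phi (x : ℝ) : HasDerivAt phi (-x * phi x) x := by
  have h1 : HasDerivAt (fun x : ℝ => -x ^ 2 / 2) (-x) x := by
    refine (((hasDerivAt_pow 2 x).neg).div_const 2).congr_deriv ?_
    simp
    ring
  have h2 := h1.exp.const_mul (√(2 * Real.pi))⁻¹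
  have h3 : phi = fun x => (√(2 * Real.pi))⁻¹ * Real.exp (-x ^ 2 / 2) := funext phi_eq
  rw [phi_eq x, h3]
  refine h2.congr_deriv ?_
  ring

lemma continuous_phi : Continuous phi :=
  continuous_iff_continuousAt.mpr fun x => (hasDerivAt_phi x).continuousAt

lemma deriv_phi (x : ℝ) : deriv phi x = -x * phi x := (hasDerivAt_phi x).deriv

lemma hasDerivAt_neg_mul_phi (x : ℝ) :
    HasDerivAt (fun x => -x * phi x) ((x ^ 2 - 1) * phi x) x := by
  refine ((hasDerivAt_id x).neg.mul (hasDerivAt_phi x)).congr_deriv ?_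
  simp
  ring

lemma hasDerivAt_sq_sub_one_mul_phi (x : ℝ) :
    HasDerivAt (fun x => (x ^ 2 - 1) * phi x) ((3 * x - x ^ 3) * phi x) x := by
  refine (((hasDerivAt_pow 2 x).sub_const 1).mul (hasDerivAt_phi x)).congr_deriv ?_
  simp
  ring

lemma pow_four_add_one_mul_phi_le (x : ℝ) : (1 + x ^ 4) * phi x ≤ 9 := by
  have h0 : (√(2 * Real.pi))⁻¹ ≤ 1 := by
    apply inv_le_one_of_one_le₀
    rw [Real.one_le_sqrt]
    linarith [Real.pi_gt_three]
  have h1 := Real.quadratic_le_exp_of_nonneg (x := x ^ 2 / 2) (by positivity)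
  have h2 : (1 + x ^ 4) ≤ 9 * Real.exp (x ^ 2 / 2) := by nlinarith [sq_nonneg (x ^ 2)]
  have h3 : Real.exp (-x ^ 2 / 2) * Real.exp (x ^ 2 / 2) = 1 := by
    rw [← Real.exp_add]
    ring_nf
    simp
  have h4 := Real.exp_pos (-x ^ 2 / 2)
  rw [phi_eq]
  calc (1 + x ^ 4) * ((√(2 * Real.pi))⁻¹ * Real.exp (-x ^ 2 / 2))
      ≤ (9 * Real.exp (x ^ 2 / 2)) * (1 * Real.exp (-x ^ 2 / 2)) := by gcongr
    _ = 9 := by linear_combination 9 * h3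

lemma abs_mul_phi_le {q c : ℝ} (x : ℝ) (h : |q| ≤ c * (1 + x ^ 4)) (hc : 0 ≤ c) :
    |q * phi x| ≤ 9 * c := by
  rw [abs_mul, abs_of_pos (phi_pos x)]
  nlinarith [pow_four_add_one_mul_phi_le x, phi_pos x]

lemma abs_phi_le (x : ℝ) : |phi x| ≤ 36 := by
  have := abs_mul_phi_le (q := 1) (c := 1) x (by
    rw [abs_one]; nlinarith [sq_nonneg (x ^ 2)]) zero_le_one
  rw [one_mul] at this
  linarith

lemma abs_neg_mul_phi_le (x : ℝ) : |-x * phi x| ≤ 36 := by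
  have := abs_mul_phi_le (q := -x) (c := 1) x (abs_le.mpr (by
    constructor <;> nlinarith [sq_nonneg (x ^ 2), sq_nonneg (x + 1), sq_nonneg (x - 1),
      sq_nonneg (x ^ 2 - 1)])) zero_le_one
  linarith

lemma abs_sq_sub_one_mul_phi_le (x : ℝ) : |(x ^ 2 - 1) * phi x| ≤ 36 := by
  have := abs_mul_phi_le (q := x ^ 2 - 1) (c := 1) x (abs_le.mpr (by
    constructor <;> nlinarith [sq_nonneg (x ^ 2), sq_nonneg x,
      sq_nonneg (x ^ 2 - 1)])) zero_le_one
  linarith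

lemma abs_cubic_mul_phi_le (x : ℝ) : |(3 * x - x ^ 3) * phi x| ≤ 36 := by
  have := abs_mul_phi_le (q := 3 * x - x ^ 3) (c := 4) x (abs_le.mpr (by
    constructor <;> nlinarith [sq_nonneg (x ^ 2), sq_nonneg (x ^ 2 + x), sq_nonneg (x ^ 2 - x),
      sq_nonneg (x + 1), sq_nonneg (x - 1), sq_nonneg x,
      sq_nonneg (x ^ 2 - 1)])) (by norm_num)
  linarith

lemma Phi_eq_measureReal (x : ℝ) : Phi x = (gaussianReal 0 1).real (Set.Iic x) :=
  cdf_eq_real _ x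

lemma Phi_eq_integral (x : ℝ) : Phi x = ∫ y in Set.Iic x, phi y := by
  rw [Phi_eq_measureReal, measureReal_def, gaussianReal_apply_eq_integral _ one_ne_zero,
    ENNReal.toReal_ofReal]
  · rfl
  · exact setIntegral_nonneg measurableSet_Iic fun y _ => (phi_pos y).le

lemma hasDerivAt_Phi (x : ℝ) : HasDerivAt Phi (phi x) x := by
  have h : Phi = fun x => Phi 0 + ∫ y in (0 : ℝ)..x, phi y := by
    ext x
    rw [Phi_eq_integral, Phi_eq_integral, ← intervalIntegral.integral_Iic_sub_Iic
      integrable_phi.integrableOn integrable_phi.integrableOn]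
    ring
  rw [h]
  exact (intervalIntegral.integral_hasDerivAt_right (continuous_phi.intervalIntegrable _ _)
    (continuous_phi.stronglyMeasurableAtFilter _ _) continuous_phi.continuousAt).const_add _

lemma continuous_Phi : Continuous Phi :=
  continuous_iff_continuousAt.mpr fun x => (hasDerivAt_Phi x).continuousAt

lemma Phi_nonneg (x : ℝ) : 0 ≤ Phi x := cdf_nonneg _ x

lemma Phi_le_one (x : ℝ) : Phi x ≤ 1 := cdf_le_one _ x

lemma abs_Phi_sub_le (x y : ℝ) : |Phi x - Phi y| ≤ 1 := by
  rw [abs_le]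
  constructor <;> linarith [Phi_nonneg x, Phi_nonneg y, Phi_le_one x, Phi_le_one y]

/-! ### Taylor bounds -/

lemma norm_le_of_hasDerivAt_le {E : Type*} [NormedAddCommGroup E] [NormedSpace ℝ E] {g g' : ℝ → E}
    {C : ℝ} {k : ℕ} (hC : 0 ≤ C) (hg : ∀ u, HasDerivAt g (g' u) u) (h0 : g 0 = 0)
    (hg' : ∀ u, ‖g' u‖ ≤ C * |u| ^ k) (u : ℝ) : ‖g u‖ ≤ C * |u| ^ (k + 1) := by
  have := (convex_uIcc (0 : ℝ) u).norm_image_sub_le_of_norm_hasDerivWithin_le (f := g) (f' := g')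
    (C := C * |u| ^ k) (fun v _ => (hg v).hasDerivWithinAt) (fun v hv => by
      refine (hg' v).trans ?_
      have : |v| ≤ |u| := by
        simpa using Set.abs_sub_left_of_mem_uIcc hv
      gcongr) Set.left_mem_uIcc Set.right_mem_uIcc
  rw [h0, sub_zero, sub_zero, Real.norm_eq_abs] at this
  rwa [pow_succ, ← mul_assoc]

lemma abs_Phi_taylor_four (x u : ℝ) :
    |Phi (x - u) - Phi x - (u * (-phi x) + u ^ 2 * (1 / 2 * (-x * phi x))
      + u ^ 3 * (-1 / 6 * ((x ^ 2 - 1) * phi x)))| ≤ 36 * u ^ 4 := by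
  have h3 : ∀ u, ‖-((x - u) ^ 2 - 1) * phi (x - u) + (x ^ 2 - 1) * phi x‖ ≤ 36 * |u| ^ 1 :=
    norm_le_of_hasDerivAt_le (k := 0) (g' := fun u => (3 * (x - u) - (x - u) ^ 3) * phi (x - u))
      (by norm_num) (fun u => by
        have := (((hasDerivAt_sq_sub_one_mul_phi (x - u)).comp_const_sub x u).neg).add_const
          ((x ^ 2 - 1) * phi x)
        simp only [neg_neg] at this
        convert this using 1
        ext v
        simp
        ring) (by simp; ring) (fun u => by simpa using abs_cubic_mul_phi_le (x - u))
  have h2 : ∀ u, ‖-(x - u) * phi (x - u) + x * phi x + u * ((x ^ 2 - 1) * phi x)‖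
      ≤ 36 * |u| ^ 2 :=
    norm_le_of_hasDerivAt_le (by norm_num) (fun u => by
        have := (((hasDerivAt_neg_mul_phi (x - u)).comp_const_sub x u).add_const
          (x * phi x)).add ((hasDerivAt_id u).mul_const ((x ^ 2 - 1) * phi x))
        refine this.congr_deriv (?_ : _ = -((x - u) ^ 2 - 1) * phi (x - u) + (x ^ 2 - 1) * phi x)
        ring) (by simp) h3
  have h1 : ∀ u, ‖-phi (x - u) + phi x + u * (x * phi x) + u ^ 2 * (1 / 2 * ((x ^ 2 - 1) * phi x))‖
      ≤ 36 * |u| ^ 3 :=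
    norm_le_of_hasDerivAt_le (by norm_num) (fun u => by
        have := (((((hasDerivAt_phi (x - u)).comp_const_sub x u).neg).add_const
          (phi x)).add ((hasDerivAt_id u).mul_const (x * phi x))).add
          ((hasDerivAt_pow 2 u).mul_const (1 / 2 * ((x ^ 2 - 1) * phi x)))
        refine this.congr_deriv (?_ : _ =
          -(x - u) * phi (x - u) + x * phi x + u * ((x ^ 2 - 1) * phi x))
        push_cast
        ring) (by simp) h2
  have h0 : ∀ u, ‖Phi (x - u) - Phi x - (u * (-phi x) + u ^ 2 * (1 / 2 * (-x * phi x))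
      + u ^ 3 * (-1 / 6 * ((x ^ 2 - 1) * phi x)))‖ ≤ 36 * |u| ^ 4 :=
    norm_le_of_hasDerivAt_le (by norm_num) (fun u => by
        have := (((hasDerivAt_Phi (x - u)).comp_const_sub x u).sub_const
          (Phi x)).sub ((((hasDerivAt_id u).mul_const (-phi x)).add
          ((hasDerivAt_pow 2 u).mul_const (1 / 2 * (-x * phi x)))).add
          ((hasDerivAt_pow 3 u).mul_const (-1 / 6 * ((x ^ 2 - 1) * phi x))))
        refine this.congr_deriv (?_ : _ =
          -phi (x - u) + phi x + u * (x * phi x) + u ^ 2 * (1 / 2 * ((x ^ 2 - 1) * phi x)))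
        push_cast
        ring) (by simp) h1
  have := h0 u
  rwa [Real.norm_eq_abs, Even.pow_abs (by decide)] at this

/-- Integration of a cubic Taylor expansion on `[-1, 1]`: the remainder and the values outside
`[-1, 1]` are both dominated by `R`. -/
lemma norm_integral_sub_moments_le {E : Type*} [NormedAddCommGroup E] [NormedSpace ℝ E]
    [CompleteSpace E] {ν : Measure ℝ} [IsFiniteMeasure ν] {f : ℝ → E} (hf : Integrable f ν)
    (c₁ c₂ c₃ : E)
    {R : ℝ → ℝ} (hR : Integrable R ν)
    (h₁ : ∀ u ∈ Set.Icc (-1 : ℝ) 1, ‖f u - (u • c₁ + u ^ 2 • c₂ + u ^ 3 • c₃)‖ ≤ R u)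
    (h₂ : ∀ u ∉ Set.Icc (-1 : ℝ) 1, ‖f u‖ ≤ R u) :
    ‖(∫ u, f u ∂ν) - ((∫ u in Set.Icc (-1) 1, u ∂ν) • c₁ + (∫ u in Set.Icc (-1) 1, u ^ 2 ∂ν) • c₂
      + (∫ u in Set.Icc (-1) 1, u ^ 3 ∂ν) • c₃)‖ ≤ ∫ u, R u ∂ν := by
  have hI {g : ℝ → E} (hg : Continuous g) : IntegrableOn g (Set.Icc (-1) 1) ν :=
    hg.continuousOn.integrableOn_compact isCompact_Icc
  have hsum : (∫ u in Set.Icc (-1) 1, u ∂ν) • c₁ + (∫ u in Set.Icc (-1) 1, u ^ 2 ∂ν) • c₂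
      + (∫ u in Set.Icc (-1) 1, u ^ 3 ∂ν) • c₃ =
      ∫ u, (Set.Icc (-1 : ℝ) 1).indicator (fun u => u • c₁ + u ^ 2 • c₂ + u ^ 3 • c₃) u ∂ν := by
    rw [integral_indicator measurableSet_Icc, integral_add (hI (by fun_prop)) (hI (by fun_prop)),
      integral_add (hI (by fun_prop)) (hI (by fun_prop)), integral_smul_const,
      integral_smul_const, integral_smul_const]
  rw [hsum, ← integral_sub hf ((hI (by fun_prop)).integrable_indicator measurableSet_Icc)]
  refine norm_integral_le_of_norm_le hR (ae_of_all _ fun u => ?_)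
  by_cases hu : u ∈ Set.Icc (-1 : ℝ) 1
  · simpa only [Set.indicator_of_mem hu] using h₁ u hu
  · simpa only [Set.indicator_of_notMem hu, sub_zero] using h₂ u hu

/-! ### The order of magnitude of the leading term -/

/-- The moment of order `k` of `ν` truncated to `[-1, 1]`. -/
noncomputable def unitMoment (ν : Measure ℝ) (k : ℕ) : ℝ := ∫ u in Set.Icc (-1) 1, u ^ k ∂ν

/-- The rate `δ_n` in terms of the law `ν` of `X / b_n`. -/
noncomputable def scaledRate (ν : Measure ℝ) (n : ℝ) : ℝ :=
  n * ν.real (Set.Icc (-1) 1)ᶜ + n * |unitMoment ν 1| + n * |unitMoment ν 3| + n * unitMoment ν 4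

/-- The leading term in terms of the law `ν` of `X / b_n`; the normalisation of the second
truncated moment of `ν` is built in. -/
noncomputable def scaledLeading (ν : Measure ℝ) (n x : ℝ) : ℝ :=
  n * (∫ u, (Phi (x - u) - Phi x) ∂ν) - 1 / 2 * (-x * phi x)

lemma unitMoment_nonneg (ν : Measure ℝ) {k : ℕ} (hk : Even k) : 0 ≤ unitMoment ν k :=
  integral_nonneg fun _ => hk.pow_nonneg _

lemma integrable_Phi_sub (ν : Measure ℝ) [IsFiniteMeasure ν] (x : ℝ) :
    Integrable (fun u => Phi (x - u) - Phi x) ν :=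
  Integrable.of_bound (C := 1) ((continuous_Phi.comp (by fun_prop)).sub
    continuous_const).aestronglyMeasurable (ae_of_all _ fun _ => abs_Phi_sub_le _ _)

lemma integrable_indicator_pow (ν : Measure ℝ) [IsFiniteMeasure ν] (k : ℕ) :
    Integrable ((Set.Icc (-1 : ℝ) 1).indicator fun u => u ^ k) ν :=
  ((continuous_pow k).continuousOn.integrableOn_compact isCompact_Icc).integrable_indicator
    measurableSet_Icc

lemma integral_indicator_pow (ν : Measure ℝ) (k : ℕ) :
    ∫ u, (Set.Icc (-1 : ℝ) 1).indicator (fun u => u ^ k) u ∂ν = unitMoment ν k :=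
  integral_indicator measurableSet_Icc

lemma integrable_indicator_compl (ν : Measure ℝ) [IsFiniteMeasure ν] :
    Integrable ((Set.Icc (-1 : ℝ) 1)ᶜ.indicator fun _ => (1 : ℝ)) ν :=
  (integrable_const _).indicator measurableSet_Icc.compl

lemma integral_indicator_compl (ν : Measure ℝ) :
    ∫ u, (Set.Icc (-1 : ℝ) 1)ᶜ.indicator (fun _ => (1 : ℝ)) u ∂ν = ν.real (Set.Icc (-1) 1)ᶜ :=
  integral_indicator_one measurableSet_Icc.compl

/-- A cubic Taylor expansion on `[-1, 1]` with remainder `C * u ^ k`, of a function that is bounded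
by `C` outside `[-1, 1]`. -/
lemma norm_mul_integral_sub_moments_le {E : Type*} [NormedAddCommGroup E] [NormedSpace ℝ E]
    [CompleteSpace E] {ν : Measure ℝ} [IsFiniteMeasure ν] {n : ℝ} (hn : 0 ≤ n) {f : ℝ → E}
    (hf : Integrable f ν) (c₁ c₂ c₃ : E) (C : ℝ) (k : ℕ)
    (h₁ : ∀ u ∈ Set.Icc (-1 : ℝ) 1, ‖f u - (u • c₁ + u ^ 2 • c₂ + u ^ 3 • c₃)‖ ≤ C * u ^ k)
    (h₂ : ∀ u, ‖f u‖ ≤ C) :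
    ‖n • (∫ u, f u ∂ν) - ((n * unitMoment ν 1) • c₁ + (n * unitMoment ν 2) • c₂
      + (n * unitMoment ν 3) • c₃)‖ ≤
      C * (n * unitMoment ν k + n * ν.real (Set.Icc (-1) 1)ᶜ) := by
  have hR := ((integrable_indicator_pow ν k).const_mul C).add
    ((integrable_indicator_compl ν).const_mul C)
  have h := norm_integral_sub_moments_le hf c₁ c₂ c₃ hR (fun u hu => by
      simpa [Set.indicator_of_mem hu, Set.indicator_of_notMem (Set.notMem_compl_iff.mpr hu)]
        using h₁ u hu)
    (fun u hu => by
      simpa [Set.indicator_of_notMem hu, Set.indicator_of_mem (Set.mem_compl hu)] using h₂ u)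
  simp only [Pi.add_apply] at h
  rw [integral_add ((integrable_indicator_pow ν k).const_mul C)
    ((integrable_indicator_compl ν).const_mul C), integral_const_mul, integral_const_mul,
    integral_indicator_pow, integral_indicator_compl] at h
  have e : n • (∫ u, f u ∂ν) - ((n * unitMoment ν 1) • c₁ + (n * unitMoment ν 2) • c₂
      + (n * unitMoment ν 3) • c₃) = n • ((∫ u, f u ∂ν) -
      ((∫ u in Set.Icc (-1) 1, u ∂ν) • c₁ + (∫ u in Set.Icc (-1) 1, u ^ 2 ∂ν) • c₂
      + (∫ u in Set.Icc (-1) 1, u ^ 3 ∂ν) • c₃)) := by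
    simp only [unitMoment, pow_one, smul_sub, smul_add, mul_smul]
  rw [e, norm_smul, Real.norm_of_nonneg hn]
  calc _ ≤ n * _ := mul_le_mul_of_nonneg_left h hn
    _ = _ := by ring

lemma abs_scaledLeading_sub_le {ν : Measure ℝ} [IsProbabilityMeasure ν] {n : ℝ} (hn : 0 ≤ n)
    (h2 : n * unitMoment ν 2 = 1) (x : ℝ) :
    |scaledLeading ν n x - (n * unitMoment ν 1 * (-phi x)
      + n * unitMoment ν 3 * (-1 / 6 * ((x ^ 2 - 1) * phi x)))| ≤
      36 * (n * unitMoment ν 4 + n * ν.real (Set.Icc (-1) 1)ᶜ) := by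
  have h := norm_mul_integral_sub_moments_le hn (integrable_Phi_sub ν x) (-phi x)
    (1 / 2 * (-x * phi x)) (-1 / 6 * ((x ^ 2 - 1) * phi x)) 36 4
    (fun u _ => by simpa only [smul_eq_mul, Real.norm_eq_abs] using abs_Phi_taylor_four x u)
    (fun u => (abs_Phi_sub_le _ _).trans (by norm_num))
  simp only [smul_eq_mul, h2, Real.norm_eq_abs] at h
  convert h using 2
  rw [scaledLeading]
  ring

lemma abs_scaledLeading_le {ν : Measure ℝ} [IsProbabilityMeasure ν] {n : ℝ} (hn : 0 ≤ n)
    (h2 : n * unitMoment ν 2 = 1) (x : ℝ) :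
    |scaledLeading ν n x| ≤ 36 * scaledRate ν n := by
  have h := abs_scaledLeading_sub_le hn h2 x
  have h1 : |n * unitMoment ν 1 * (-phi x)| ≤ 36 * (n * |unitMoment ν 1|) := by
    rw [abs_mul, abs_mul, abs_neg, abs_of_nonneg hn, mul_comm]
    exact mul_le_mul_of_nonneg_right (abs_phi_le x) (by positivity)
  have h3 : |n * unitMoment ν 3 * (-1 / 6 * ((x ^ 2 - 1) * phi x))| ≤
      36 * (n * |unitMoment ν 3|) := by
    rw [abs_mul, abs_mul, abs_mul, abs_of_nonneg hn, mul_comm]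
    refine mul_le_mul_of_nonneg_right ?_ (by positivity)
    have := abs_sq_sub_one_mul_phi_le x
    have h6 : |(-1 / 6 : ℝ)| = 1 / 6 := by norm_num [abs_of_neg]
    rw [h6]
    linarith [abs_nonneg ((x ^ 2 - 1) * phi x)]
  have h4 := abs_sub_abs_le_abs_sub (scaledLeading ν n x) (n * unitMoment ν 1 * (-phi x)
      + n * unitMoment ν 3 * (-1 / 6 * ((x ^ 2 - 1) * phi x)))
  have h5 := abs_add_le (n * unitMoment ν 1 * (-phi x))
    (n * unitMoment ν 3 * (-1 / 6 * ((x ^ 2 - 1) * phi x)))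
  rw [scaledRate]
  linarith

/-- Integrating the increments of `Phi` against the derivative of `exp (-a x ^ 2)` gives
`K * (1 - exp (-c u ^ 2))`, since convolving the two Gaussian shapes gives a Gaussian shape; the
second identity is the matching second derivative at `u = 0`. -/
lemma exists_integral_Phi_sub_mul_gaussian {a : ℝ} (ha : 0 < a) : ∃ K : ℝ, 0 < K ∧
    (∀ u, ∫ x, (Phi (x - u) - Phi x) * (-(2 * a * x) * Real.exp (-a * x ^ 2)) =
      K * (1 - Real.exp (-(a / (1 + 2 * a)) * u ^ 2))) ∧
    ∫ x, (-x * phi x) * (-(2 * a * x) * Real.exp (-a * x ^ 2)) = 2 * (a / (1 + 2 * a)) * K := by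
  set b := a + 1 / 2 with hb
  have hbpos : 0 < b := by positivity
  set κ := (√(2 * Real.pi))⁻¹ with hκ
  have hκpos : 0 < κ := by positivity
  have hG : Integrable fun x : ℝ => Real.exp (-b * x ^ 2) := integrable_exp_neg_mul_sq hbpos
  have hGpos : 0 < ∫ x : ℝ, Real.exp (-b * x ^ 2) := by
    rw [integral_gaussian]
    positivity
  have hderiv (a x : ℝ) : HasDerivAt (fun x => Real.exp (-a * x ^ 2))
      (-(2 * a * x) * Real.exp (-a * x ^ 2)) x := by
    refine ((hasDerivAt_pow 2 x).const_mul (-a)).exp.congr_deriv ?_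
    push_cast
    ring
  have hH : Integrable fun x : ℝ => Real.exp (-a * x ^ 2) := integrable_exp_neg_mul_sq ha
  have hH' (a : ℝ) (ha : 0 < a) : Integrable fun x : ℝ => -(2 * a * x) * Real.exp (-a * x ^ 2) := by
    have := (integrable_mul_exp_neg_mul_sq ha).const_mul (-(2 * a))
    refine this.congr (ae_of_all _ fun x => ?_)
    simp only
    ring
  have hconv (u : ℝ) : ∫ x, phi (x - u) * Real.exp (-a * x ^ 2) =
      κ * (∫ x : ℝ, Real.exp (-b * x ^ 2)) * Real.exp (-(a / (1 + 2 * a)) * u ^ 2) := by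
    rw [← integral_sub_right_eq_self (fun x : ℝ => Real.exp (-b * x ^ 2)) (u / (2 * b)),
      ← integral_const_mul, ← integral_mul_const]
    refine integral_congr_ae (ae_of_all _ fun x => ?_)
    simp only
    rw [phi_eq, mul_assoc, mul_assoc, ← Real.exp_add, ← Real.exp_add]
    congr 2
    rw [hb]
    field_simp
    ring
  have hphiH (u : ℝ) : Integrable fun x => phi (x - u) * Real.exp (-a * x ^ 2) := by
    refine hH.bdd_mul (c := 36) (Continuous.aestronglyMeasurable
      (continuous_phi.comp (by fun_prop))) (ae_of_all _ fun x => abs_phi_le _)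
  refine ⟨κ * ∫ x : ℝ, Real.exp (-b * x ^ 2), by positivity, fun u => ?_, ?_⟩
  · have hc : Continuous fun x => Phi (x - u) - Phi x :=
      (continuous_Phi.comp (by fun_prop)).sub continuous_Phi
    have hbd : ∀ᵐ x : ℝ, ‖Phi (x - u) - Phi x‖ ≤ 1 := ae_of_all _ fun x => abs_Phi_sub_le _ _
    have hu' (x : ℝ) : HasDerivAt (fun x => Phi (x - u) - Phi x) (phi (x - u) - phi x) x :=
      ((hasDerivAt_Phi (x - u)).comp_sub_const x u).sub (hasDerivAt_Phi x)
    have hphi0 := hphiH 0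
    have hconv0 := hconv 0
    simp only [sub_zero] at hphi0 hconv0
    have h := integral_mul_deriv_eq_deriv_mul_of_integrable (fun x _ => hu' x)
      (fun x _ => hderiv a x)
      ((hH' a ha).bdd_mul (c := 1) hc.aestronglyMeasurable hbd)
      (by
        refine ((hphiH u).sub hphi0).congr (ae_of_all _ fun x => ?_)
        simp only [Pi.mul_apply, Pi.sub_apply]
        ring)
      (hH.bdd_mul (c := 1) hc.aestronglyMeasurable hbd)
    rw [h]
    simp only [sub_mul]
    rw [integral_sub (hphiH u) hphi0, hconv, hconv0]
    simp
    ring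
  · have h := integral_mul_deriv_eq_deriv_mul_of_integrable (fun x _ => hasDerivAt_id x)
      (fun x _ => hderiv b x) (by
        have := (integrable_rpow_mul_exp_neg_mul_sq (s := 2) hbpos
          (by norm_num)).const_mul (-(2 * b))
        refine this.congr (ae_of_all _ fun x => ?_)
        simp only [Pi.mul_apply, id, Real.rpow_two]
        ring) (by
        refine hG.congr (ae_of_all _ fun x => ?_)
        simp) (by
        refine (integrable_mul_exp_neg_mul_sq hbpos).congr (ae_of_all _ fun x => ?_)
        simp)
    have e : ∫ x, (-x * phi x) * (-(2 * a * x) * Real.exp (-a * x ^ 2)) =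
        ∫ x, -(κ * a / b) * (id x * (-(2 * b * x) * Real.exp (-b * x ^ 2))) := by
      refine integral_congr_ae (ae_of_all _ fun x => ?_)
      have : Real.exp (-b * x ^ 2) = Real.exp (-x ^ 2 / 2) * Real.exp (-a * x ^ 2) := by
        rw [← Real.exp_add, hb]
        ring_nf
      simp only [id]
      rw [phi_eq, this, ← hκ]
      field_simp
    rw [e, integral_const_mul, h]
    simp only [one_mul]
    have : 1 + 2 * a = 2 * b := by rw [hb]; ring
    rw [this]
    field_simp

/-- The functional of `ν` that controls both the tail and the truncated fourth moment is an
integral of the leading term against a fixed integrable function: the combination of two Gaussian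
shapes is chosen so that the second-order terms cancel. -/
lemma exists_mul_integral_sq_le : ∃ C : ℝ, 0 < C ∧
    ∀ (ν : Measure ℝ) [IsProbabilityMeasure ν] (n M : ℝ), (∀ x, |scaledLeading ν n x| ≤ M) →
      n * ∫ u, (1 - Real.exp (-(1 / 8) * u ^ 2)) ^ 2 ∂ν ≤ C * M := by
  obtain ⟨K₁, hK₁, h₁, d₁⟩ := exists_integral_Phi_sub_mul_gaussian (a := 1 / 6) (by norm_num)
  obtain ⟨K₂, hK₂, h₂, d₂⟩ := exists_integral_Phi_sub_mul_gaussian (a := 1 / 2) (by norm_num)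
  have e₁ : (1 / 6 : ℝ) / (1 + 2 * (1 / 6)) = 1 / 8 := by norm_num
  have e₂ : (1 / 2 : ℝ) / (1 + 2 * (1 / 2)) = 1 / 4 := by norm_num
  rw [e₁] at h₁ d₁
  rw [e₂] at h₂ d₂
  have hHint (a : ℝ) (ha : 0 < a) :
      Integrable fun x : ℝ => -(2 * a * x) * Real.exp (-a * x ^ 2) := by
    have := (integrable_mul_exp_neg_mul_sq ha).const_mul (-(2 * a))
    refine this.congr (ae_of_all _ fun x => ?_)
    simp only
    ring
  set g₁ : ℝ → ℝ := fun x => -(2 * (1 / 6) * x) * Real.exp (-(1 / 6) * x ^ 2) with hg₁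
  set g₂ : ℝ → ℝ := fun x => -(2 * (1 / 2) * x) * Real.exp (-(1 / 2) * x ^ 2) with hg₂
  have ig₁ : Integrable g₁ := hHint _ (by norm_num)
  have ig₂ : Integrable g₂ := hHint _ (by norm_num)
  set h : ℝ → ℝ := fun x => 2 / K₁ * g₁ x - 1 / K₂ * g₂ x with hh
  have ih : Integrable h := (ig₁.const_mul _).sub (ig₂.const_mul _)
  have hbdd {f : ℝ → ℝ} (hf : Continuous f) (C : ℝ) (hC : ∀ x, |f x| ≤ C) {g : ℝ → ℝ}
      (hg : Integrable g) : Integrable fun x => f x * g x :=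
    hg.bdd_mul (c := C) hf.aestronglyMeasurable (ae_of_all _ hC)
  have hPhi (u : ℝ) : Continuous fun x => Phi (x - u) - Phi x :=
    (continuous_Phi.comp (by fun_prop)).sub continuous_Phi
  have hphi' : Continuous fun x => -x * phi x := continuous_neg.mul continuous_phi
  have hu (u : ℝ) : ∫ x, (Phi (x - u) - Phi x) * h x = (1 - Real.exp (-(1 / 8) * u ^ 2)) ^ 2 := by
    have e : ∀ x, (Phi (x - u) - Phi x) * h x = 2 / K₁ * ((Phi (x - u) - Phi x) * g₁ x)
        - 1 / K₂ * ((Phi (x - u) - Phi x) * g₂ x) := fun x => by rw [hh]; ring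
    simp only [e]
    rw [integral_sub ((hbdd (hPhi u) 1 (fun x => abs_Phi_sub_le _ _) ig₁).const_mul _)
      ((hbdd (hPhi u) 1 (fun x => abs_Phi_sub_le _ _) ig₂).const_mul _), integral_const_mul,
      integral_const_mul, h₁, h₂]
    have : Real.exp (-(1 / 4) * u ^ 2) = Real.exp (-(1 / 8) * u ^ 2) ^ 2 := by
      rw [← Real.exp_nat_mul]
      congr 1
      push_cast
      ring
    rw [this]
    field_simp
    ring
  have hd : ∫ x, (-x * phi x) * h x = 0 := by
    have e : ∀ x, (-x * phi x) * h x = 2 / K₁ * ((-x * phi x) * g₁ x)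
        - 1 / K₂ * ((-x * phi x) * g₂ x) := fun x => by rw [hh]; ring
    simp only [e]
    rw [integral_sub ((hbdd hphi' 36 abs_neg_mul_phi_le ig₁).const_mul _)
      ((hbdd hphi' 36 abs_neg_mul_phi_le ig₂).const_mul _), integral_const_mul,
      integral_const_mul, d₁, d₂]
    field_simp
    norm_num
  refine ⟨(∫ x, |h x|) + 1, by positivity, ?_⟩
  intro ν _ n M hM
  have hM0 : 0 ≤ M := (abs_nonneg _).trans (hM 0)
  have hfub : Integrable (Function.uncurry fun (x u : ℝ) => (Phi (x - u) - Phi x) * h x)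
      (volume.prod ν) := by
    have hc : Continuous fun p : ℝ × ℝ => Phi (p.1 - p.2) - Phi p.1 :=
      (continuous_Phi.comp (by fun_prop)).sub (continuous_Phi.comp continuous_fst)
    exact (ih.comp_fst ν).bdd_mul (c := 1) hc.aestronglyMeasurable
      (ae_of_all _ fun p => abs_Phi_sub_le _ _)
  have key : n * ∫ u, (1 - Real.exp (-(1 / 8) * u ^ 2)) ^ 2 ∂ν =
      ∫ x, scaledLeading ν n x * h x := by
    have e : ∀ x, scaledLeading ν n x * h x =
        n * (∫ u, (Phi (x - u) - Phi x) * h x ∂ν) - 1 / 2 * ((-x * phi x) * h x) := fun x => by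
      rw [integral_mul_const, scaledLeading]
      ring
    simp only [e]
    have hi : Integrable fun x => ∫ u, (Phi (x - u) - Phi x) * h x ∂ν := hfub.integral_prod_left
    rw [integral_sub (hi.const_mul _) ((hbdd hphi' 36 abs_neg_mul_phi_le ih).const_mul _),
      integral_const_mul, integral_const_mul, hd, integral_integral_swap hfub]
    simp only [hu]
    ring
  rw [key]
  calc ∫ x, scaledLeading ν n x * h x ≤ ‖∫ x, scaledLeading ν n x * h x‖ := le_abs_self _
    _ ≤ ∫ x, M * |h x| := by
        refine norm_integral_le_of_norm_le (ih.abs.const_mul M) (ae_of_all _ fun x => ?_)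
        rw [norm_mul]
        exact mul_le_mul_of_nonneg_right (hM x) (norm_nonneg _)
    _ = (∫ x, |h x|) * M := by rw [integral_const_mul, mul_comm]
    _ ≤ _ := by nlinarith

lemma indicator_pow_four_add_le (u : ℝ) :
    (Set.Icc (-1 : ℝ) 1).indicator (fun u => u ^ 4) u
      + (Set.Icc (-1 : ℝ) 1)ᶜ.indicator (fun _ => (1 : ℝ)) u ≤
      256 * (1 - Real.exp (-(1 / 8) * u ^ 2)) ^ 2 := by
  -- `1 - exp (-t) ≥ t / 2` on `[0, 1]`, from `exp (-t) ≤ 1 / (1 + t)`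
  have h (t : ℝ) (ht : 0 ≤ t) (ht1 : t ≤ 1) : t / 2 ≤ 1 - Real.exp (-t) := by
    have h1 := Real.add_one_le_exp t
    have h2 : Real.exp (-t) ≤ (1 + t)⁻¹ := by
      rw [Real.exp_neg]
      exact inv_anti₀ (by linarith) (by linarith)
    have h3 : (1 + t)⁻¹ ≤ 1 - t / 2 := by
      rw [inv_le_iff_one_le_mul₀ (by linarith)]
      nlinarith
    linarith
  by_cases hu : u ∈ Set.Icc (-1 : ℝ) 1
  · rw [Set.indicator_of_mem hu, Set.indicator_of_notMem (Set.notMem_compl_iff.mpr hu)]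
    have h1 : u ^ 2 ≤ 1 := by nlinarith [hu.1, hu.2]
    have h2 := h (1 / 8 * u ^ 2) (by positivity) (by linarith)
    rw [neg_mul]
    nlinarith [sq_nonneg u]
  · rw [Set.indicator_of_notMem hu, Set.indicator_of_mem (Set.mem_compl hu)]
    have h1 : 1 ≤ u ^ 2 := by
      rw [← sq_abs]
      have : 1 ≤ |u| := by
        by_contra! hlt
        exact hu (abs_le.mp hlt.le)
      nlinarith
    have h2 := h (1 / 8) (by norm_num) (by norm_num)
    have h3 : Real.exp (-(1 / 8) * u ^ 2) ≤ Real.exp (-(1 / 8)) :=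
      Real.exp_le_exp.mpr (by nlinarith)
    nlinarith

/-- The leading term is uniformly at least of the order of the rate. -/
theorem exists_scaledRate_le : ∃ C : ℝ, 0 < C ∧
    ∀ (ν : Measure ℝ) [IsProbabilityMeasure ν] (n M : ℝ), 0 ≤ n → n * unitMoment ν 2 = 1 →
      (∀ x, |scaledLeading ν n x| ≤ M) → scaledRate ν n ≤ C * M := by
  obtain ⟨C, hC, H⟩ := exists_mul_integral_sq_le
  have hp0 := phi_pos 0
  have hp1 := phi_pos 1
  refine ⟨256 * C + (1 + 36 * (256 * C)) / phi 1 +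
    6 * ((1 + 36 * (256 * C)) / phi 0 + (1 + 36 * (256 * C)) / phi 1), by positivity, ?_⟩
  intro ν _ n M hn h2 hM
  have hM0 : 0 ≤ M := (abs_nonneg _).trans (hM 0)
  have h4 : n * unitMoment ν 4 + n * ν.real (Set.Icc (-1) 1)ᶜ ≤ 256 * C * M := by
    have h := H ν n M hM
    have hint : Integrable (fun u : ℝ => 256 * (1 - Real.exp (-(1 / 8) * u ^ 2)) ^ 2) ν := by
      refine Integrable.of_bound (C := 256) (Continuous.aestronglyMeasurable (by fun_prop))
        (ae_of_all _ fun u => ?_)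
      have h1 : Real.exp (-(1 / 8) * u ^ 2) ≤ 1 :=
        Real.exp_le_one_iff.mpr (by nlinarith [sq_nonneg u])
      have h2 := Real.exp_pos (-(1 / 8) * u ^ 2)
      rw [Real.norm_of_nonneg (by positivity)]
      nlinarith
    have h3 := integral_mono
      ((integrable_indicator_pow ν 4).add (integrable_indicator_compl ν)) hint
      (fun u => indicator_pow_four_add_le u)
    simp only [Pi.add_apply] at h3
    rw [integral_add (integrable_indicator_pow ν 4) (integrable_indicator_compl ν),
      integral_indicator_pow, integral_indicator_compl, integral_const_mul] at h3
    nlinarith [mul_le_mul_of_nonneg_left h3 hn]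
  set E := 256 * C * M with hE
  -- at `x = 1` the third moment drops out of the expansion of the leading term
  have h1 : n * |unitMoment ν 1| * phi 1 ≤ M + 36 * E := by
    have h := abs_scaledLeading_sub_le hn h2 1
    have e : n * |unitMoment ν 1| * phi 1 = |n * unitMoment ν 1 * (-phi 1)
        + n * unitMoment ν 3 * (-1 / 6 * (((1 : ℝ) ^ 2 - 1) * phi 1))| := by
      rw [one_pow, sub_self, zero_mul, mul_zero, mul_zero, add_zero, abs_mul, abs_mul, abs_neg,
        abs_of_pos hp1, abs_of_nonneg hn]
    rw [e]
    have h5 := abs_sub_abs_le_abs_sub (n * unitMoment ν 1 * (-phi 1)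
        + n * unitMoment ν 3 * (-1 / 6 * (((1 : ℝ) ^ 2 - 1) * phi 1))) (scaledLeading ν n 1)
    rw [abs_sub_comm] at h5
    linarith [hM 1]
  have h0 : |n * unitMoment ν 1 - n * unitMoment ν 3 / 6| * phi 0 ≤ M + 36 * E := by
    have h := abs_scaledLeading_sub_le hn h2 0
    have e : |n * unitMoment ν 1 - n * unitMoment ν 3 / 6| * phi 0 = |n * unitMoment ν 1 * (-phi 0)
        + n * unitMoment ν 3 * (-1 / 6 * (((0 : ℝ) ^ 2 - 1) * phi 0))| := by
      nth_rw 1 [← abs_of_pos hp0]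
      rw [← abs_mul, ← abs_neg]
      congr 1
      ring
    rw [e]
    have h5 := abs_sub_abs_le_abs_sub (n * unitMoment ν 1 * (-phi 0)
        + n * unitMoment ν 3 * (-1 / 6 * (((0 : ℝ) ^ 2 - 1) * phi 0))) (scaledLeading ν n 0)
    rw [abs_sub_comm] at h5
    linarith [hM 0]
  have hF : M + 36 * E = (1 + 36 * (256 * C)) * M := by rw [hE]; ring
  rw [hF] at h0 h1
  rw [← le_div_iff₀ hp0] at h0
  rw [← le_div_iff₀ hp1] at h1
  have h3 : n * |unitMoment ν 3| ≤
      6 * ((1 + 36 * (256 * C)) * M / phi 0 + (1 + 36 * (256 * C)) * M / phi 1) := by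
    have e : n * |unitMoment ν 3| = 6 * |n * unitMoment ν 1 -
        (n * unitMoment ν 1 - n * unitMoment ν 3 / 6)| := by
      rw [sub_sub_cancel, abs_div, abs_mul, abs_of_nonneg hn]
      norm_num
      ring
    have h5 := abs_sub (n * unitMoment ν 1) (n * unitMoment ν 1 - n * unitMoment ν 3 / 6)
    rw [abs_mul, abs_of_nonneg hn] at h5
    linarith
  rw [scaledRate]
  have hfin : n * ν.real (Set.Icc (-1) 1)ᶜ + n * |unitMoment ν 1| + n * |unitMoment ν 3| +
      n * unitMoment ν 4 ≤ E + (1 + 36 * (256 * C)) * M / phi 1 +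
      6 * ((1 + 36 * (256 * C)) * M / phi 0 + (1 + 36 * (256 * C)) * M / phi 1) := by linarith
  refine hfin.trans (le_of_eq ?_)
  rw [hE]
  ring

/-! ### Symmetrisation and vanishing mass at large distances -/

/-- The symmetrisation of `μ`: the law of the difference of two independent variables with
law `μ`. -/
noncomputable def symmetrization (μ : Measure ℝ) : Measure ℝ := μ ∗ μ.map (fun x => -x)

instance (μ : Measure ℝ) [IsProbabilityMeasure μ] : IsProbabilityMeasure (symmetrization μ) := by
  have : IsProbabilityMeasure (μ.map (fun x => -x)) :=
    Measure.isProbabilityMeasure_map measurable_neg.aemeasurable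
  unfold symmetrization
  infer_instance

lemma charFun_symmetrization (μ : Measure ℝ) [IsProbabilityMeasure μ] (t : ℝ) :
    charFun (symmetrization μ) t = ((‖charFun μ t‖ ^ 2 : ℝ) : ℂ) := by
  have : IsProbabilityMeasure (μ.map (fun x => -x)) :=
    Measure.isProbabilityMeasure_map measurable_neg.aemeasurable
  have h : charFun (μ.map (fun x => -x)) t = charFun μ (-t) := by
    have := charFun_map_mul (μ := μ) (-1) t
    simpa using this
  rw [symmetrization, charFun_conv, h, charFun_neg, Complex.mul_conj, Complex.normSq_eq_norm_sq]

lemma integrable_one_sub_cos (ρ : Measure ℝ) [IsFiniteMeasure ρ] (t : ℝ) :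
    Integrable (fun u => 1 - Real.cos (t * u)) ρ := by
  refine Integrable.of_bound (C := 2) (Continuous.aestronglyMeasurable (by fun_prop))
    (ae_of_all _ fun u => ?_)
  rw [Real.norm_eq_abs, abs_le]
  constructor <;> linarith [Real.cos_le_one (t * u), Real.neg_one_le_cos (t * u)]

lemma integral_cos_eq_re_charFun (ρ : Measure ℝ) [IsFiniteMeasure ρ] (t : ℝ) :
    ∫ u, Real.cos (t * u) ∂ρ = (charFun ρ t).re := by
  have hint : Integrable (fun u : ℝ => Complex.exp (t * u * Complex.I)) ρ := by
    refine Integrable.of_bound (C := 1) (Continuous.aestronglyMeasurable (by fun_prop))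
      (ae_of_all _ fun w => ?_)
    norm_cast
    rw [Complex.norm_exp_ofReal_mul_I]
  rw [charFun_apply_real, ← Complex.reCLM_apply, ← ContinuousLinearMap.integral_comp_comm _ hint]
  refine integral_congr_ae (ae_of_all _ fun w => ?_)
  simp only [Complex.reCLM_apply]
  norm_cast
  rw [Complex.exp_ofReal_mul_I_re]

lemma integral_one_sub_cos_symmetrization (μ : Measure ℝ) [IsProbabilityMeasure μ] (t : ℝ) :
    ∫ u, (1 - Real.cos (t * u)) ∂(symmetrization μ) = 1 - ‖charFun μ t‖ ^ 2 := by
  rw [integral_sub (integrable_const _), integral_cos_eq_re_charFun, charFun_symmetrization]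
  · simp
    norm_cast
  · have := (integrable_const (1 : ℝ)).sub (integrable_one_sub_cos (symmetrization μ) t)
    refine this.congr (ae_of_all _ fun u => ?_)
    simp

lemma mul_one_sub_le_neg_log_pow {r : ℝ} (hr : 0 < r) (n : ℕ) :
    n * (1 - r) ≤ -Real.log (r ^ n) := by
  rw [Real.log_pow, ← mul_neg]
  exact mul_le_mul_of_nonneg_left (by linarith [Real.log_le_sub_one_of_pos hr]) (Nat.cast_nonneg n)

lemma tendsto_mul_one_sub_of_tendsto_pow {r : ℕ → ℝ} {L : ℝ} (h0 : ∀ n, 0 ≤ r n)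
    (h : Tendsto (fun n => r n ^ n) atTop (𝓝 (Real.exp (-L)))) :
    Tendsto (fun n : ℕ => n * (1 - r n)) atTop (𝓝 L) := by
  have hlog : Tendsto (fun n => -Real.log (r n ^ n)) atTop (𝓝 L) := by
    simpa using (h.log (Real.exp_pos _).ne').neg
  have hpos : ∀ᶠ n in atTop, 0 < r n := by
    filter_upwards [h.eventually_const_lt (Real.exp_pos _), eventually_ge_atTop 1] with n hn hn1
    exact lt_of_le_of_ne (h0 n) fun h => by
      rw [← h, zero_pow (by omega)] at hn
      exact lt_irrefl _ hn
  have hr1 : Tendsto r atTop (𝓝 1) := by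
    have h1 : Tendsto (fun n : ℕ => Real.exp (-(-Real.log (r n ^ n) / n))) atTop
        (𝓝 (Real.exp (-0))) :=
      (Real.continuous_exp.tendsto _).comp
        (hlog.div_atTop tendsto_natCast_atTop_atTop).neg
    rw [neg_zero, Real.exp_zero] at h1
    refine h1.congr' ?_
    filter_upwards [hpos, eventually_ge_atTop 1] with n hn hn1
    have : (n : ℝ) ≠ 0 := by positivity
    rw [Real.log_pow, neg_div, neg_neg, mul_div_cancel_left₀ _ this, Real.exp_log hn]
  have hlow := hr1.mul hlog
  rw [one_mul] at hlow
  refine tendsto_of_tendsto_of_tendsto_of_le_of_le' hlow hlog ?_ ?_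
  · filter_upwards [hpos] with n hn
    have h1 := Real.log_le_sub_one_of_pos (inv_pos.mpr hn)
    rw [Real.log_inv] at h1
    rw [Real.log_pow]
    have h2 : r n * -Real.log (r n) ≤ 1 - r n := by
      calc r n * -Real.log (r n) ≤ r n * ((r n)⁻¹ - 1) := by gcongr
        _ = 1 - r n := by field_simp
    calc r n * -(n * Real.log (r n)) = n * (r n * -Real.log (r n)) := by ring
      _ ≤ n * (1 - r n) := by gcongr
  · filter_upwards [hpos] with n hn
    exact mul_one_sub_le_neg_log_pow hn n

lemma one_sub_cos_sq (x : ℝ) :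
    (1 - Real.cos x) ^ 2 = 2 * (1 - Real.cos x) - 1 / 2 * (1 - Real.cos (2 * x)) := by
  rw [Real.cos_two_mul]
  ring

/-- Away from `0`, a single value of `(1 - cos (t v)) ^ 2` together with its average over a short
interval of frequencies is bounded below: the average handles large `v`, the single value the
remaining bounded window. -/
lemma exists_one_le_one_sub_cos_sq {ε δ : ℝ} (hε : 0 < ε) (hδ : 0 < δ) : ∃ A B t : ℝ,
    0 ≤ A ∧ 0 ≤ B ∧ ∀ v, ε < |v| → 1 ≤ A * (1 - Real.cos (t * v)) ^ 2 +
      B * ∫ τ in (0 : ℝ)..δ, (1 - Real.cos (τ * v)) ^ 2 := by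
  -- the average over `[0, δ]` is at least `1` for `|v| > R`, and `t = π / R` keeps `|t v| ≤ π` for
  -- `|v| ≤ R`, where `1 - cos` is bounded below quadratically
  set R := 8 / δ with hR
  have hRpos : 0 < R := by positivity
  set t := Real.pi / R with ht
  have htpos : 0 < t := by have := Real.pi_pos; positivity
  set c := 2 / Real.pi ^ 2 * (t * ε) ^ 2 with hc
  have hcpos : 0 < c := by have := Real.pi_pos; positivity
  refine ⟨1 / c ^ 2, 1 / δ, t, by positivity, by positivity, fun v hv => ?_⟩
  have hint0 : 0 ≤ ∫ τ in (0 : ℝ)..δ, (1 - Real.cos (τ * v)) ^ 2 :=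
    intervalIntegral.integral_nonneg hδ.le fun _ _ => sq_nonneg _
  by_cases hvR : |v| ≤ R
  · have h1 : |t * v| ≤ Real.pi := by
      rw [abs_mul, abs_of_pos htpos, ht]
      calc Real.pi / R * |v| ≤ Real.pi / R * R := by
            have := Real.pi_pos
            gcongr
        _ = Real.pi := by field_simp
    have h2 := Real.cos_le_one_sub_mul_cos_sq h1
    have h3 : (t * ε) ^ 2 ≤ (t * v) ^ 2 := by
      rw [sq_le_sq, abs_mul, abs_mul, abs_of_pos hε]
      gcongr
    have h4 : c ≤ 1 - Real.cos (t * v) := by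
      have : c ≤ 2 / Real.pi ^ 2 * (t * v) ^ 2 := by rw [hc]; gcongr
      linarith
    have h5 : 1 ≤ 1 / c ^ 2 * (1 - Real.cos (t * v)) ^ 2 := by
      rw [one_div, ← div_eq_inv_mul, one_le_div (by positivity)]
      gcongr
    have : 0 ≤ 1 / δ * ∫ τ in (0 : ℝ)..δ, (1 - Real.cos (τ * v)) ^ 2 := by positivity
    linarith
  · rw [not_le] at hvR
    have hv0 : v ≠ 0 := fun h => by
      rw [h, abs_zero] at hvR
      linarith
    have hval : ∫ τ in (0 : ℝ)..δ, (1 - Real.cos (τ * v)) ^ 2 =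
        3 / 2 * δ - 2 * (Real.sin (δ * v) / v) + 1 / 4 * (Real.sin (2 * (δ * v)) / v) := by
      have hd : ∀ τ ∈ Set.uIcc 0 δ, HasDerivAt (fun τ => 3 / 2 * τ - 2 * (Real.sin (τ * v) / v) +
          1 / 4 * (Real.sin (2 * (τ * v)) / v)) ((1 - Real.cos (τ * v)) ^ 2) τ := by
        intro τ _
        have h1 : HasDerivAt (fun t : ℝ => t * v) v τ := by
          simpa using (hasDerivAt_id τ).mul_const v
        refine ((((hasDerivAt_id τ).const_mul (3 / 2)).sub ((h1.sin.div_const v).const_mul 2)).add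
          (((h1.const_mul 2).sin.div_const v).const_mul (1 / 4))).congr_deriv ?_
        rw [one_sub_cos_sq]
        field_simp
        ring
      rw [intervalIntegral.integral_eq_sub_of_hasDerivAt hd
        (Continuous.intervalIntegrable (by fun_prop) _ _)]
      simp
    have hsin (x : ℝ) : |Real.sin x / v| ≤ δ / 8 := by
      rw [abs_div, div_le_iff₀ (abs_pos.mpr hv0)]
      have h1 : 8 < δ * |v| := by
        rw [hR, div_lt_iff₀ hδ] at hvR
        linarith
      linarith [Real.abs_sin_le_one x]
    have h1 := abs_le.mp (hsin (δ * v))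
    have h2 := abs_le.mp (hsin (2 * (δ * v)))
    have h3 : δ ≤ ∫ τ in (0 : ℝ)..δ, (1 - Real.cos (τ * v)) ^ 2 := by
      rw [hval]
      linarith
    have h4 : 1 ≤ 1 / δ * ∫ τ in (0 : ℝ)..δ, (1 - Real.cos (τ * v)) ^ 2 := by
      rw [one_div, ← div_eq_inv_mul, one_le_div hδ]
      exact h3
    have : 0 ≤ 1 / c ^ 2 * (1 - Real.cos (t * v)) ^ 2 := by positivity
    linarith

lemma integral_one_sub_cos_sq (ρ : Measure ℝ) [IsFiniteMeasure ρ] (t : ℝ) :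
    ∫ u, (1 - Real.cos (t * u)) ^ 2 ∂ρ =
      2 * ∫ u, (1 - Real.cos (t * u)) ∂ρ - 1 / 2 * ∫ u, (1 - Real.cos (2 * t * u)) ∂ρ := by
  simp_rw [one_sub_cos_sq, ← mul_assoc]
  rw [integral_sub ((integrable_one_sub_cos ρ t).const_mul _)
    ((integrable_one_sub_cos ρ (2 * t)).const_mul _), integral_const_mul, integral_const_mul]

lemma integrable_one_sub_cos_sq (ρ : Measure ℝ) [IsFiniteMeasure ρ] (t : ℝ) :
    Integrable (fun u => (1 - Real.cos (t * u)) ^ 2) ρ := by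
  simp_rw [one_sub_cos_sq, ← mul_assoc]
  exact ((integrable_one_sub_cos ρ t).const_mul _).sub
    ((integrable_one_sub_cos ρ (2 * t)).const_mul _)

/-- If `n ∫ (1 - cos (t u / a n)) dρ` tends to `t ^ 2`, boundedly near `t = 0`, then the mass of
`n ρ` at distances beyond `ε a n` tends to zero. -/
lemma tendsto_mul_measureReal_compl_Icc {ρ : Measure ℝ} [IsProbabilityMeasure ρ] {a : ℕ → ℝ}
    (ha : ∀ n, 0 < a n)
    (hlim : ∀ t, Tendsto (fun n : ℕ => (n : ℝ) * ∫ u, (1 - Real.cos (t / a n * u)) ∂ρ) atTop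
      (𝓝 (t ^ 2)))
    {δ : ℝ} (hδ : 0 < δ)
    (hbdd : ∀ᶠ n : ℕ in atTop, ∀ t ∈ Set.Icc 0 δ,
      (n : ℝ) * ∫ u, (1 - Real.cos (t / a n * u)) ∂ρ ≤ 1) {ε : ℝ} (hε : 0 < ε) :
    Tendsto (fun n : ℕ => n * ρ.real (Set.Icc (-(ε * a n)) (ε * a n))ᶜ) atTop (𝓝 0) := by
  obtain ⟨A, B, t, hA, hB, H⟩ := exists_one_le_one_sub_cos_sq hε hδ
  have hsq (t : ℝ) : Tendsto (fun n : ℕ => (n : ℝ) * ∫ u, (1 - Real.cos (t / a n * u)) ^ 2 ∂ρ) atTop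
      (𝓝 0) := by
    have h := ((hlim t).const_mul 2).sub ((hlim (2 * t)).const_mul (1 / 2))
    -- the quadratic limit is annihilated by the identity for `(1 - cos) ^ 2`
    have e : 2 * t ^ 2 - 1 / 2 * (2 * t) ^ 2 = 0 := by ring
    rw [e] at h
    refine h.congr fun n => ?_
    rw [integral_one_sub_cos_sq, mul_div_assoc]
    ring
  have hmeas (n : ℕ) :
      Measurable fun t : ℝ => (n : ℝ) * ∫ u, (1 - Real.cos (t / a n * u)) ^ 2 ∂ρ := by
    refine Measurable.const_mul (StronglyMeasurable.measurable ?_) _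
    exact StronglyMeasurable.integral_prod_right
      (f := fun t u : ℝ => (1 - Real.cos (t / a n * u)) ^ 2)
      (Continuous.stronglyMeasurable (by unfold Function.uncurry; fun_prop))
  have hdct : Tendsto (fun n : ℕ => ∫ τ in (0 : ℝ)..δ,
      ((n : ℝ) * ∫ u, (1 - Real.cos (τ / a n * u)) ^ 2 ∂ρ)) atTop (𝓝 0) := by
    have h := intervalIntegral.tendsto_integral_filter_of_dominated_convergence
      (μ := volume) (a := 0) (b := δ) (l := atTop)
      (F := fun (n : ℕ) τ => (n : ℝ) * ∫ u, (1 - Real.cos (τ / a n * u)) ^ 2 ∂ρ) (f := fun _ => 0)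
      (fun _ => 2) (Eventually.of_forall fun n => (hmeas n).aestronglyMeasurable) ?_ (by simp)
      (ae_of_all _ fun τ _ => hsq τ)
    · simpa using h
    · filter_upwards [hbdd] with n hn
      refine ae_of_all _ fun τ hτ => ?_
      rw [Set.uIoc_of_le hδ.le] at hτ
      have h0 : 0 ≤ ∫ u, (1 - Real.cos (τ / a n * u)) ^ 2 ∂ρ :=
        integral_nonneg fun _ => sq_nonneg _
      rw [Real.norm_of_nonneg (by positivity), integral_one_sub_cos_sq]
      have h1 := hn τ ⟨hτ.1.le, hτ.2⟩
      have h2 : 0 ≤ ∫ u, (1 - Real.cos (2 * (τ / a n) * u)) ∂ρ :=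
        integral_nonneg fun u => by
          simp only [Pi.zero_apply]
          linarith [Real.cos_le_one (2 * (τ / a n) * u)]
      have h3 : 0 ≤ (n : ℝ) * ∫ u, (1 - Real.cos (2 * (τ / a n) * u)) ∂ρ := by positivity
      linarith
  have hup := ((hsq t).const_mul A).add (hdct.const_mul B)
  rw [mul_zero, mul_zero, add_zero] at hup
  refine squeeze_zero (fun n => by positivity) (fun n => ?_) hup
  have hfub : Integrable (Function.uncurry fun (τ u : ℝ) => (1 - Real.cos (τ / a n * u)) ^ 2)
      ((volume.restrict (Set.uIoc 0 δ)).prod ρ) := by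
    have : IsFiniteMeasure ((volume : Measure ℝ).restrict (Set.uIoc 0 δ)) := by
      rw [Set.uIoc_of_le hδ.le]
      infer_instance
    refine Integrable.of_bound (C := 4) (Continuous.aestronglyMeasurable
      (by unfold Function.uncurry; fun_prop)) (ae_of_all _ fun p => ?_)
    simp only [Function.uncurry]
    rw [Real.norm_of_nonneg (sq_nonneg _)]
    nlinarith [Real.cos_le_one (p.1 / a n * p.2), Real.neg_one_le_cos (p.1 / a n * p.2)]
  have hint2 : Integrable (fun u => ∫ τ in (0 : ℝ)..δ, (1 - Real.cos (τ / a n * u)) ^ 2) ρ := by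
    refine hfub.integral_prod_right.congr (ae_of_all _ fun u => ?_)
    simp only [Function.uncurry]
    rw [intervalIntegral.integral_of_le hδ.le, Set.uIoc_of_le hδ.le]
  rw [intervalIntegral.integral_const_mul, intervalIntegral_integral_swap hfub]
  have key : ρ.real (Set.Icc (-(ε * a n)) (ε * a n))ᶜ ≤
      ∫ u, (A * (1 - Real.cos (t / a n * u)) ^ 2 +
        B * ∫ τ in (0 : ℝ)..δ, (1 - Real.cos (τ / a n * u)) ^ 2) ∂ρ := by
    rw [← integral_indicator_one measurableSet_Icc.compl]
    refine integral_mono ((integrable_const _).indicator measurableSet_Icc.compl)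
      (((integrable_one_sub_cos_sq ρ _).const_mul A).add (hint2.const_mul B)) fun u => ?_
    have h0 : 0 ≤ ∫ τ in (0 : ℝ)..δ, (1 - Real.cos (τ / a n * u)) ^ 2 :=
      intervalIntegral.integral_nonneg hδ.le fun _ _ => sq_nonneg _
    by_cases hu : u ∈ (Set.Icc (-(ε * a n)) (ε * a n))ᶜ
    · rw [Set.indicator_of_mem hu]
      have h1 : ε < |u / a n| := by
        rw [abs_div, abs_of_pos (ha n), lt_div_iff₀ (ha n)]
        by_contra! hle
        exact hu (abs_le.mp hle)
      have h2 := H (u / a n) h1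
      simp only [mul_div_assoc', div_mul_eq_mul_div] at h2 ⊢
      exact h2
    · rw [Set.indicator_of_notMem hu]
      positivity
  rw [integral_add ((integrable_one_sub_cos_sq ρ _).const_mul A) (hint2.const_mul B),
    integral_const_mul, integral_const_mul] at key
  have := mul_le_mul_of_nonneg_left key (Nat.cast_nonneg n : (0 : ℝ) ≤ n)
  linarith

/-! ### Passing from the norming sequence to all arguments -/

/-- The truncated second moment divided by `x ^ 2`, in the form `E min (U ^ 2 / x ^ 2, 1)` which is
monotone in `x`. -/
noncomputable def minMoment (ρ : Measure ℝ) (x : ℝ) : ℝ := ∫ u, min ((u / x) ^ 2) 1 ∂ρ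

lemma integrable_min_sq (ρ : Measure ℝ) [IsFiniteMeasure ρ] (x : ℝ) :
    Integrable (fun u => min ((u / x) ^ 2) 1) ρ := by
  refine Integrable.of_bound (C := 1) (Continuous.aestronglyMeasurable (by fun_prop))
    (ae_of_all _ fun u => ?_)
  rw [Real.norm_of_nonneg (le_min (sq_nonneg _) zero_le_one)]
  exact min_le_right _ _

lemma minMoment_nonneg (ρ : Measure ℝ) (x : ℝ) : 0 ≤ minMoment ρ x :=
  integral_nonneg fun _ => le_min (sq_nonneg _) zero_le_one

lemma minMoment_antitone (ρ : Measure ℝ) [IsFiniteMeasure ρ] {x y : ℝ} (hx : 0 < x) (hxy : x ≤ y) :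
    minMoment ρ y ≤ minMoment ρ x := by
  refine integral_mono (integrable_min_sq ρ y) (integrable_min_sq ρ x) fun u => ?_
  refine min_le_min_right _ ?_
  rw [div_pow, div_pow]
  gcongr

lemma sq_mul_minMoment_mono (ρ : Measure ℝ) [IsFiniteMeasure ρ] {x y : ℝ} (hx : 0 < x)
    (hxy : x ≤ y) : x ^ 2 * minMoment ρ x ≤ y ^ 2 * minMoment ρ y := by
  have hy : 0 < y := hx.trans_le hxy
  rw [minMoment, minMoment, ← integral_const_mul, ← integral_const_mul]
  refine integral_mono ((integrable_min_sq ρ x).const_mul _) ((integrable_min_sq ρ y).const_mul _)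
    fun u => ?_
  simp only
  rw [mul_min_of_nonneg _ _ (sq_nonneg x), mul_min_of_nonneg _ _ (sq_nonneg y), div_pow, div_pow,
    mul_div_cancel₀ _ (by positivity), mul_div_cancel₀ _ (by positivity)]
  refine min_le_min_left _ ?_
  rw [mul_one, mul_one]
  gcongr

lemma sq_le_mul_one_sub_cos {v : ℝ} (hv : |v| ≤ 1) : v ^ 2 ≤ 5 / 2 * (1 - Real.cos v) := by
  have h := (abs_le.mp (Real.cos_bound hv)).2
  have h1 : v ^ 2 ≤ 1 := by rw [← sq_abs]; nlinarith [abs_nonneg v]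
  have h2 : |v| ^ 4 = v ^ 2 * v ^ 2 := by rw [Even.pow_abs (by decide)]; ring
  rw [h2] at h
  nlinarith [sq_nonneg v]

lemma integral_one_sub_cos_le_minMoment (ρ : Measure ℝ) [IsFiniteMeasure ρ] (x : ℝ) :
    ∫ u, (1 - Real.cos (1 / x * u)) ∂ρ ≤ 2 * minMoment ρ x := by
  rw [minMoment, ← integral_const_mul]
  refine integral_mono (integrable_one_sub_cos ρ _) ((integrable_min_sq ρ x).const_mul 2)
    fun u => ?_
  simp only
  rw [one_div_mul_eq_div, mul_min_of_nonneg _ _ zero_le_two]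
  refine le_min ?_ ?_
  · have := Real.one_sub_sq_div_two_le_cos (x := u / x)
    nlinarith [sq_nonneg (u / x)]
  · linarith [Real.neg_one_le_cos (u / x)]

lemma integrable_indicator_compl_Icc (ρ : Measure ℝ) [IsFiniteMeasure ρ] (x : ℝ) :
    Integrable ((Set.Icc (-x) x)ᶜ.indicator (1 : ℝ → ℝ)) ρ :=
  (integrable_const (1 : ℝ)).indicator measurableSet_Icc.compl

lemma minMoment_three_mul_le (ρ : Measure ℝ) [IsFiniteMeasure ρ] {x : ℝ} (hx : 0 < x) :
    minMoment ρ (3 * x) ≤ 5 / 18 * (∫ u, (1 - Real.cos (1 / x * u)) ∂ρ) +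
      ρ.real (Set.Icc (-x) x)ᶜ := by
  rw [minMoment, ← integral_const_mul, ← integral_indicator_one measurableSet_Icc.compl,
    ← integral_add ((integrable_one_sub_cos ρ _).const_mul _)
      (integrable_indicator_compl_Icc ρ x)]
  refine integral_mono (integrable_min_sq ρ _) (((integrable_one_sub_cos ρ _).const_mul _).add
    (integrable_indicator_compl_Icc ρ x)) fun u => ?_
  have h0 := Real.cos_le_one (1 / x * u)
  by_cases hu : u ∈ Set.Icc (-x) x
  · simp only [Set.indicator_of_notMem (Set.notMem_compl_iff.mpr hu), add_zero]
    refine (min_le_left _ _).trans ?_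
    have h1 : |u / x| ≤ 1 := by
      rw [abs_div, abs_of_pos hx, div_le_one hx]
      exact abs_le.mpr hu
    have h2 := sq_le_mul_one_sub_cos h1
    have h3 : (u / (3 * x)) ^ 2 = (u / x) ^ 2 / 9 := by field_simp; norm_num
    rw [h3, one_div_mul_eq_div]
    linarith
  · simp only [Set.indicator_of_mem (Set.mem_compl hu)]
    refine (min_le_right _ _).trans ?_
    simp only [Pi.one_apply]
    linarith

/-- If `n ∫ (1 - cos (t u / a n)) dρ` tends to `t ^ 2`, boundedly near `t = 0`, then the tail of
`ρ` is negligible compared with `minMoment ρ`. The sequence `a` turns out to have bounded ratios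
`a (n + 1) / a n`, so that information along `a` passes to all large `x`. -/
lemma eventually_measureReal_compl_Icc_le_minMoment {ρ : Measure ℝ} [IsProbabilityMeasure ρ]
    {a : ℕ → ℝ} (ha : ∀ n, 0 < a n)
    (hlim : ∀ t, Tendsto (fun n : ℕ => (n : ℝ) * ∫ u, (1 - Real.cos (t / a n * u)) ∂ρ) atTop
      (𝓝 (t ^ 2)))
    {δ : ℝ} (hδ : 0 < δ)
    (hbdd : ∀ᶠ n : ℕ in atTop, ∀ t ∈ Set.Icc 0 δ,
      (n : ℝ) * ∫ u, (1 - Real.cos (t / a n * u)) ∂ρ ≤ 1) :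
    (∀ ε > 0, ∀ᶠ x in atTop, ρ.real (Set.Icc (-x) x)ᶜ ≤ ε * minMoment ρ x) ∧
      ∀ᶠ x in atTop, 0 < minMoment ρ x := by
  have htail : Tendsto (fun n : ℕ => n * ρ.real (Set.Icc (-(a n)) (a n))ᶜ) atTop (𝓝 0) := by
    simpa using tendsto_mul_measureReal_compl_Icc ha hlim hδ hbdd one_pos
  have h1 := hlim 1
  rw [one_pow] at h1
  have hlow : ∀ᶠ n : ℕ in atTop, 2 / 5 ≤ n * minMoment ρ (a n) := by
    filter_upwards [h1.eventually_const_le (u := 4 / 5) (by norm_num)] with n hn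
    have := mul_le_mul_of_nonneg_left (integral_one_sub_cos_le_minMoment ρ (a n))
      (Nat.cast_nonneg n : (0 : ℝ) ≤ n)
    linarith
  have hupp : ∀ᶠ n : ℕ in atTop, n * minMoment ρ (3 * a n) ≤ 3 / 10 := by
    have h := (h1.const_mul (5 / 18)).add htail
    filter_upwards [h.eventually_le_const (u := 3 / 10) (by norm_num)] with n hn
    have := mul_le_mul_of_nonneg_left (minMoment_three_mul_le ρ (ha n))
      (Nat.cast_nonneg n : (0 : ℝ) ≤ n)
    linarith
  obtain ⟨N, hN⟩ := eventually_atTop.mp (hlow.and (hupp.and (eventually_ge_atTop 4)))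
  have hN4 : 4 ≤ N := (hN N le_rfl).2.2
  -- if `a (n + 1) ≥ 3 * a n`, the two bounds for `minMoment` contradict its monotonicity
  have hratio (n : ℕ) (hn : N ≤ n) : a (n + 1) < 3 * a n := by
    by_contra! hle
    have h2 := (hN n hn).2.1
    have h3 := (hN (n + 1) (by omega)).1
    have h4 := minMoment_antitone ρ (by have := ha n; positivity) hle
    have hn4 : (4 : ℝ) ≤ n := by exact_mod_cast hN4.trans hn
    push_cast at h3
    have h5 : (n + 1) * minMoment ρ (a (n + 1)) ≤ (n + 1) * minMoment ρ (3 * a n) := by gcongr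
    nlinarith [minMoment_nonneg ρ (3 * a n)]
  have hpos (x : ℝ) (hx : 0 < x) : 0 < minMoment ρ x := by
    rcases le_total x (a N) with h | h
    · have h2 := (hN N le_rfl).1
      have h3 : 0 < minMoment ρ (a N) := by
        by_contra! hle
        nlinarith [(Nat.cast_nonneg N : (0 : ℝ) ≤ N)]
      exact h3.trans_le (minMoment_antitone ρ hx h)
    · have h2 := (hN N le_rfl).1
      have h3 : 0 < minMoment ρ (a N) := by
        by_contra! hle
        nlinarith [(Nat.cast_nonneg N : (0 : ℝ) ≤ N)]
      have h4 := sq_mul_minMoment_mono ρ (ha N) h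
      have h5 : 0 < a N ^ 2 * minMoment ρ (a N) := by have := ha N; positivity
      by_contra! hle
      nlinarith [sq_nonneg x]
  have hatop (M : ℝ) (hM : 0 < M) : ∀ᶠ n in atTop, M < a n := by
    have h2 : Tendsto (fun n : ℕ => (n : ℝ) * minMoment ρ (3 * M)) atTop atTop :=
      tendsto_natCast_atTop_atTop.atTop_mul_const (hpos _ (by positivity))
    filter_upwards [h2.eventually_gt_atTop (3 / 10), hupp] with n h3 h4
    by_contra! hle
    have h5 := minMoment_antitone ρ (x := 3 * a n) (y := 3 * M) (by have := ha n; positivity)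
      (by linarith)
    have h6 := mul_le_mul_of_nonneg_left h5 (Nat.cast_nonneg n : (0 : ℝ) ≤ n)
    linarith
  refine ⟨fun ε hε => ?_, ?_⟩
  · have h2 : ∀ᶠ n : ℕ in atTop, n * ρ.real (Set.Icc (-(a n)) (a n))ᶜ ≤ ε / 9 * (2 / 5) :=
      htail.eventually_le_const (by positivity)
    obtain ⟨N', hN'⟩ := eventually_atTop.mp h2
    set m := max N N' with hm
    filter_upwards [eventually_ge_atTop (a m)] with x hx
    have hxpos : 0 < x := (ha m).trans_le hx
    -- the first index at which `a` exceeds `x`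
    obtain ⟨k, hk⟩ := ((eventually_ge_atTop m).and (hatop x hxpos)).exists
    classical
    have hex : ∃ k, m ≤ k ∧ x < a k := ⟨k, hk⟩
    set K := Nat.find hex with hK
    obtain ⟨hK1, hK2⟩ : m ≤ K ∧ x < a K := Nat.find_spec hex
    have hKm : K ≠ m := fun h => by rw [h] at hK2; linarith
    obtain ⟨j, hj⟩ : ∃ j, K = j + 1 := ⟨K - 1, by omega⟩
    have hmj : m ≤ j := by omega
    have hjx : a j ≤ x := by
      by_contra! hlt
      have := Nat.find_min' hex ⟨hmj, hlt⟩
      omega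
    have hxj : x < 3 * a j := by
      rw [hj] at hK2
      exact hK2.trans (hratio j ((le_max_left _ _).trans hmj))
    have hj1 := (hN j ((le_max_left _ _).trans hmj)).1
    have hj2 := hN' j ((le_max_right _ _).trans hmj)
    have hjpos : (0 : ℝ) < j := by
      have : 0 < j := by
        have := (le_max_left N N').trans hmj
        omega
      exact_mod_cast this
    have h3 : ρ.real (Set.Icc (-x) x)ᶜ ≤ ρ.real (Set.Icc (-(a j)) (a j))ᶜ :=
      measureReal_mono (Set.compl_subset_compl.mpr (Set.Icc_subset_Icc (by linarith) hjx))
    have h4 := sq_mul_minMoment_mono ρ (ha j) hjx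
    have h5 : ρ.real (Set.Icc (-(a j)) (a j))ᶜ ≤ ε / 9 * minMoment ρ (a j) := by
      have : j * ρ.real (Set.Icc (-(a j)) (a j))ᶜ ≤ j * (ε / 9 * minMoment ρ (a j)) := by
        calc _ ≤ ε / 9 * (2 / 5) := hj2
          _ ≤ ε / 9 * (j * minMoment ρ (a j)) := by gcongr
          _ = _ := by ring
      exact le_of_mul_le_mul_left this hjpos
    have h6 : minMoment ρ (a j) ≤ 9 * minMoment ρ x := by
      have h7 : x ^ 2 * minMoment ρ x ≤ (3 * a j) ^ 2 * minMoment ρ x := by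
        have := minMoment_nonneg ρ x
        gcongr
      have h8 : a j ^ 2 * minMoment ρ (a j) ≤ a j ^ 2 * (9 * minMoment ρ x) := by linarith
      exact le_of_mul_le_mul_left h8 (by have := ha j; positivity)
    calc _ ≤ ε / 9 * minMoment ρ (a j) := h3.trans h5
      _ ≤ ε / 9 * (9 * minMoment ρ x) := by gcongr
      _ = ε * minMoment ρ x := by ring
  · filter_upwards [eventually_gt_atTop 0] with x hx using hpos x hx

/-- The truncated second moment `E X ^ 2 I(|X| ≤ x)` of a law on the real line. -/
noncomputable def truncSecond (μ : Measure ℝ) (x : ℝ) : ℝ := ∫ u in Set.Icc (-x) x, u ^ 2 ∂μ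

lemma integrable_indicator_Icc_pow (μ : Measure ℝ) [IsFiniteMeasure μ] (x : ℝ) (k : ℕ) :
    Integrable ((Set.Icc (-x) x).indicator fun u => u ^ k) μ :=
  ((continuous_pow k).continuousOn.integrableOn_compact isCompact_Icc).integrable_indicator
    measurableSet_Icc

lemma truncSecond_eq (μ : Measure ℝ) (x : ℝ) :
    truncSecond μ x = ∫ u, (Set.Icc (-x) x).indicator (fun u => u ^ 2) u ∂μ :=
  (integral_indicator measurableSet_Icc).symm

lemma truncSecond_nonneg (μ : Measure ℝ) (x : ℝ) : 0 ≤ truncSecond μ x :=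
  integral_nonneg fun _ => sq_nonneg _

lemma truncSecond_mono (μ : Measure ℝ) [IsFiniteMeasure μ] {x y : ℝ} (h : x ≤ y) :
    truncSecond μ x ≤ truncSecond μ y := by
  rw [truncSecond_eq, truncSecond_eq]
  refine integral_mono (integrable_indicator_Icc_pow μ x 2) (integrable_indicator_Icc_pow μ y 2)
    fun u => ?_
  exact Set.indicator_le_indicator_of_subset (Set.Icc_subset_Icc (by linarith) h)
    (fun _ => sq_nonneg _) u

lemma sq_mul_minMoment_le (μ : Measure ℝ) [IsFiniteMeasure μ] {x : ℝ} (hx : 0 < x) :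
    x ^ 2 * minMoment μ x ≤
      truncSecond μ (2 * x) + x ^ 2 * μ.real (Set.Icc (-(2 * x)) (2 * x))ᶜ := by
  rw [minMoment, truncSecond_eq, ← integral_const_mul,
    ← integral_indicator_one measurableSet_Icc.compl, ← integral_const_mul,
    ← integral_add (integrable_indicator_Icc_pow μ _ 2)
      ((integrable_indicator_compl_Icc μ _).const_mul _)]
  refine integral_mono ((integrable_min_sq μ x).const_mul _)
    ((integrable_indicator_Icc_pow μ _ 2).add
      ((integrable_indicator_compl_Icc μ _).const_mul _)) fun u => ?_
  simp only
  by_cases hu : u ∈ Set.Icc (-(2 * x)) (2 * x)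
  · simp only [Set.indicator_of_notMem (Set.notMem_compl_iff.mpr hu), Set.indicator_of_mem hu,
      mul_zero, add_zero]
    calc x ^ 2 * min ((u / x) ^ 2) 1 ≤ x ^ 2 * (u / x) ^ 2 := by gcongr; exact min_le_left _ _
      _ = u ^ 2 := by field_simp
  · simp only [Set.indicator_of_mem (Set.mem_compl hu), Set.indicator_of_notMem hu, zero_add]
    gcongr
    exact min_le_right _ _

lemma minMoment_symmetrization_le (μ : Measure ℝ) [IsProbabilityMeasure μ] (x : ℝ) :
    minMoment (symmetrization μ) x ≤ 4 * minMoment μ x := by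
  have : IsProbabilityMeasure (μ.map (fun x => -x)) :=
    Measure.isProbabilityMeasure_map measurable_neg.aemeasurable
  have hneg : ∫ v, min ((v / x) ^ 2) 1 ∂(μ.map (fun x => -x)) = minMoment μ x := by
    rw [integral_map measurable_neg.aemeasurable (Continuous.aestronglyMeasurable (by fun_prop)),
      minMoment]
    simp [neg_div]
  have h1 : minMoment (symmetrization μ) x =
      ∫ p, min (((p.1 + p.2) / x) ^ 2) 1 ∂(μ.prod (μ.map (fun x => -x))) := by
    rw [minMoment, symmetrization, Measure.conv,
      integral_map (by fun_prop) (Continuous.aestronglyMeasurable (by fun_prop))]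
  have i1 := (integrable_min_sq μ x).comp_fst (μ.map (fun x => -x))
  have i2 := (integrable_min_sq (μ.map (fun x => -x)) x).comp_snd μ
  have h2 : minMoment (symmetrization μ) x ≤
      ∫ p, (2 * min ((p.1 / x) ^ 2) 1 + 2 * min ((p.2 / x) ^ 2) 1)
        ∂(μ.prod (μ.map (fun x => -x))) := by
    rw [h1]
    refine integral_mono_of_nonneg (ae_of_all _ fun p => le_min (sq_nonneg _) zero_le_one)
      ((i1.const_mul 2).add (i2.const_mul 2)) (ae_of_all _ fun p => ?_)
    simp only
    have e : (p.1 + p.2) / x = p.1 / x + p.2 / x := by ring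
    rw [e]
    have hs : (p.1 / x + p.2 / x) ^ 2 ≤ 2 * (p.1 / x) ^ 2 + 2 * (p.2 / x) ^ 2 := by
      nlinarith [sq_nonneg (p.1 / x - p.2 / x)]
    rcases min_cases ((p.1 / x) ^ 2) 1 with ⟨h3, _⟩ | ⟨h3, _⟩ <;>
      rcases min_cases ((p.2 / x) ^ 2) 1 with ⟨h4, _⟩ | ⟨h4, _⟩ <;>
      rcases min_cases ((p.1 / x + p.2 / x) ^ 2) 1 with ⟨h5, _⟩ | ⟨h5, _⟩ <;>
      rw [h3, h4, h5] <;> nlinarith [sq_nonneg (p.1 / x), sq_nonneg (p.2 / x)]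
  refine h2.trans (le_of_eq ?_)
  rw [integral_add (i1.const_mul 2) (i2.const_mul 2), integral_const_mul, integral_const_mul,
    integral_fun_fst (f := fun u => min ((u / x) ^ 2) 1),
    integral_fun_snd (f := fun u => min ((u / x) ^ 2) 1), hneg]
  simp [minMoment]
  ring

lemma eventually_measureReal_compl_Icc_le_symmetrization (μ : Measure ℝ) [IsProbabilityMeasure μ] :
    ∀ᶠ x in atTop, μ.real (Set.Icc (-(2 * x)) (2 * x))ᶜ ≤
      2 * (symmetrization μ).real (Set.Icc (-x) x)ᶜ := by
  have : IsProbabilityMeasure (μ.map (fun x => -x)) :=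
    Measure.isProbabilityMeasure_map measurable_neg.aemeasurable
  have hlim : Tendsto (fun x : ℝ => μ.real (Set.Icc (-x) x)) atTop (𝓝 1) := by
    have h := tendsto_measure_iUnion_atTop (μ := μ) (s := fun x : ℝ => Set.Icc (-x) x)
      (fun x y h => Set.Icc_subset_Icc (by linarith) h)
    have hU : ⋃ x : ℝ, Set.Icc (-x) x = Set.univ := by
      ext u
      simp only [Set.mem_iUnion, Set.mem_univ, iff_true]
      exact ⟨|u|, abs_le.mp le_rfl⟩
    rw [hU, measure_univ] at h
    exact (ENNReal.tendsto_toReal ENNReal.one_ne_top).comp h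
  filter_upwards [hlim.eventually_const_le (u := 1 / 2) (by norm_num)] with x hx
  have h1 : (symmetrization μ).real (Set.Icc (-x) x)ᶜ =
      (μ.prod (μ.map (fun x => -x))).real {p | p.1 + p.2 ∈ (Set.Icc (-x) x)ᶜ} := by
    rw [symmetrization, Measure.conv, measureReal_def, measureReal_def,
      Measure.map_apply (by fun_prop) measurableSet_Icc.compl]
    rfl
  have h2 : (μ.map (fun x => -x)).real (Set.Icc (-x) x) = μ.real (Set.Icc (-x) x) := by
    rw [measureReal_def, Measure.map_apply measurable_neg measurableSet_Icc, measureReal_def]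
    congr 2
    ext u
    simp [and_comm]
  have h3 : (μ.prod (μ.map (fun x => -x))).real
      ((Set.Icc (-(2 * x)) (2 * x))ᶜ ×ˢ Set.Icc (-x) x) ≤
      (symmetrization μ).real (Set.Icc (-x) x)ᶜ := by
    rw [h1]
    refine measureReal_mono ?_
    rintro ⟨u, v⟩ ⟨hu, hv⟩
    simp only [Set.mem_ofPred_eq, Set.mem_compl_iff, Set.mem_Icc, not_and_or, not_le] at hu hv ⊢
    rcases hu with hu | hu
    · left
      linarith [hv.2]
    · right
      linarith [hv.1]
  rw [measureReal_prod_prod, h2] at h3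
  nlinarith [measureReal_nonneg (μ := μ) (s := (Set.Icc (-(2 * x)) (2 * x))ᶜ)]

/-- The tail condition for a law follows from the corresponding one for its symmetrisation. -/
lemma eventually_sq_mul_measureReal_compl_Icc_le {μ : Measure ℝ} [IsProbabilityMeasure μ]
    (h : ∀ ε > 0, ∀ᶠ x in atTop, (symmetrization μ).real (Set.Icc (-x) x)ᶜ ≤
      ε * minMoment (symmetrization μ) x)
    (hpos : ∀ᶠ x in atTop, 0 < minMoment (symmetrization μ) x) :
    (∀ ε > 0, ∀ᶠ x in atTop, x ^ 2 * μ.real (Set.Icc (-x) x)ᶜ ≤ ε * truncSecond μ x) ∧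
      ∀ᶠ x in atTop, 0 < truncSecond μ x := by
  have key : ∀ ε > 0, ε ≤ 1 / 16 → ∀ᶠ x in atTop,
      (2 * x) ^ 2 * μ.real (Set.Icc (-(2 * x)) (2 * x))ᶜ ≤ 64 * ε * truncSecond μ (2 * x) := by
    intro ε hε hε1
    filter_upwards [h ε hε, eventually_measureReal_compl_Icc_le_symmetrization μ,
      eventually_gt_atTop 0] with x h1 h2 hx
    have h3 := sq_mul_minMoment_le μ hx
    have h4 := minMoment_symmetrization_le μ x
    have h5 : μ.real (Set.Icc (-(2 * x)) (2 * x))ᶜ ≤ 8 * ε * minMoment μ x := by nlinarith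
    have h6 : x ^ 2 * μ.real (Set.Icc (-(2 * x)) (2 * x))ᶜ ≤ 8 * ε * (x ^ 2 * minMoment μ x) := by
      calc _ ≤ x ^ 2 * (8 * ε * minMoment μ x) := by gcongr
        _ = _ := by ring
    have h7 : 0 ≤ x ^ 2 * μ.real (Set.Icc (-(2 * x)) (2 * x))ᶜ := by positivity
    have h8 : 8 * ε * (x ^ 2 * minMoment μ x) ≤ 8 * ε * (truncSecond μ (2 * x) +
        x ^ 2 * μ.real (Set.Icc (-(2 * x)) (2 * x))ᶜ) := by gcongr
    nlinarith
  have hscale {p : ℝ → Prop} (hp : ∀ᶠ x in atTop, p (2 * x)) : ∀ᶠ x in atTop, p x := by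
    have : Tendsto (fun x : ℝ => x / 2) atTop atTop := tendsto_id.atTop_div_const two_pos
    filter_upwards [this.eventually hp] with x hx
    rwa [mul_div_cancel₀ _ two_ne_zero] at hx
  have hmain : ∀ ε > 0, ∀ᶠ x in atTop, x ^ 2 * μ.real (Set.Icc (-x) x)ᶜ ≤ ε * truncSecond μ x := by
    intro ε hε
    have h1 := hscale (p := fun x => x ^ 2 * μ.real (Set.Icc (-x) x)ᶜ ≤
      64 * min (ε / 64) (1 / 16) * truncSecond μ x)
      (key (min (ε / 64) (1 / 16)) (by positivity) (min_le_right _ _))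
    filter_upwards [h1] with x hx
    refine hx.trans (mul_le_mul_of_nonneg_right ?_ (truncSecond_nonneg μ x))
    linarith [min_le_left (ε / 64) (1 / 16)]
  refine ⟨hmain, hscale ?_⟩
  filter_upwards [(tendsto_id.const_mul_atTop (two_pos (α := ℝ))).eventually (hmain 1 one_pos),
    hpos, eventually_gt_atTop 0] with x h2 h3 hx
  have h4 := sq_mul_minMoment_le μ hx
  have h5 := minMoment_symmetrization_le μ x
  have h6 : 0 < x ^ 2 * minMoment μ x := by
    have : 0 < minMoment μ x := by linarith
    positivity
  simp only [id] at h2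
  nlinarith [measureReal_nonneg (μ := μ) (s := (Set.Icc (-(2 * x)) (2 * x))ᶜ)]

/-! ### The tail condition in the domain of attraction -/

lemma charFun_map_sum {Ω : Type*} [MeasurableSpace Ω] {P : Measure Ω} [IsProbabilityMeasure P]
    {X : ℕ → Ω → ℝ} (hindep : iIndepFun X P) (hident : ∀ i, IdentDistrib (X i) (X 0) P P)
    (n : ℕ) (t : ℝ) :
    charFun (P.map fun ω => ∑ i ∈ Finset.range n, X i ω) t = charFun (P.map (X 0)) t ^ n := by
  rw [iIndepFun.charFun_map_fun_finsetSum_eq_prod (fun i _ => (hident i).aemeasurable_fst)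
    (hindep.restrict _)]
  simp [(hident _).map_eq]

lemma norm_charFun_map_normalized {Ω : Type*} [MeasurableSpace Ω] {P : Measure Ω}
    [IsProbabilityMeasure P] {X : ℕ → Ω → ℝ} (hindep : iIndepFun X P)
    (hident : ∀ i, IdentDistrib (X i) (X 0) P P) (n : ℕ) (a c t : ℝ) :
    ‖charFun (P.map fun ω => ((∑ i ∈ Finset.range n, X i ω) - c) / a) t‖ =
      ‖charFun (P.map (X 0)) (t / a)‖ ^ n := by
  have hm : AEMeasurable (fun ω => ∑ i ∈ Finset.range n, X i ω) P :=
    Finset.aemeasurable_fun_sum _ fun i _ => (hident i).aemeasurable_fst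
  have e : (P.map fun ω => ((∑ i ∈ Finset.range n, X i ω) - c) / a) =
      ((P.map fun ω => ∑ i ∈ Finset.range n, X i ω).map (fun x => a⁻¹ * x)).map (· + (-c / a)) := by
    rw [AEMeasurable.map_map_of_aemeasurable (by fun_prop) hm,
      AEMeasurable.map_map_of_aemeasurable (by fun_prop) (by fun_prop)]
    congr 1
    ext ω
    simp only [Function.comp]
    ring
  rw [e, charFun_map_add_const, norm_mul, Complex.norm_exp_ofReal_mul_I, mul_one,
    charFun_map_mul, charFun_map_sum hindep hident, norm_pow, div_eq_inv_mul]

lemma norm_one_sub_charFun_le (ρ : Measure ℝ) [IsProbabilityMeasure ρ] {t δ : ℝ}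
    (ht : t ∈ Set.Icc 0 δ) : ‖1 - charFun ρ t‖ ≤ ∫ z, min 2 (δ * |z|) ∂ρ := by
  have hδ : 0 ≤ δ := ht.1.trans ht.2
  have hint : Integrable (fun u : ℝ => Complex.exp (t * u * Complex.I)) ρ := by
    refine Integrable.of_bound (C := 1) (Continuous.aestronglyMeasurable (by fun_prop))
      (ae_of_all _ fun w => ?_)
    norm_cast
    rw [Complex.norm_exp_ofReal_mul_I]
  have h1 : (1 : ℂ) = ∫ _, (1 : ℂ) ∂ρ := by simp
  rw [charFun_apply_real, h1, ← integral_sub (integrable_const _) hint]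
  refine norm_integral_le_of_norm_le ?_ (ae_of_all _ fun z => le_min ?_ ?_)
  · refine Integrable.of_bound (C := 2) (Continuous.aestronglyMeasurable (by fun_prop))
      (ae_of_all _ fun u => ?_)
    rw [Real.norm_of_nonneg (le_min zero_le_two (by positivity))]
    exact min_le_left _ _
  · refine (norm_sub_le _ _).trans ?_
    norm_cast
    rw [Complex.norm_exp_ofReal_mul_I]
    norm_num
  · have h := Real.norm_exp_I_mul_ofReal_sub_one_le (x := t * z)
    rw [norm_sub_rev, mul_comm]
    push_cast at h
    refine h.trans ?_
    rw [Real.norm_eq_abs, abs_mul, abs_of_nonneg ht.1]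
    exact mul_le_mul_of_nonneg_right ht.2 (abs_nonneg z)

lemma integral_min_abs_gaussian_le {δ : ℝ} (hδ : 0 ≤ δ) :
    ∫ z, min 2 (δ * |z|) ∂(gaussianReal 0 1) ≤ δ := by
  have hi : Integrable (fun z : ℝ => z ^ 2) (gaussianReal 0 1) :=
    (memLp_id_gaussianReal (μ := 0) (v := 1) 2).integrable_sq
  have h2 : ∫ z, z ^ 2 ∂(gaussianReal 0 1) = 1 := by
    have := variance_fun_id_gaussianReal (μ := 0) (v := 1)
    rw [variance_of_integral_eq_zero aemeasurable_id' (by simp)] at this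
    simpa using this
  calc ∫ z, min 2 (δ * |z|) ∂(gaussianReal 0 1)
      ≤ ∫ z, δ * (1 / 2 * (1 + z ^ 2)) ∂(gaussianReal 0 1) := by
        refine integral_mono_of_nonneg (ae_of_all _ fun z => le_min zero_le_two (by positivity))
          ((((integrable_const _).add hi).const_mul _).const_mul _) (ae_of_all _ fun z => ?_)
        refine (min_le_right _ _).trans (mul_le_mul_of_nonneg_left ?_ hδ)
        nlinarith [sq_abs z, sq_nonneg (|z| - 1)]
    _ = δ := by
        rw [integral_const_mul, integral_const_mul, integral_add (integrable_const _) hi, h2]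
        simp
        norm_num

/-- A law in the domain of attraction of the normal law has
`x ^ 2 P(|X| > x) = o(E X ^ 2 I(|X| ≤ x))`. -/
theorem InNormalDomainOfAttraction.tail {Ω : Type*} [MeasurableSpace Ω] {P : Measure Ω}
    [IsProbabilityMeasure P] {X : ℕ → Ω → ℝ} (hindep : iIndepFun X P)
    (hident : ∀ i, IdentDistrib (X i) (X 0) P P) (hdom : InNormalDomainOfAttraction P X) :
    (∀ ε > 0, ∀ᶠ x in atTop, x ^ 2 * (P.map (X 0)).real (Set.Icc (-x) x)ᶜ ≤
      ε * truncSecond (P.map (X 0)) x) ∧ ∀ᶠ x in atTop, 0 < truncSecond (P.map (X 0)) x := by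
  obtain ⟨a, c, ha, hconv⟩ := hdom
  have hprob : IsProbabilityMeasure (P.map (X 0)) :=
    Measure.isProbabilityMeasure_map (hident 0).aemeasurable_fst
  set μ := P.map (X 0) with hμ
  have hweak := hconv.tendsto
  have hZ (n : ℕ) : IsProbabilityMeasure
      (P.map fun ω => ((∑ i ∈ Finset.range n, X i ω) - c n) / a n) :=
    Measure.isProbabilityMeasure_map (hconv.forall_aemeasurable n)
  -- the centering constants disappear from the absolute values
  have hcf (t : ℝ) : Tendsto (fun n => ‖charFun μ (t / a n)‖ ^ n) atTop
      (𝓝 (Real.exp (-t ^ 2 / 2))) := by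
    have h := (ProbabilityMeasure.tendsto_iff_tendsto_charFun.mp hweak t).norm
    simp only [ProbabilityMeasure.coe_mk, Measure.map_id', charFun_gaussianReal,
      norm_charFun_map_normalized hindep hident, Complex.norm_exp] at h
    convert h using 3
    simp [← Complex.ofReal_pow]
    ring
  have hint : Tendsto (fun n => ∫ z, min 2 (1 / 10 * |z|)
      ∂(P.map fun ω => ((∑ i ∈ Finset.range n, X i ω) - c n) / a n)) atTop
      (𝓝 (∫ z, min 2 (1 / 10 * |z|) ∂(gaussianReal 0 1))) := by
    have h := (ProbabilityMeasure.tendsto_iff_forall_integral_tendsto.mp hweak)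
      (BoundedContinuousFunction.ofNormedAddCommGroup (fun z : ℝ => min 2 (1 / 10 * |z|))
        (by fun_prop) 2 (fun z => by
          rw [Real.norm_of_nonneg (le_min zero_le_two (by positivity))]
          exact min_le_left _ _))
    simpa using h
  -- uniformity in `t` near the origin comes from a single bounded continuous test function
  have hloc : ∀ᶠ n : ℕ in atTop, ∀ t ∈ Set.Icc (0 : ℝ) (1 / 10),
      4 / 5 ≤ ‖charFun μ (t / a n)‖ ^ n := by
    have hlt := (integral_min_abs_gaussian_le (δ := 1 / 10) (by norm_num)).trans_lt
      (by norm_num : (1 / 10 : ℝ) < 1 / 5)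
    filter_upwards [hint.eventually_le_const hlt] with n hn t ht
    have h1 := (norm_one_sub_charFun_le _ ht).trans hn
    rw [← norm_charFun_map_normalized hindep hident n (a n) (c n) t]
    have h2 := norm_sub_norm_le (1 : ℂ)
      (charFun (P.map fun ω => ((∑ i ∈ Finset.range n, X i ω) - c n) / a n) t)
    rw [norm_one] at h2
    linarith
  have hint' (n : ℕ) (t : ℝ) : ∫ u, (1 - Real.cos (t / a n * u)) ∂(symmetrization μ) =
      1 - ‖charFun μ (t / a n)‖ ^ 2 := integral_one_sub_cos_symmetrization μ _
  have h := eventually_measureReal_compl_Icc_le_minMoment (ρ := symmetrization μ) ha (fun t => by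
      simp only [hint']
      refine tendsto_mul_one_sub_of_tendsto_pow (fun n => sq_nonneg _) ?_
      have h := (hcf t).pow 2
      rw [← Real.exp_nat_mul] at h
      convert h using 2
      · rw [← pow_mul, ← pow_mul, mul_comm]
      · push_cast
        ring_nf) (δ := 1 / 10) (by norm_num) (by
      filter_upwards [hloc, eventually_ge_atTop 1] with n hn hn1 t ht
      have h1 := hn t ht
      rw [hint']
      have hpos : 0 < ‖charFun μ (t / a n)‖ ^ 2 := by
        refine lt_of_le_of_ne (sq_nonneg _) fun h => ?_
        rw [pow_eq_zero_iff two_ne_zero |>.mp h.symm, zero_pow (by omega)] at h1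
        norm_num at h1
      refine (mul_one_sub_le_neg_log_pow hpos n).trans ?_
      rw [← pow_mul, mul_comm, pow_mul, neg_le, ← Real.log_exp (-1)]
      refine Real.log_le_log (Real.exp_pos _) ?_
      have h2 : Real.exp (-1) ≤ 1 / 2 := by
        rw [Real.exp_neg, one_div]
        exact inv_anti₀ two_pos (by linarith [Real.add_one_le_exp 1])
      nlinarith)
  exact eventually_sq_mul_measureReal_compl_Icc_le h.1 h.2

/-! ### Slow variation of the truncated second moment -/

section SlowVariation

lemma truncSecond_two_mul_le (μ : Measure ℝ) [IsFiniteMeasure μ] {x : ℝ} (hx : 0 ≤ x) :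
    truncSecond μ (2 * x) ≤ truncSecond μ x + 4 * (x ^ 2 * μ.real (Set.Icc (-x) x)ᶜ) := by
  rw [truncSecond_eq, truncSecond_eq, ← integral_indicator_one measurableSet_Icc.compl,
    ← mul_assoc, ← integral_const_mul, ← integral_add (integrable_indicator_Icc_pow μ x 2)
      ((integrable_indicator_compl_Icc μ x).const_mul _)]
  refine integral_mono (integrable_indicator_Icc_pow μ _ 2)
    ((integrable_indicator_Icc_pow μ x 2).add
      ((integrable_indicator_compl_Icc μ x).const_mul _)) fun u => ?_
  by_cases hu : u ∈ Set.Icc (-x) x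
  · have hu2 : u ∈ Set.Icc (-(2 * x)) (2 * x) := ⟨by linarith [hu.1], by linarith [hu.2]⟩
    simp [Set.indicator_of_notMem (Set.notMem_compl_iff.mpr hu), Set.indicator_of_mem hu,
      Set.indicator_of_mem hu2]
  · simp only [Set.indicator_of_mem (Set.mem_compl hu), Set.indicator_of_notMem hu]
    by_cases hu2 : u ∈ Set.Icc (-(2 * x)) (2 * x)
    · simp only [Set.indicator_of_mem hu2, Pi.one_apply]
      nlinarith [hu2.1, hu2.2]
    · simp only [Set.indicator_of_notMem hu2, Pi.one_apply]
      positivity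

/-- The tail first moment `E |X| I(|X| > x)`. -/
noncomputable def tailFirst (μ : Measure ℝ) (x : ℝ) : ℝ := ∫ u in (Set.Icc (-x) x)ᶜ, |u| ∂μ

/-- The truncated absolute third moment `E |X| ^ 3 I(|X| ≤ x)`. -/
noncomputable def truncThird (μ : Measure ℝ) (x : ℝ) : ℝ := ∫ u in Set.Icc (-x) x, |u| ^ 3 ∂μ

lemma tailFirst_nonneg (μ : Measure ℝ) (x : ℝ) : 0 ≤ tailFirst μ x :=
  integral_nonneg fun _ => abs_nonneg _

lemma truncThird_nonneg (μ : Measure ℝ) (x : ℝ) : 0 ≤ truncThird μ x :=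
  integral_nonneg fun _ => by positivity

variable {μ : Measure ℝ} [IsProbabilityMeasure μ]

lemma eventually_truncSecond_two_mul_le
    (htail : ∀ ε > 0, ∀ᶠ x in atTop, x ^ 2 * μ.real (Set.Icc (-x) x)ᶜ ≤ ε * truncSecond μ x)
    {ε : ℝ} (hε : 0 < ε) : ∀ᶠ x in atTop, truncSecond μ (2 * x) ≤ (1 + ε) * truncSecond μ x := by
  filter_upwards [htail (ε / 4) (by positivity), eventually_ge_atTop 0] with x hx h0
  linarith [truncSecond_two_mul_le μ h0]

lemma eventually_truncSecond_two_pow_mul_le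
    (htail : ∀ ε > 0, ∀ᶠ x in atTop, x ^ 2 * μ.real (Set.Icc (-x) x)ᶜ ≤ ε * truncSecond μ x)
    (j : ℕ) : ∀ ε > 0, ∀ᶠ x in atTop, truncSecond μ (2 ^ j * x) ≤ (1 + ε) * truncSecond μ x := by
  induction j with
  | zero =>
    intro ε hε
    refine Eventually.of_forall fun x => ?_
    rw [pow_zero, one_mul]
    nlinarith [truncSecond_nonneg μ x]
  | succ j ih =>
    intro ε hε
    set e := min 1 ε / 3 with he
    have hepos : 0 < e := by positivity
    have he1 : e ≤ 1 / 3 := by rw [he]; linarith [min_le_left 1 ε]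
    have he2 : e ≤ ε / 3 := by rw [he]; linarith [min_le_right 1 ε]
    have h1 := eventually_truncSecond_two_mul_le htail hepos
    have h2 : Tendsto (fun x : ℝ => 2 ^ j * x) atTop atTop :=
      tendsto_id.const_mul_atTop (by positivity)
    filter_upwards [ih e hepos, h2.eventually h1] with x h3 h4
    rw [pow_succ, mul_comm (2 ^ j) (2 : ℝ), mul_assoc]
    refine h4.trans ?_
    calc (1 + e) * truncSecond μ (2 ^ j * x) ≤ (1 + e) * ((1 + e) * truncSecond μ x) := by gcongr
      _ = (1 + (2 * e + e ^ 2)) * truncSecond μ x := by ring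
      _ ≤ _ := by
        refine mul_le_mul_of_nonneg_right ?_ (truncSecond_nonneg μ x)
        nlinarith

/-- A Potter-type bound: the truncated second moment grows at most linearly. -/
lemma truncSecond_mul_le {x₀ : ℝ} (hx₀ : 0 < x₀)
    (h : ∀ x, x₀ ≤ x → truncSecond μ (2 * x) ≤ 2 * truncSecond μ x) {x t : ℝ} (hx : x₀ ≤ x)
    (ht : 1 ≤ t) : truncSecond μ (t * x) ≤ 2 * t * truncSecond μ x := by
  have hk (k : ℕ) : truncSecond μ (2 ^ k * x) ≤ 2 ^ k * truncSecond μ x := by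
    induction k with
    | zero => simp
    | succ k ih =>
      have h1 := h (2 ^ k * x) (by
        have : (1 : ℝ) ≤ 2 ^ k := one_le_pow₀ one_le_two
        nlinarith)
      rw [pow_succ, mul_comm (2 ^ k) (2 : ℝ), mul_assoc, mul_assoc]
      linarith
  obtain ⟨k, hk1, hk2⟩ := exists_nat_pow_near ht one_lt_two
  calc truncSecond μ (t * x) ≤ truncSecond μ (2 ^ (k + 1) * x) :=
        truncSecond_mono μ (by gcongr; linarith)
    _ ≤ 2 ^ (k + 1) * truncSecond μ x := hk _
    _ ≤ 2 * t * truncSecond μ x := by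
        refine mul_le_mul_of_nonneg_right ?_ (truncSecond_nonneg μ x)
        rw [pow_succ]
        linarith

lemma integrable_indicator_abs {ρ : Measure ℝ} (hint : Integrable id ρ) (x : ℝ) :
    Integrable ((Set.Icc (-x) x)ᶜ.indicator fun u => |u|) ρ :=
  hint.abs.indicator measurableSet_Icc.compl

lemma tailFirst_eq (μ : Measure ℝ) (x : ℝ) :
    tailFirst μ x = ∫ u, (Set.Icc (-x) x)ᶜ.indicator (fun u => |u|) u ∂μ :=
  (integral_indicator measurableSet_Icc.compl).symm

/-- Iterating this inequality along `2 ^ k * x` bounds the tail first moment by increments of the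
truncated second moment. -/
lemma mul_tailFirst_le (hint : Integrable id μ) {x : ℝ} (hx : 0 < x) :
    x * tailFirst μ x ≤ (truncSecond μ (2 * x) - truncSecond μ x)
      + 1 / 2 * (2 * x * tailFirst μ (2 * x)) := by
  have e : 1 / 2 * (2 * x * tailFirst μ (2 * x)) = x * tailFirst μ (2 * x) := by ring
  have i1 := integrable_indicator_Icc_pow μ (2 * x) 2
  have i2 := integrable_indicator_Icc_pow μ x 2
  have i12 : Integrable (fun u => (Set.Icc (-(2 * x)) (2 * x)).indicator (fun u => u ^ 2) u -
      (Set.Icc (-x) x).indicator (fun u => u ^ 2) u) μ := i1.sub i2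
  have i3 := (integrable_indicator_abs hint (2 * x)).const_mul x
  rw [e, tailFirst_eq, tailFirst_eq, truncSecond_eq, truncSecond_eq, ← integral_const_mul,
    ← integral_const_mul, ← integral_sub i1 i2, ← integral_add i12 i3]
  refine integral_mono ((integrable_indicator_abs hint x).const_mul x) (i12.add i3)
    fun u => ?_
  by_cases hu : u ∈ Set.Icc (-x) x
  · have hu2 : u ∈ Set.Icc (-(2 * x)) (2 * x) := ⟨by linarith [hu.1], by linarith [hu.2]⟩
    simp [Set.indicator_of_notMem (Set.notMem_compl_iff.mpr hu), Set.indicator_of_mem hu,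
      Set.indicator_of_mem hu2, Set.indicator_of_notMem (Set.notMem_compl_iff.mpr hu2)]
  · simp only [Set.indicator_of_mem (Set.mem_compl hu), Set.indicator_of_notMem hu]
    have hu1 : x < |u| := by
      by_contra! hle
      exact hu (abs_le.mp hle)
    by_cases hu2 : u ∈ Set.Icc (-(2 * x)) (2 * x)
    · simp only [Set.indicator_of_mem hu2, Set.indicator_of_notMem (Set.notMem_compl_iff.mpr hu2)]
      nlinarith [sq_abs u]
    · simp [Set.indicator_of_notMem hu2, Set.indicator_of_mem (Set.mem_compl hu2)]

lemma tendsto_tailFirst {ρ : Measure ℝ} (hint : Integrable id ρ) :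
    Tendsto (tailFirst ρ) atTop (𝓝 0) := by
  have h := tendsto_integral_filter_of_dominated_convergence (μ := ρ) (l := atTop)
    (F := fun (x : ℝ) u => (Set.Icc (-x) x)ᶜ.indicator (fun u => |u|) u) (f := fun _ => 0)
    (fun u => |u|)
    (Eventually.of_forall fun x => (integrable_indicator_abs hint x).aestronglyMeasurable)
    (Eventually.of_forall fun x => ae_of_all _ fun u => by
      rw [Real.norm_of_nonneg (Set.indicator_nonneg (fun _ _ => abs_nonneg _) _)]
      exact Set.indicator_le_self' (fun _ _ => abs_nonneg _) u) hint.abs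
    (ae_of_all _ fun u => by
      refine tendsto_const_nhds.congr' ?_
      filter_upwards [eventually_ge_atTop |u|] with x hx
      rw [Set.indicator_of_notMem (Set.notMem_compl_iff.mpr (Set.mem_Icc.mpr (abs_le.mp hx)))])
  rw [integral_zero] at h
  exact h.congr fun x => (tailFirst_eq ρ x).symm

lemma eventually_mul_tailFirst_le
    (htail : ∀ ε > 0, ∀ᶠ x in atTop, x ^ 2 * μ.real (Set.Icc (-x) x)ᶜ ≤ ε * truncSecond μ x)
    (hint : Integrable id μ) {ε : ℝ} (hε : 0 < ε) :
    ∀ᶠ x in atTop, x * tailFirst μ x ≤ ε * truncSecond μ x := by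
  set e := min (ε / 4) (1 / 2) with he
  have hepos : 0 < e := by positivity
  have he1 : e ≤ ε / 4 := min_le_left _ _
  have he2 : e ≤ 1 / 2 := min_le_right _ _
  obtain ⟨x₀, hx₀⟩ := eventually_atTop.mp (eventually_truncSecond_two_mul_le htail hepos)
  filter_upwards [eventually_ge_atTop x₀, eventually_gt_atTop 0] with x hx hxpos
  -- iterate the inequality relating `x` and `2 * x`; the last term vanishes in the limit
  have hk (k : ℕ) : ∀ x, x₀ ≤ x → 0 < x →
      x * tailFirst μ x ≤ 4 * e * truncSecond μ x + x * tailFirst μ (2 ^ k * x) := by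
    induction k with
    | zero =>
      intro x _ _
      rw [pow_zero, one_mul]
      have := truncSecond_nonneg μ x
      nlinarith
    | succ k ih =>
      intro x hx hxpos
      have h1 := mul_tailFirst_le hint hxpos
      have h2 := ih (2 * x) (by linarith) (by linarith)
      have h3 := hx₀ x hx
      rw [← mul_assoc, ← pow_succ] at h2
      have h4 : e * truncSecond μ (2 * x) ≤ e * (3 / 2 * truncSecond μ x) := by
        refine mul_le_mul_of_nonneg_left (h3.trans ?_) hepos.le
        exact mul_le_mul_of_nonneg_right (by linarith) (truncSecond_nonneg μ x)
      nlinarith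
  have hlim : Tendsto (fun k : ℕ => 4 * e * truncSecond μ x + x * tailFirst μ (2 ^ k * x)) atTop
      (𝓝 (4 * e * truncSecond μ x + x * 0)) := by
    refine tendsto_const_nhds.add (((tendsto_tailFirst hint).comp ?_).const_mul x)
    exact (tendsto_pow_atTop_atTop_of_one_lt one_lt_two).atTop_mul_const hxpos
  have h := ge_of_tendsto' hlim fun k => hk k x hx hxpos
  have := truncSecond_nonneg μ x
  nlinarith

/-- Splitting at `y`: the inner part gains the factor `y`, the outer part an increment of the slowly
varying function `truncSecond μ`. -/
lemma truncThird_le (μ : Measure ℝ) [IsProbabilityMeasure μ] {x y : ℝ} (hyx : y ≤ x) :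
    truncThird μ x ≤ y * truncSecond μ y + x * (truncSecond μ x - truncSecond μ y) := by
  have i1 := integrable_indicator_Icc_pow μ x 2
  have i2 := integrable_indicator_Icc_pow μ y 2
  have i12 : Integrable (fun u => (Set.Icc (-x) x).indicator (fun u => u ^ 2) u -
      (Set.Icc (-y) y).indicator (fun u => u ^ 2) u) μ := i1.sub i2
  have i3 : Integrable ((Set.Icc (-x) x).indicator fun u => |u| ^ 3) μ :=
    ((continuous_abs.pow 3).continuousOn.integrableOn_compact isCompact_Icc).integrable_indicator
      measurableSet_Icc
  rw [truncThird, ← integral_indicator measurableSet_Icc, truncSecond_eq, truncSecond_eq,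
    ← integral_sub i1 i2, ← integral_const_mul, ← integral_const_mul,
    ← integral_add (i2.const_mul y) (i12.const_mul x)]
  refine integral_mono i3 ((i2.const_mul y).add (i12.const_mul x)) fun u => ?_
  by_cases hu : u ∈ Set.Icc (-x) x
  · have h3 : |u| ^ 3 = |u| * u ^ 2 := by rw [← sq_abs u]; ring
    by_cases huy : u ∈ Set.Icc (-y) y
    · simp only [Set.indicator_of_mem hu, Set.indicator_of_mem huy, sub_self, mul_zero, add_zero,
        h3]
      exact mul_le_mul_of_nonneg_right (abs_le.mpr huy) (sq_nonneg u)
    · simp only [Set.indicator_of_mem hu, Set.indicator_of_notMem huy, sub_zero, mul_zero, zero_add,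
        h3]
      exact mul_le_mul_of_nonneg_right (abs_le.mpr hu) (sq_nonneg u)
  · have huy : u ∉ Set.Icc (-y) y := fun h => hu ⟨by linarith [h.1], by linarith [h.2]⟩
    simp [Set.indicator_of_notMem hu, Set.indicator_of_notMem huy]

lemma eventually_truncThird_le
    (htail : ∀ ε > 0, ∀ᶠ x in atTop, x ^ 2 * μ.real (Set.Icc (-x) x)ᶜ ≤ ε * truncSecond μ x)
    {ε : ℝ} (hε : 0 < ε) :
    ∀ᶠ x in atTop, truncThird μ x ≤ ε * (x * truncSecond μ x) := by
  obtain ⟨j, hj⟩ := exists_pow_lt_of_lt_one (half_pos hε) (one_half_lt_one (α := ℝ))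
  have h1 := eventually_truncSecond_two_pow_mul_le htail j (ε / 2) (by positivity)
  have h2 : Tendsto (fun x : ℝ => (1 / 2) ^ j * x) atTop atTop :=
    tendsto_id.const_mul_atTop (by positivity)
  filter_upwards [h2.eventually h1, eventually_ge_atTop 0] with x h3 h0
  have h4 : (2 : ℝ) ^ j * ((1 / 2) ^ j * x) = x := by
    rw [← mul_assoc, ← mul_pow]
    norm_num
  rw [h4] at h3
  have h5 : (1 / 2 : ℝ) ^ j * x ≤ x := by
    have : (1 / 2 : ℝ) ^ j ≤ 1 := pow_le_one₀ (by norm_num) (by norm_num)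
    nlinarith
  have h6 := truncThird_le μ (y := (1 / 2) ^ j * x) (x := x) h5
  have h7 := truncSecond_mono μ h5
  have h8 := truncSecond_nonneg μ ((1 / 2) ^ j * x)
  have h9 : (1 / 2) ^ j * x * truncSecond μ ((1 / 2) ^ j * x) ≤ ε / 2 * x * truncSecond μ x := by
    gcongr
  have h10 : x * (truncSecond μ x - truncSecond μ ((1 / 2) ^ j * x)) ≤
      x * (ε / 2 * truncSecond μ x) := by
    refine mul_le_mul_of_nonneg_left ?_ h0
    nlinarith
  linarith

lemma eventually_truncSecond_le_mul_sq
    (htail : ∀ ε > 0, ∀ᶠ x in atTop, x ^ 2 * μ.real (Set.Icc (-x) x)ᶜ ≤ ε * truncSecond μ x)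
    {ε : ℝ} (hε : 0 < ε) : ∀ᶠ x in atTop, truncSecond μ x ≤ ε * x ^ 2 := by
  obtain ⟨x₀, hx₀⟩ := eventually_atTop.mp (eventually_truncSecond_two_mul_le htail one_pos)
  set x₁ := max x₀ 1 with hx₁
  have hx₁1 : 1 ≤ x₁ := le_max_right _ _
  have h2 : ∀ x, x₁ ≤ x → truncSecond μ (2 * x) ≤ 2 * truncSecond μ x := fun x hx => by
    have := hx₀ x ((le_max_left _ _).trans hx)
    linarith
  filter_upwards [eventually_ge_atTop x₁, eventually_ge_atTop (2 * truncSecond μ x₁ / ε)]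
    with x h3 h4
  have hxpos : 0 < x := by linarith
  have h5 := truncSecond_mul_le (by linarith) h2 le_rfl (t := x / x₁)
    ((one_le_div (by linarith)).mpr h3)
  rw [div_mul_cancel₀ _ (by linarith)] at h5
  rw [div_le_iff₀ hε] at h4
  have h6 : x / x₁ ≤ x := div_le_self hxpos.le hx₁1
  calc truncSecond μ x ≤ 2 * (x / x₁) * truncSecond μ x₁ := h5
    _ ≤ 2 * x * truncSecond μ x₁ := by
        have := truncSecond_nonneg μ x₁
        gcongr
    _ = x * (2 * truncSecond μ x₁) := by ring
    _ ≤ x * (x * ε) := by gcongr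
    _ = ε * x ^ 2 := by ring

end SlowVariation

/-! ### Characteristic function bounds -/

/-- Taylor remainders of `exp (i z)` of orders two, three and four. -/
lemma norm_exp_mul_I_taylor (z : ℝ) :
    ‖Complex.exp (z * Complex.I) - 1 - z * Complex.I‖ ≤ |z| ^ 2 ∧
    ‖Complex.exp (z * Complex.I) - 1 - z * Complex.I + z ^ 2 / 2‖ ≤ |z| ^ 3 ∧
    ‖Complex.exp (z * Complex.I) - 1 - z * Complex.I + z ^ 2 / 2 + z ^ 3 / 6 * Complex.I‖
      ≤ |z| ^ 4 := by
  have hz (z : ℝ) : HasDerivAt (fun z : ℝ => (z : ℂ)) 1 z := Complex.ofRealCLM.hasDerivAt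
  have he (z : ℝ) : HasDerivAt (fun z : ℝ => Complex.exp (z * Complex.I))
      (Complex.exp (z * Complex.I) * Complex.I) z := by
    simpa using ((hz z).mul_const Complex.I).cexp
  have hI {w w' : ℂ} {C : ℝ} (h : ‖w‖ ≤ C) (hw : w' = w * Complex.I) : ‖w'‖ ≤ C := by
    rw [hw, norm_mul, Complex.norm_I, mul_one]
    exact h
  have I2 := Complex.I_sq
  have h1 : ∀ z : ℝ, ‖Complex.exp (z * Complex.I) - 1‖ ≤ 1 * |z| ^ (0 + 1) :=
    norm_le_of_hasDerivAt_le zero_le_one (fun z => (he z).sub_const 1) (by simp) (fun z => by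
      rw [norm_mul, Complex.norm_exp_ofReal_mul_I, Complex.norm_I]
      simp)
  have h2 : ∀ z : ℝ, ‖Complex.exp (z * Complex.I) - 1 - z * Complex.I‖ ≤ 1 * |z| ^ (0 + 1 + 1) :=
    norm_le_of_hasDerivAt_le zero_le_one
      (fun z => ((he z).sub_const 1).sub ((hz z).mul_const Complex.I)) (by simp) (fun z =>
      hI (h1 z) (by ring))
  have h3 : ∀ z : ℝ, ‖Complex.exp (z * Complex.I) - 1 - z * Complex.I + z ^ 2 / 2‖
      ≤ 1 * |z| ^ (0 + 1 + 1 + 1) :=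
    norm_le_of_hasDerivAt_le zero_le_one
      (fun z => (((he z).sub_const 1).sub ((hz z).mul_const Complex.I)).add
        (((hz z).pow 2).div_const 2)) (by simp) (fun z => hI (h2 z) (by
          push_cast
          linear_combination (z : ℂ) * I2))
  have h4 : ∀ z : ℝ, ‖Complex.exp (z * Complex.I) - 1 - z * Complex.I + z ^ 2 / 2
      + z ^ 3 / 6 * Complex.I‖ ≤ 1 * |z| ^ (0 + 1 + 1 + 1 + 1) :=
    norm_le_of_hasDerivAt_le zero_le_one
      (fun z => ((((he z).sub_const 1).sub ((hz z).mul_const Complex.I)).add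
        (((hz z).pow 2).div_const 2)).add ((((hz z).pow 3).div_const 6).mul_const Complex.I))
      (by simp) (fun z => hI (h3 z) (by
          push_cast
          linear_combination (z : ℂ) * I2))
  exact ⟨by simpa using h2 z, by simpa using h3 z, by simpa using h4 z⟩

lemma norm_exp_mul_I_sub_one_le (z : ℝ) : ‖Complex.exp (z * Complex.I) - 1‖ ≤ |z| := by
  have h := Real.norm_exp_I_mul_ofReal_sub_one_le (x := z)
  rwa [mul_comm] at h

lemma norm_exp_mul_I_sub_one_le_two (z : ℝ) : ‖Complex.exp (z * Complex.I) - 1‖ ≤ 2 := by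
  refine (norm_sub_le _ _).trans ?_
  rw [Complex.norm_exp_ofReal_mul_I, norm_one]
  norm_num

lemma integrable_exp_mul_I (ρ : Measure ℝ) [IsFiniteMeasure ρ] (t : ℝ) :
    Integrable (fun u : ℝ => Complex.exp ((t * u : ℝ) * Complex.I)) ρ := by
  refine Integrable.of_bound (C := 1) (Continuous.aestronglyMeasurable (by fun_prop))
    (ae_of_all _ fun w => ?_)
  rw [Complex.norm_exp_ofReal_mul_I]

lemma charFun_sub_one (ρ : Measure ℝ) [IsProbabilityMeasure ρ] (t : ℝ) :
    charFun ρ t - 1 = ∫ u, (Complex.exp ((t * u : ℝ) * Complex.I) - 1) ∂ρ := by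
  rw [integral_sub (integrable_exp_mul_I ρ t) (integrable_const _), charFun_apply_real]
  simp

lemma re_charFun_sub_one_le (μ : Measure ℝ) [IsProbabilityMeasure μ] {x : ℝ} (hx : 0 < x) :
    (charFun μ x⁻¹ - 1).re ≤ -(2 / 5) * (truncSecond μ x / x ^ 2) := by
  have h1 : (charFun μ x⁻¹ - 1).re = -∫ u, (1 - Real.cos (x⁻¹ * u)) ∂μ := by
    have hc : Integrable (fun u => Real.cos (x⁻¹ * u)) μ :=
      Integrable.of_bound (C := 1) (Continuous.aestronglyMeasurable (by fun_prop))
        (ae_of_all _ fun u => Real.abs_cos_le_one _)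
    rw [integral_sub (integrable_const _) hc, integral_cos_eq_re_charFun]
    simp
  have h2 : 2 / 5 * (truncSecond μ x / x ^ 2) ≤ ∫ u, (1 - Real.cos (x⁻¹ * u)) ∂μ := by
    have e : 2 / 5 * (truncSecond μ x / x ^ 2) =
        ∫ u, 2 / 5 / x ^ 2 * (Set.Icc (-x) x).indicator (fun u => u ^ 2) u ∂μ := by
      rw [integral_const_mul, ← truncSecond_eq]
      ring
    rw [e]
    refine integral_mono ((integrable_indicator_Icc_pow μ x 2).const_mul _)
      (integrable_one_sub_cos μ _) fun u => ?_
    by_cases hu : u ∈ Set.Icc (-x) x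
    · simp only [Set.indicator_of_mem hu]
      have h3 : |x⁻¹ * u| ≤ 1 := by
        rw [abs_mul, abs_inv, abs_of_pos hx, inv_mul_le_one₀ hx]
        exact abs_le.mpr hu
      have h4 := sq_le_mul_one_sub_cos h3
      have h5 : 2 / 5 / x ^ 2 * u ^ 2 = 2 / 5 * (x⁻¹ * u) ^ 2 := by field_simp
      rw [h5]
      linarith
    · simp only [Set.indicator_of_notMem hu, mul_zero]
      linarith [Real.cos_le_one (x⁻¹ * u)]
  rw [h1]
  linarith

lemma norm_charFun_sub_one_le {μ : Measure ℝ} [IsProbabilityMeasure μ] (hint : Integrable id μ)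
    (hmean : ∫ u, u ∂μ = 0) {x : ℝ} (hx : 0 < x) :
    ‖charFun μ x⁻¹ - 1‖ ≤ truncSecond μ x / x ^ 2 + 2 * (tailFirst μ x / x) := by
  have hi : Integrable (fun u : ℝ => (((x⁻¹ * u : ℝ) : ℂ)) * Complex.I) μ :=
    ((hint.const_mul x⁻¹).ofReal).mul_const Complex.I
  have h1 : charFun μ x⁻¹ - 1 = ∫ u, (Complex.exp ((x⁻¹ * u : ℝ) * Complex.I) - 1 -
      ((x⁻¹ * u : ℝ) : ℂ) * Complex.I) ∂μ := by
    have hi' : Integrable (fun u => Complex.exp ((x⁻¹ * u : ℝ) * Complex.I) - 1) μ :=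
      (integrable_exp_mul_I μ _).sub (integrable_const _)
    rw [integral_sub hi' hi, ← charFun_sub_one,
      integral_mul_const, integral_complex_ofReal, integral_const_mul, hmean]
    simp
  have e : truncSecond μ x / x ^ 2 + 2 * (tailFirst μ x / x) =
      ∫ u, (1 / x ^ 2 * (Set.Icc (-x) x).indicator (fun u => u ^ 2) u +
        2 / x * (Set.Icc (-x) x)ᶜ.indicator (fun u => |u|) u) ∂μ := by
    rw [integral_add ((integrable_indicator_Icc_pow μ x 2).const_mul _)
      ((integrable_indicator_abs hint x).const_mul _), integral_const_mul, integral_const_mul,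
      ← truncSecond_eq, ← tailFirst_eq]
    ring
  rw [h1, e]
  refine norm_integral_le_of_norm_le (((integrable_indicator_Icc_pow μ x 2).const_mul _).add
      ((integrable_indicator_abs hint x).const_mul _)) (ae_of_all _ fun u => ?_)
  by_cases hu : u ∈ Set.Icc (-x) x
  · simp only [Set.indicator_of_mem hu, Set.indicator_of_notMem (Set.notMem_compl_iff.mpr hu),
      mul_zero, add_zero]
    refine (norm_exp_mul_I_taylor (x⁻¹ * u)).1.trans (le_of_eq ?_)
    rw [sq_abs]
    field_simp
  · simp only [Set.indicator_of_notMem hu, Set.indicator_of_mem (Set.mem_compl hu),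
      mul_zero, zero_add]
    refine (norm_sub_le _ _).trans ?_
    have h2 := norm_exp_mul_I_sub_one_le (x⁻¹ * u)
    rw [norm_mul, Complex.norm_I, mul_one, Complex.norm_real, Real.norm_eq_abs]
    rw [abs_mul, abs_of_pos (inv_pos.mpr hx)] at h2 ⊢
    calc _ ≤ x⁻¹ * |u| + x⁻¹ * |u| := by gcongr
      _ = 2 / x * |u| := by ring

/-- The behaviour of the characteristic function near the origin, with `x = 1 / t`. -/
lemma eventually_charFun_bounds {μ : Measure ℝ} [IsProbabilityMeasure μ]
    (htail : ∀ ε > 0, ∀ᶠ x in atTop, x ^ 2 * μ.real (Set.Icc (-x) x)ᶜ ≤ ε * truncSecond μ x)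
    (hint : Integrable id μ) (hmean : ∫ u, u ∂μ = 0) :
    ∀ᶠ x in atTop, ‖charFun μ x⁻¹ - 1‖ ≤ 4 * (truncSecond μ x / x ^ 2) ∧
      (charFun μ x⁻¹ - 1).re ≤ -(2 / 5) * (truncSecond μ x / x ^ 2) ∧
      truncSecond μ x / x ^ 2 ≤ 1 / 40 ∧
      ‖charFun μ x⁻¹‖ ≤ Real.exp (-(truncSecond μ x / x ^ 2) / 5) := by
  filter_upwards [eventually_mul_tailFirst_le htail hint one_pos,
    eventually_truncSecond_le_mul_sq htail (ε := 1 / 40) (by norm_num), eventually_gt_atTop 0]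
    with x h1 h2 hx
  have h3 := norm_charFun_sub_one_le hint hmean hx
  have h4 := re_charFun_sub_one_le μ hx
  set q := truncSecond μ x / x ^ 2 with hq
  have h5 : tailFirst μ x / x ≤ q := by
    rw [hq, div_le_div_iff₀ hx (by positivity)]
    nlinarith
  have hq0 : 0 ≤ q := div_nonneg (truncSecond_nonneg μ x) (sq_nonneg x)
  have hq1 : q ≤ 1 / 40 := by
    rw [hq, div_le_iff₀ (by positivity)]
    exact h2
  have h6 : ‖charFun μ x⁻¹ - 1‖ ≤ 4 * q := by linarith
  refine ⟨h6, h4, hq1, ?_⟩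
  have h7 : ‖charFun μ x⁻¹‖ ^ 2 =
      1 + 2 * (charFun μ x⁻¹ - 1).re + ‖charFun μ x⁻¹ - 1‖ ^ 2 := by
    rw [← Complex.normSq_eq_norm_sq, ← Complex.normSq_eq_norm_sq, Complex.normSq_apply,
      Complex.normSq_apply]
    simp
    ring
  have h8 : ‖charFun μ x⁻¹ - 1‖ ^ 2 ≤ (4 * q) ^ 2 := by gcongr
  have h9 : ‖charFun μ x⁻¹‖ ^ 2 ≤ Real.exp (-q / 5) ^ 2 := by
    rw [← Real.exp_nat_mul]
    have h10 := Real.add_one_le_exp (((2 : ℕ) : ℝ) * (-q / 5))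
    push_cast at h10 ⊢
    nlinarith
  exact (sq_le_sq₀ (norm_nonneg _) (Real.exp_pos _).le).mp h9

lemma norm_pow_sub_pow_le {a b : ℂ} {M : ℝ} (ha : ‖a‖ ≤ M) (hb : ‖b‖ ≤ M) (n : ℕ) :
    ‖a ^ n - b ^ n‖ ≤ n * M ^ (n - 1) * ‖a - b‖ := by
  have hM : 0 ≤ M := (norm_nonneg a).trans ha
  induction n with
  | zero => simp
  | succ n ih =>
    have e : a ^ (n + 1) - b ^ (n + 1) = a ^ n * (a - b) + (a ^ n - b ^ n) * b := by ring
    rw [e, Nat.add_sub_cancel]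
    have h1 : ‖a ^ n * (a - b)‖ ≤ M ^ n * ‖a - b‖ := by
      rw [norm_mul, norm_pow]
      gcongr
    have h2 : ‖(a ^ n - b ^ n) * b‖ ≤ n * M ^ n * ‖a - b‖ := by
      rw [norm_mul]
      calc ‖a ^ n - b ^ n‖ * ‖b‖ ≤ (n * M ^ (n - 1) * ‖a - b‖) * M := by gcongr
        _ = n * M ^ n * ‖a - b‖ := by
          rcases n with _ | n
          · simp
          · rw [Nat.add_sub_cancel, pow_succ]
            ring
    refine (norm_add_le _ _).trans ((add_le_add h1 h2).trans (le_of_eq ?_))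
    push_cast
    ring

lemma norm_exp_sub_one_le_mul (w : ℂ) :
    ‖Complex.exp w - 1‖ ≤ ‖w‖ * max 1 (Real.exp w.re) := by
  have hd (τ : ℝ) : HasDerivAt (fun τ : ℝ => Complex.exp (τ * w)) (Complex.exp (τ * w) * w) τ := by
    simpa using ((Complex.ofRealCLM.hasDerivAt (x := τ)).mul_const w).cexp
  have h := norm_image_sub_le_of_norm_deriv_le_segment_01' (C := ‖w‖ * max 1 (Real.exp w.re))
    (fun τ _ => (hd τ).hasDerivWithinAt) (fun τ hτ => by
      rw [norm_mul, Complex.norm_exp, mul_comm]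
      gcongr
      simp only [Complex.re_ofReal_mul]
      rcases le_total w.re 0 with h | h
      · exact le_max_of_le_left (Real.exp_le_one_iff.mpr (mul_nonpos_of_nonneg_of_nonpos hτ.1 h))
      · exact le_max_of_le_right (Real.exp_le_exp.mpr (by nlinarith [hτ.2])))
  simpa using h

/-- A second-order remainder bound for the complex exponential without exponential growth
for negative real parts. -/
lemma norm_exp_sub_one_sub_le (d : ℂ) :
    ‖Complex.exp d - 1 - d‖ ≤ ‖d‖ ^ 2 * (1 + Real.exp d.re) := by
  have hd (τ : ℝ) : HasDerivAt (fun τ : ℝ => Complex.exp (τ * d) - τ * d)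
      (Complex.exp (τ * d) * d - 1 * d) τ := by
    have h1 := (Complex.ofRealCLM.hasDerivAt (x := τ)).mul_const d
    refine (h1.cexp.sub h1).congr_deriv ?_
    simp
  have hM : max 1 (Real.exp d.re) ≤ 1 + Real.exp d.re :=
    max_le (by linarith [Real.exp_pos d.re]) (by linarith)
  have h := norm_image_sub_le_of_norm_deriv_le_segment_01' (C := ‖d‖ ^ 2 * max 1 (Real.exp d.re))
    (fun τ _ => (hd τ).hasDerivWithinAt) (fun τ hτ => by
      rw [← sub_mul, norm_mul]
      have h1 := norm_exp_sub_one_le_mul (τ * d)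
      have h2 : max 1 (Real.exp ((τ : ℂ) * d).re) ≤ max 1 (Real.exp d.re) := by
        simp only [Complex.re_ofReal_mul]
        rcases le_total d.re 0 with h | h
        · exact max_le (le_max_left _ _) (le_max_of_le_left
            (Real.exp_le_one_iff.mpr (mul_nonpos_of_nonneg_of_nonpos hτ.1 h)))
        · exact max_le_max le_rfl (Real.exp_le_exp.mpr (by nlinarith [hτ.2]))
      have h3 : ‖(τ : ℂ) * d‖ ≤ ‖d‖ := by
        rw [norm_mul, Complex.norm_real, Real.norm_of_nonneg hτ.1]
        nlinarith [norm_nonneg d, hτ.2]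
      calc ‖Complex.exp (τ * d) - 1‖ * ‖d‖
          ≤ (‖d‖ * max 1 (Real.exp d.re)) * ‖d‖ := by
            gcongr
            exact h1.trans (by gcongr)
        _ = _ := by ring)
  have e : Complex.exp ((1 : ℝ) * d) - (1 : ℝ) * d - (Complex.exp ((0 : ℝ) * d) - (0 : ℝ) * d) =
      Complex.exp d - 1 - d := by
    simp
    ring
  rw [e] at h
  exact h.trans (mul_le_mul_of_nonneg_left hM (sq_nonneg _))

/-- Comparison of `ψ ^ n` with `exp (-s ^ 2 / 2) * (1 + d)`, where `d = n (ψ - 1) + s ^ 2 / 2`. -/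
lemma norm_pow_sub_exp_mul_le {ψ : ℂ} {n : ℕ} (hn : 2 ≤ n) {q s : ℝ} (hs : 0 < s)
    (h1 : ‖ψ - 1‖ ≤ 4 * q) (h2 : (ψ - 1).re ≤ -(2 / 5) * q) (hq : q ≤ 1 / 40)
    (h3 : ‖ψ‖ ≤ Real.exp (-q / 5)) (h4 : s / 2 - 1 / 2 ≤ n * q) (h5 : n * q ≤ 2 * s + s ^ 2) :
    ‖ψ ^ n - Complex.exp (-s ^ 2 / 2) * (1 + (n * (ψ - 1) + s ^ 2 / 2))‖ ≤
      (32 / n * (2 * s + s ^ 2) ^ 2 + 4 * ‖(n * (ψ - 1) + s ^ 2 / 2 : ℂ)‖ ^ 2) *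
        Real.exp (-s / 20) := by
  set v := ψ - 1 with hv
  set d : ℂ := n * v + s ^ 2 / 2 with hd
  have hq0 : 0 ≤ q := by linarith [norm_nonneg v]
  have hn2 : (2 : ℝ) ≤ n := by exact_mod_cast hn
  have hbase : Real.exp (1 / 2) ≤ 2 := by
    have h6 : Real.exp (1 / 2) ^ 2 ≤ 2 ^ 2 := by
      rw [← Real.exp_nat_mul]
      norm_num
      linarith [Real.exp_one_lt_d9]
    exact (sq_le_sq₀ (Real.exp_pos _).le two_pos.le).mp h6
  have hexp {y : ℝ} (hy : y ≤ -s / 20 + 1 / 2) : Real.exp y ≤ 2 * Real.exp (-s / 20) := by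
    refine (Real.exp_le_exp.mpr hy).trans ?_
    rw [Real.exp_add, mul_comm]
    gcongr
  -- `ψ ^ n` is first compared with `exp (n (ψ - 1)) = exp (-s ^ 2 / 2) * exp d`
  have hA : ‖ψ ^ n - Complex.exp (n * v)‖ ≤
      32 / n * (2 * s + s ^ 2) ^ 2 * Real.exp (-s / 20) := by
    have h6 : ‖Complex.exp v‖ ≤ Real.exp (-q / 5) := by
      rw [Complex.norm_exp]
      exact Real.exp_le_exp.mpr (by linarith)
    have h7 : ‖ψ - Complex.exp v‖ ≤ (4 * q) ^ 2 := by
      have h8 := Complex.norm_exp_sub_one_sub_id_le (x := v) (by linarith)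
      have h9 : ψ - Complex.exp v = -(Complex.exp v - 1 - v) := by rw [hv]; ring
      rw [h9, norm_neg]
      exact h8.trans (by gcongr)
    have h10 : Real.exp (-q / 5) ^ (n - 1) ≤ 2 * Real.exp (-s / 20) := by
      rw [← Real.exp_nat_mul]
      refine hexp ?_
      rw [Nat.cast_sub (by omega)]
      push_cast
      nlinarith
    rw [Complex.exp_nat_mul]
    calc ‖ψ ^ n - Complex.exp v ^ n‖
        ≤ n * Real.exp (-q / 5) ^ (n - 1) * ‖ψ - Complex.exp v‖ := norm_pow_sub_pow_le h3 h6 n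
      _ ≤ n * (2 * Real.exp (-s / 20)) * (4 * q) ^ 2 := by gcongr
      _ = 32 / n * (n * q) ^ 2 * Real.exp (-s / 20) := by field_simp; ring
      _ ≤ 32 / n * (2 * s + s ^ 2) ^ 2 * Real.exp (-s / 20) := by gcongr
  have hB : ‖Complex.exp (n * v) - Complex.exp (-s ^ 2 / 2) * (1 + d)‖ ≤
      4 * ‖d‖ ^ 2 * Real.exp (-s / 20) := by
    have e1 : Complex.exp (n * v) = Complex.exp (-s ^ 2 / 2) * Complex.exp d := by
      rw [← Complex.exp_add, hd]
      ring_nf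
    have e2 : ‖Complex.exp (-(s : ℂ) ^ 2 / 2)‖ = Real.exp (-s ^ 2 / 2) := by
      rw [Complex.norm_exp]
      norm_cast
    have e3 : d.re = n * v.re + s ^ 2 / 2 := by
      rw [hd]
      simp [← Complex.ofReal_pow]
    have e4 : Complex.exp (n * v) - Complex.exp (-s ^ 2 / 2) * (1 + d) =
        Complex.exp (-s ^ 2 / 2) * (Complex.exp d - 1 - d) := by rw [e1]; ring
    rw [e4, norm_mul, e2]
    have h6 : Real.exp (-s ^ 2 / 2) ≤ 2 * Real.exp (-s / 20) :=
      hexp (by nlinarith [sq_nonneg (s - 1)])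
    have h7 : Real.exp (-s ^ 2 / 2) * Real.exp d.re ≤ 2 * Real.exp (-s / 20) := by
      rw [← Real.exp_add]
      refine hexp ?_
      rw [e3]
      nlinarith
    calc _ ≤ Real.exp (-s ^ 2 / 2) * (‖d‖ ^ 2 * (1 + Real.exp d.re)) := by
          gcongr
          exact norm_exp_sub_one_sub_le d
      _ = ‖d‖ ^ 2 * (Real.exp (-s ^ 2 / 2) + Real.exp (-s ^ 2 / 2) * Real.exp d.re) := by ring
      _ ≤ ‖d‖ ^ 2 * (2 * Real.exp (-s / 20) + 2 * Real.exp (-s / 20)) := by gcongr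
      _ = _ := by ring
  have h6 := norm_sub_le_norm_sub_add_norm_sub (ψ ^ n) (Complex.exp (n * v))
    (Complex.exp (-s ^ 2 / 2) * (1 + d))
  refine h6.trans ((add_le_add hA hB).trans (le_of_eq ?_))
  ring

/-! ### The defect of the characteristic function -/

section Defect

variable {ν : Measure ℝ} [IsProbabilityMeasure ν] {n : ℝ}

/-- The defect `n (ψ(s) - 1) + s ^ 2 / 2` of a normalised characteristic function is at most of the
order of the rate. -/
lemma norm_defect_le_scaledRate (hn : 0 ≤ n) (h2 : n * unitMoment ν 2 = 1) {s : ℝ} (hs : 0 ≤ s) :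
    ‖(n * (charFun ν s - 1) + s ^ 2 / 2 : ℂ)‖ ≤ 3 * (1 + s ^ 4) * scaledRate ν n := by
  have hf : Integrable (fun u : ℝ => Complex.exp ((s * u : ℝ) * Complex.I) - 1) ν :=
    (integrable_exp_mul_I ν s).sub (integrable_const _)
  have h := norm_mul_integral_sub_moments_le hn hf (s * Complex.I) (-(s : ℂ) ^ 2 / 2)
    (-((s : ℂ) ^ 3 / 6 * Complex.I)) (2 + s ^ 4) 4
    (fun u _ => by
      have h1 := (norm_exp_mul_I_taylor (s * u)).2.2
      have e : Complex.exp ((s * u : ℝ) * Complex.I) - 1 - (u • ((s : ℂ) * Complex.I) +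
          u ^ 2 • (-(s : ℂ) ^ 2 / 2) + u ^ 3 • (-((s : ℂ) ^ 3 / 6 * Complex.I))) =
          Complex.exp ((s * u : ℝ) * Complex.I) - 1 - (s * u : ℝ) * Complex.I +
          ((s * u : ℝ) : ℂ) ^ 2 / 2 + ((s * u : ℝ) : ℂ) ^ 3 / 6 * Complex.I := by
        simp only [Complex.real_smul]
        push_cast
        ring
      rw [e]
      refine h1.trans ?_
      rw [Even.pow_abs (by decide), mul_pow]
      nlinarith [sq_nonneg (u ^ 2)])
    (fun u => (norm_exp_mul_I_sub_one_le_two _).trans (by nlinarith [sq_nonneg (s ^ 2)]))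
  rw [← charFun_sub_one, h2] at h
  simp only [Complex.real_smul, one_smul] at h
  set A := n * unitMoment ν 1 with hA
  set B := n * unitMoment ν 3 with hB
  have e : (n * (charFun ν s - 1) + s ^ 2 / 2 : ℂ) =
      (n * (charFun ν s - 1) - (A * (s * Complex.I) + -(s : ℂ) ^ 2 / 2 +
        B * (-((s : ℂ) ^ 3 / 6 * Complex.I)))) + (A * (s * Complex.I) +
        B * (-((s : ℂ) ^ 3 / 6 * Complex.I))) := by ring
  have h3 : ‖(A * (s * Complex.I) : ℂ)‖ ≤ (1 + s ^ 4) * |A| := by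
    rw [norm_mul, norm_mul, Complex.norm_I, Complex.norm_real, Complex.norm_real, Real.norm_eq_abs,
      Real.norm_eq_abs, abs_of_nonneg hs, mul_one, mul_comm]
    refine mul_le_mul_of_nonneg_right ?_ (abs_nonneg _)
    nlinarith [sq_nonneg (s ^ 2 - 1), sq_nonneg (s - 1)]
  have h4 : ‖(B * (-((s : ℂ) ^ 3 / 6 * Complex.I)) : ℂ)‖ ≤ (1 + s ^ 4) * |B| := by
    have e1 : ‖(-((s : ℂ) ^ 3 / 6 * Complex.I) : ℂ)‖ = s ^ 3 / 6 := by
      rw [norm_neg, norm_mul, norm_div, norm_pow, Complex.norm_I, Complex.norm_real,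
        Real.norm_eq_abs, abs_of_nonneg hs]
      simp
    rw [norm_mul, Complex.norm_real, Real.norm_eq_abs, e1, mul_comm]
    refine mul_le_mul_of_nonneg_right ?_ (abs_nonneg _)
    nlinarith [sq_nonneg (s ^ 2 - s), sq_nonneg (s ^ 2 - 1), sq_nonneg (s - 1)]
  have h5 : 0 ≤ n * unitMoment ν 4 + n * ν.real (Set.Icc (-1) 1)ᶜ := by
    have := unitMoment_nonneg ν (k := 4) (by decide)
    positivity
  have hA' : |A| = n * |unitMoment ν 1| := by rw [hA, abs_mul, abs_of_nonneg hn]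
  have hB' : |B| = n * |unitMoment ν 3| := by rw [hB, abs_mul, abs_of_nonneg hn]
  rw [e]
  refine (norm_add_le _ _).trans
    ((add_le_add h ((norm_add_le _ _).trans (add_le_add h3 h4))).trans ?_)
  rw [hA', hB', scaledRate]
  have h6 : 0 ≤ n * |unitMoment ν 1| := by positivity
  have h7 : 0 ≤ n * |unitMoment ν 3| := by positivity
  have h8 : 0 ≤ s ^ 4 := by positivity
  nlinarith [mul_nonneg h8 h5, mul_nonneg h8 h6, mul_nonneg h8 h7]

lemma abs_unitMoment_one_le {ρ : Measure ℝ} (hint : Integrable id ρ) (hmean : ∫ u, u ∂ρ = 0) :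
    |unitMoment ρ 1| ≤ tailFirst ρ 1 := by
  have h := integral_add_compl (μ := ρ) (f := fun u => u) (s := Set.Icc (-1 : ℝ) 1)
    measurableSet_Icc hint
  rw [hmean] at h
  have h1 : unitMoment ρ 1 = -∫ u in (Set.Icc (-1 : ℝ) 1)ᶜ, u ∂ρ := by
    simp only [unitMoment, pow_one]
    linarith
  rw [h1, abs_neg]
  exact abs_integral_le_integral_abs

lemma measureReal_compl_le_tailFirst (hint : Integrable id ν) :
    ν.real (Set.Icc (-1) 1)ᶜ ≤ tailFirst ν 1 := by
  rw [← integral_indicator_one measurableSet_Icc.compl, tailFirst_eq]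
  refine integral_mono (integrable_indicator_compl_Icc ν 1) (integrable_indicator_abs hint 1)
    fun u => ?_
  by_cases hu : u ∈ (Set.Icc (-1 : ℝ) 1)ᶜ
  · simp only [Set.indicator_of_mem hu, Pi.one_apply]
    by_contra! hlt
    exact hu (abs_le.mp hlt.le)
  · simp only [Set.indicator_of_notMem hu, le_refl]

lemma integrableOn_abs_pow (ν : Measure ℝ) [IsFiniteMeasure ν] (x : ℝ) (k : ℕ) :
    IntegrableOn (fun u => |u| ^ k) (Set.Icc (-x) x) ν :=
  (continuous_abs.pow k).continuousOn.integrableOn_compact isCompact_Icc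

lemma abs_unitMoment_three_le (ν : Measure ℝ) : |unitMoment ν 3| ≤ truncThird ν 1 := by
  refine abs_integral_le_integral_abs.trans (le_of_eq ?_)
  simp only [abs_pow, truncThird]

lemma unitMoment_four_le : unitMoment ν 4 ≤ truncThird ν 1 := by
  refine setIntegral_mono_on
    ((continuous_pow 4).continuousOn.integrableOn_compact isCompact_Icc)
    (integrableOn_abs_pow ν 1 3) measurableSet_Icc fun u hu => ?_
  have h1 : |u| ≤ 1 := abs_le.mpr hu
  have h2 : u ^ 4 = |u| ^ 3 * |u| := by rw [← pow_succ, Even.pow_abs (by decide)]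
  rw [h2]
  exact mul_le_of_le_one_right (by positivity) h1

lemma scaledRate_le (hn : 0 ≤ n) (hint : Integrable id ν) (hmean : ∫ u, u ∂ν = 0) :
    scaledRate ν n ≤ 2 * (n * (tailFirst ν 1 + truncThird ν 1)) := by
  have h1 := mul_le_mul_of_nonneg_left (abs_unitMoment_one_le hint hmean) hn
  have h2 := mul_le_mul_of_nonneg_left (measureReal_compl_le_tailFirst hint) hn
  have h3 := mul_le_mul_of_nonneg_left (abs_unitMoment_three_le ν) hn
  have h4 := mul_le_mul_of_nonneg_left (unitMoment_four_le (ν := ν)) hn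
  rw [scaledRate]
  linarith

/-- A bound for the defect that vanishes at the origin and is small by itself, though not of the
order of the rate. -/
lemma norm_defect_le_mul (hn : 0 ≤ n) (h2 : n * unitMoment ν 2 = 1) (hint : Integrable id ν)
    (hmean : ∫ u, u ∂ν = 0) {s : ℝ} (hs : 0 ≤ s) :
    ‖(n * (charFun ν s - 1) + s ^ 2 / 2 : ℂ)‖ ≤
      s * (2 * (1 + s ^ 2) * (n * (tailFirst ν 1 + truncThird ν 1))) := by
  have hf : Integrable (fun u : ℝ => Complex.exp ((s * u : ℝ) * Complex.I) - 1) ν :=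
    (integrable_exp_mul_I ν s).sub (integrable_const _)
  have i3 : Integrable ((Set.Icc (-1 : ℝ) 1).indicator fun u => |u| ^ 3) ν :=
    (integrableOn_abs_pow ν 1 3).integrable_indicator measurableSet_Icc
  have i1 := integrable_indicator_abs hint 1
  have hR : Integrable (fun u => s ^ 3 * (Set.Icc (-1 : ℝ) 1).indicator (fun u => |u| ^ 3) u +
      s * (Set.Icc (-1 : ℝ) 1)ᶜ.indicator (fun u => |u|) u) ν :=
    (i3.const_mul _).add (i1.const_mul _)
  have h := norm_integral_sub_moments_le hf (s * Complex.I) (-(s : ℂ) ^ 2 / 2) 0 hR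
    (fun u hu => by
      simp only [Set.indicator_of_mem hu, Set.indicator_of_notMem (Set.notMem_compl_iff.mpr hu),
        mul_zero, add_zero]
      have h1 := (norm_exp_mul_I_taylor (s * u)).2.1
      have e : Complex.exp ((s * u : ℝ) * Complex.I) - 1 - (u • ((s : ℂ) * Complex.I) +
          u ^ 2 • (-(s : ℂ) ^ 2 / 2) + u ^ 3 • (0 : ℂ)) =
          Complex.exp ((s * u : ℝ) * Complex.I) - 1 - (s * u : ℝ) * Complex.I +
          ((s * u : ℝ) : ℂ) ^ 2 / 2 := by
        simp only [Complex.real_smul]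
        push_cast
        ring
      rw [e]
      refine h1.trans (le_of_eq ?_)
      rw [abs_mul, mul_pow, abs_of_nonneg hs])
    (fun u hu => by
      simp only [Set.indicator_of_notMem hu, Set.indicator_of_mem (Set.mem_compl hu), mul_zero,
        zero_add]
      refine (norm_exp_mul_I_sub_one_le _).trans (le_of_eq ?_)
      rw [abs_mul, abs_of_nonneg hs])
  rw [← charFun_sub_one, integral_add (i3.const_mul _) (i1.const_mul _), integral_const_mul,
    integral_const_mul, integral_indicator measurableSet_Icc, ← tailFirst_eq] at h
  change _ ≤ s ^ 3 * truncThird ν 1 + s * tailFirst ν 1 at h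
  simp only [Complex.real_smul, smul_zero, add_zero] at h
  have hm1 : ∫ u in Set.Icc (-1 : ℝ) 1, u ∂ν = unitMoment ν 1 := by simp [unitMoment]
  have hm2 : ∫ u in Set.Icc (-1 : ℝ) 1, u ^ 2 ∂ν = unitMoment ν 2 := rfl
  rw [hm1, hm2] at h
  have h2' : (n : ℂ) * unitMoment ν 2 = 1 := by exact_mod_cast h2
  have e : (n * (charFun ν s - 1) + s ^ 2 / 2 : ℂ) =
      n * (charFun ν s - 1 - (unitMoment ν 1 * (s * Complex.I) +
        unitMoment ν 2 * (-(s : ℂ) ^ 2 / 2))) + n * (unitMoment ν 1 * (s * Complex.I)) := by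
    linear_combination (-(s : ℂ) ^ 2 / 2) * h2'
  have h3 : ‖(n * (unitMoment ν 1 * (s * Complex.I)) : ℂ)‖ ≤ n * (s * tailFirst ν 1) := by
    rw [norm_mul, norm_mul, norm_mul, Complex.norm_I, Complex.norm_real, Complex.norm_real,
      Complex.norm_real, Real.norm_of_nonneg hn, Real.norm_of_nonneg hs, mul_one, mul_comm s]
    gcongr
    exact abs_unitMoment_one_le hint hmean
  rw [e]
  refine (norm_add_le _ _).trans ((add_le_add ?_ h3).trans (b := n * (s ^ 3 * truncThird ν 1 +
    s * tailFirst ν 1) + n * (s * tailFirst ν 1)) ?_)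
  · rw [norm_mul, Complex.norm_real, Real.norm_of_nonneg hn]
    gcongr
  · have h5 := mul_nonneg hn (tailFirst_nonneg ν 1)
    have h6 := mul_nonneg hn (truncThird_nonneg ν 1)
    have h7 : 0 ≤ s * (n * truncThird ν 1) := mul_nonneg hs h6
    have h8 : 0 ≤ s * s ^ 2 * (n * tailFirst ν 1) := mul_nonneg (by positivity) h5
    have h9 : 0 ≤ s * s ^ 2 * (n * truncThird ν 1) := mul_nonneg (by positivity) h6
    nlinarith

lemma abs_sub_le_of_hasDerivAt {f f' : ℝ → ℝ} {C : ℝ} (hf : ∀ x, HasDerivAt f (f' x) x)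
    (hC : ∀ x, |f' x| ≤ C) (x : ℝ) {y : ℝ} (hy : 0 ≤ y) : |f (x + y) - f x| ≤ C * y := by
  have := convex_univ.norm_image_sub_le_of_norm_hasDerivWithin_le (f := f) (f' := f') (C := C)
    (fun v _ => (hf v).hasDerivWithinAt) (fun v _ => hC v) (Set.mem_univ x) (Set.mem_univ (x + y))
  rwa [add_sub_cancel_left, Real.norm_eq_abs, Real.norm_eq_abs, abs_of_nonneg hy] at this

/-- The approximating function is Lipschitz, uniformly as long as the rate stays bounded. -/
lemma Phi_add_scaledLeading_sub_le (hn : 0 ≤ n) (h2 : n * unitMoment ν 2 = 1) (x : ℝ) {y : ℝ}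
    (hy : 0 ≤ y) : (Phi (x + y) + scaledLeading ν n (x + y)) - (Phi x + scaledLeading ν n x) ≤
      200 * (1 + scaledRate ν n) * y := by
  have hPhi (z : ℝ) : |Phi (z + y) - Phi z| ≤ 36 * y :=
    abs_sub_le_of_hasDerivAt hasDerivAt_Phi abs_phi_le z hy
  have hphi (z : ℝ) : |phi (z + y) - phi z| ≤ 36 * y :=
    abs_sub_le_of_hasDerivAt hasDerivAt_phi abs_neg_mul_phi_le z hy
  have hphi' (z : ℝ) : |-(z + y) * phi (z + y) - -z * phi z| ≤ 36 * y :=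
    abs_sub_le_of_hasDerivAt hasDerivAt_neg_mul_phi abs_sq_sub_one_mul_phi_le z hy
  set f : ℝ → ℝ := fun u => (Phi (x - u + y) - Phi (x - u)) - (Phi (x + y) - Phi x) with hf
  have hfd1 : ∀ u,
      ‖-(phi (x - u + y) - phi (x - u)) + (phi (x + y) - phi x)‖ ≤ 36 * y * |u| ^ 1 := by
    refine norm_le_of_hasDerivAt_le (k := 0)
      (g' := fun u => -(x - u + y) * phi (x - u + y) - -(x - u) * phi (x - u)) (by positivity)
      (fun u => ?_) (by simp) (fun u => by simpa using hphi' (x - u))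
    have h1 := ((hasDerivAt_phi (x - u + y)).comp_add_const (x - u) y).comp_const_sub x u
    have h3 := (hasDerivAt_phi (x - u)).comp_const_sub x u
    refine ((h1.sub h3).neg.add_const (phi (x + y) - phi x)).congr_deriv ?_
    ring
  have hfd0 : ∀ u, ‖f u + u * (phi (x + y) - phi x)‖ ≤ 36 * y * |u| ^ 2 := by
    refine norm_le_of_hasDerivAt_le (by positivity) (fun u => ?_) (by simp [hf]) hfd1
    have h1 := ((hasDerivAt_Phi (x - u + y)).comp_add_const (x - u) y).comp_const_sub x u
    have h3 := (hasDerivAt_Phi (x - u)).comp_const_sub x u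
    refine (((h1.sub h3).sub_const (Phi (x + y) - Phi x)).add
      ((hasDerivAt_id u).mul_const (phi (x + y) - phi x))).congr_deriv ?_
    ring
  have hfb : ∀ u, ‖f u‖ ≤ 72 * y := fun u => by
    refine (abs_sub _ _).trans ?_
    linarith [hPhi (x - u), hPhi x]
  have hfc : Continuous f :=
    ((continuous_Phi.comp (by fun_prop)).sub (continuous_Phi.comp (by fun_prop))).sub
      continuous_const
  have hfi : Integrable f ν :=
    Integrable.of_bound hfc.aestronglyMeasurable (72 * y) (ae_of_all _ hfb)
  have h := norm_mul_integral_sub_moments_le hn hfi (-(phi (x + y) - phi x)) 0 0 (72 * y) 2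
    (fun u _ => by
      have h3 := hfd0 u
      rw [sq_abs] at h3
      have e : f u - (u • (-(phi (x + y) - phi x)) + u ^ 2 • (0 : ℝ) + u ^ 3 • (0 : ℝ)) =
          f u + u * (phi (x + y) - phi x) := by
        simp only [smul_eq_mul]
        ring
      rw [e]
      nlinarith [mul_nonneg hy (sq_nonneg u)]) hfb
  simp only [smul_eq_mul, mul_zero, add_zero, h2, Real.norm_eq_abs] at h
  have hLf : n * ∫ u, f u ∂ν = n * (∫ u, (Phi (x + y - u) - Phi (x + y)) ∂ν) -
      n * (∫ u, (Phi (x - u) - Phi x) ∂ν) := by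
    rw [← mul_sub, ← integral_sub (integrable_Phi_sub ν (x + y)) (integrable_Phi_sub ν x)]
    congr 1
    refine integral_congr_ae (ae_of_all _ fun u => ?_)
    have e : x + y - u = x - u + y := by ring
    simp only [hf]
    rw [e]
    ring
  have h3 : |n * unitMoment ν 1 * -(phi (x + y) - phi x)| ≤ n * |unitMoment ν 1| * (36 * y) := by
    rw [abs_mul, abs_mul, abs_neg, abs_of_nonneg hn]
    exact mul_le_mul_of_nonneg_left (hphi x) (by positivity)
  have h4 := (abs_le.mp h).2
  have h5 := (abs_le.mp h3).2
  have h6 := (abs_le.mp (hphi' x)).1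
  have h7 := (abs_le.mp (hPhi x)).2
  have h8 := unitMoment_nonneg ν (k := 4) (by decide)
  have h9 : 0 ≤ n * unitMoment ν 4 * y := by positivity
  have h10 : 0 ≤ n * |unitMoment ν 3| * y := by positivity
  have h11 : 0 ≤ n * |unitMoment ν 1| * y := by positivity
  have h12 : 0 ≤ n * ν.real (Set.Icc (-1) 1)ᶜ * y := by positivity
  simp only [scaledLeading, scaledRate]
  nlinarith

end Defect

/-! ### The smoothing inequality applied to the expansion -/

/-- The measure with density `z ^ 2 * phi z`. Its characteristic function carries the term
`s ^ 2 / 2` of the expansion. -/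
noncomputable def sqGaussian : Measure ℝ :=
  (gaussianReal 0 1).withDensity fun z => ENNReal.ofReal (z ^ 2)

lemma integral_sqGaussian {E : Type*} [NormedAddCommGroup E] [NormedSpace ℝ E] (g : ℝ → E) :
    ∫ z, g z ∂sqGaussian = ∫ z, z ^ 2 • g z ∂gaussianReal 0 1 := by
  rw [sqGaussian, integral_withDensity_eq_integral_toReal_smul (by fun_prop)
    (ae_of_all _ fun _ => ENNReal.ofReal_lt_top)]
  simp only [ENNReal.toReal_ofReal (sq_nonneg _)]

lemma integrable_pow_gaussianReal (k : ℕ) : Integrable (fun z : ℝ => z ^ k) (gaussianReal 0 1) := by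
  have h := (memLp_id_gaussianReal (μ := 0) (v := 1) (k : NNReal)).integrable_norm_pow'
  refine h.mono' (by fun_prop) (ae_of_all _ fun z => ?_)
  simp

instance : IsFiniteMeasure sqGaussian := by
  refine isFiniteMeasure_withDensity_ofReal ?_
  exact (integrable_pow_gaussianReal 2).hasFiniteIntegral

lemma integrable_id_sqGaussian : Integrable id sqGaussian := by
  rw [sqGaussian, integrable_withDensity_iff_integrable_smul' (by fun_prop)
    (ae_of_all _ fun _ => ENNReal.ofReal_lt_top)]
  refine (integrable_pow_gaussianReal 3).congr (ae_of_all _ fun z => ?_)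
  simp only [ENNReal.toReal_ofReal (sq_nonneg _), id, smul_eq_mul]
  ring

lemma charFun_gaussianReal_zero_one (t : ℝ) :
    charFun (gaussianReal 0 1) t = Complex.exp (-(t : ℂ) ^ 2 / 2) := by
  rw [charFun_gaussianReal]
  congr 1
  simp
  ring

lemma charFun_sqGaussian (t : ℝ) :
    charFun sqGaussian t = (1 - (t : ℂ) ^ 2) * Complex.exp (-(t : ℂ) ^ 2 / 2) := by
  have h1 := iteratedDeriv_charFun (μ := gaussianReal 0 1) (n := 2) (t := t)
    (by exact_mod_cast memLp_id_gaussianReal (2 : NNReal))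
  have hd1 (t : ℝ) : HasDerivAt (fun t : ℝ => Complex.exp (-(t : ℂ) ^ 2 / 2))
      (-(t : ℂ) * Complex.exp (-(t : ℂ) ^ 2 / 2)) t := by
    have h : HasDerivAt (fun z : ℂ => Complex.exp (-z ^ 2 / 2))
        (Complex.exp (-(t : ℂ) ^ 2 / 2) * (-(2 * (t : ℂ)) / 2)) t := by
      have := (((hasDerivAt_pow 2 (t : ℂ)).neg).div_const 2).cexp
      simpa using this
    refine h.comp_ofReal.congr_deriv ?_
    ring
  have hd2 (t : ℝ) : HasDerivAt (fun t : ℝ => -(t : ℂ) * Complex.exp (-(t : ℂ) ^ 2 / 2))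
      (-((1 - (t : ℂ) ^ 2) * Complex.exp (-(t : ℂ) ^ 2 / 2))) t := by
    refine ((Complex.ofRealCLM.hasDerivAt (x := t)).neg.mul (hd1 t)).congr_deriv ?_
    simp
    ring
  have e : charFun (gaussianReal 0 1) = fun t : ℝ => Complex.exp (-(t : ℂ) ^ 2 / 2) :=
    funext charFun_gaussianReal_zero_one
  have e1 : deriv (fun t : ℝ => Complex.exp (-(t : ℂ) ^ 2 / 2)) =
      fun t : ℝ => -(t : ℂ) * Complex.exp (-(t : ℂ) ^ 2 / 2) := funext fun t => (hd1 t).deriv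
  rw [e, iteratedDeriv_succ, iteratedDeriv_one, e1, (hd2 t).deriv] at h1
  rw [charFun_apply_real, integral_sqGaussian]
  simp only [Complex.real_smul, Complex.ofReal_pow]
  rw [Complex.I_sq] at h1
  linear_combination h1

lemma tendsto_neg_mul_phi_atBot : Tendsto (fun x => -x * phi x) atBot (𝓝 0) := by
  have h : Tendsto (fun x : ℝ => 9 * x⁻¹) atBot (𝓝 0) := by
    simpa using tendsto_inv_atBot_zero.const_mul (9 : ℝ)
  refine squeeze_zero_norm' (a := fun x : ℝ => -(9 * x⁻¹)) ?_ (by simpa using h.neg)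
  filter_upwards [eventually_lt_atBot 0] with x hx
  have h1 := pow_four_add_one_mul_phi_le x
  have h2 := phi_pos x
  have h3 : -(9 * x⁻¹) = 9 * (-x)⁻¹ := by rw [inv_neg, mul_neg]
  rw [Real.norm_of_nonneg (by nlinarith), h3, le_mul_inv_iff₀ (by linarith)]
  nlinarith [mul_nonneg h2.le (sq_nonneg (x ^ 2 - 1)), mul_nonneg h2.le (sq_nonneg (x ^ 2))]

lemma measureReal_Iic_sqGaussian (x : ℝ) :
    sqGaussian.real (Set.Iic x) = Phi x - x * phi x := by
  have hi : Integrable fun z : ℝ => z ^ 2 * phi z := by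
    have h := (integrable_pow_gaussianReal 2)
    rw [gaussianReal_of_var_ne_zero _ one_ne_zero, integrable_withDensity_iff_integrable_smul'
      (measurable_gaussianPDF 0 1) (ae_of_all _ fun _ => ENNReal.ofReal_lt_top)] at h
    refine h.congr (ae_of_all _ fun z => ?_)
    simp only [toReal_gaussianPDF, smul_eq_mul, phi]
    ring
  have h1 : sqGaussian.real (Set.Iic x) = ∫ z in Set.Iic x, z ^ 2 * phi z := by
    rw [← integral_indicator_one measurableSet_Iic, integral_sqGaussian,
      integral_gaussianReal_eq_integral_smul one_ne_zero, ← integral_indicator measurableSet_Iic]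
    congr 1 with z
    by_cases hz : z ∈ Set.Iic x
    · simp only [Set.indicator_of_mem hz, Pi.one_apply, smul_eq_mul, phi]
      ring
    · simp only [Set.indicator_of_notMem hz, smul_zero]
  have hd (z : ℝ) : HasDerivAt (fun z => Phi z + -z * phi z) (z ^ 2 * phi z) z := by
    refine ((hasDerivAt_Phi z).add (hasDerivAt_neg_mul_phi z)).congr_deriv ?_
    ring
  rw [h1, integral_Iic_of_hasDerivAt_of_tendsto (hd x).continuousAt.continuousWithinAt
    (fun z _ => hd z) hi.integrableOn
    ((tendsto_cdf_atBot (gaussianReal 0 1)).add tendsto_neg_mul_phi_atBot)]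
  ring

lemma measureReal_Iic_conv (ν : Measure ℝ) [IsProbabilityMeasure ν] (x : ℝ) :
    (ν ∗ gaussianReal 0 1).real (Set.Iic x) = ∫ u, Phi (x - u) ∂ν := by
  rw [← integral_indicator_one measurableSet_Iic, integral_conv]
  · congr 1 with u
    have : (fun y => (Set.Iic x).indicator (1 : ℝ → ℝ) (u + y)) =
        (Set.Iic (x - u)).indicator 1 := by
      ext y
      simp only [Set.indicator, Set.mem_Iic, le_sub_iff_add_le']
      rfl
    rw [this, integral_indicator_one measurableSet_Iic, Phi_eq_measureReal]
  · exact (integrable_const 1).indicator measurableSet_Iic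

lemma integrable_id_conv {μ ν : Measure ℝ} [IsFiniteMeasure μ] [IsFiniteMeasure ν]
    (hμ : Integrable id μ) (hν : Integrable id ν) : Integrable id (μ ∗ ν) := by
  rw [Measure.conv, integrable_map_measure (by fun_prop) (by fun_prop)]
  exact hμ.comp_fst ν |>.add (hν.comp_snd μ)

section Expansion

variable {μS ν : Measure ℝ} [IsProbabilityMeasure μS] [IsProbabilityMeasure ν] {n : ℕ}

/-- The law of the normalised sum, completed by the terms that enter `Phi + scaledLeading ν n`
with a negative sign: `n * Phi x` from the increments of `Phi`, and `Phi x - x * phi x`, the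
distribution function of `sqGaussian`, with the factor `1 / 2`. -/
noncomputable def leftMeasure (μS : Measure ℝ) (n : ℕ) : Measure ℝ :=
  μS + (n : NNReal) • gaussianReal 0 1 + (1 / 2 : NNReal) • sqGaussian

/-- The terms of `Phi + scaledLeading ν n` with a positive sign. The convolution has distribution
function `∫ Phi (x - u) dν`; the factor `3 / 2` is `1` for `Phi` itself and `1 / 2` to compensate
the summand `Phi x` in the distribution function of `sqGaussian`. -/
noncomputable def rightMeasure (ν : Measure ℝ) (n : ℕ) : Measure ℝ :=
  (3 / 2 : NNReal) • gaussianReal 0 1 + (n : NNReal) • (ν ∗ gaussianReal 0 1)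

instance : IsFiniteMeasure (leftMeasure μS n) := by
  unfold leftMeasure; infer_instance

instance : IsFiniteMeasure (rightMeasure ν n) := by
  unfold rightMeasure; infer_instance

lemma measureReal_leftMeasure_sub (x : ℝ) :
    (leftMeasure μS n).real (Set.Iic x) - (rightMeasure ν n).real (Set.Iic x) =
      μS.real (Set.Iic x) - (Phi x + scaledLeading ν n x) := by
  have hi : Integrable (fun u => Phi (x - u)) ν := by
    refine ((integrable_Phi_sub ν x).add (integrable_const (Phi x))).congr (ae_of_all _ fun u => ?_)
    simp
  rw [leftMeasure, rightMeasure, measureReal_add_apply, measureReal_add_apply,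
    measureReal_add_apply, measureReal_nnreal_smul_apply, measureReal_nnreal_smul_apply,
    measureReal_nnreal_smul_apply, measureReal_nnreal_smul_apply, measureReal_Iic_sqGaussian,
    measureReal_Iic_conv, ← Phi_eq_measureReal, scaledLeading,
    integral_sub hi (integrable_const _)]
  simp
  ring

lemma charFun_leftMeasure_sub (s : ℝ) :
    charFun (leftMeasure μS n) s - charFun (rightMeasure ν n) s =
      charFun μS s - Complex.exp (-(s : ℂ) ^ 2 / 2) *
        (1 + (n * (charFun ν s - 1) + (s : ℂ) ^ 2 / 2)) := by
  have ha {μ₁ μ₂ : Measure ℝ} [IsFiniteMeasure μ₁] [IsFiniteMeasure μ₂] :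
      charFun (μ₁ + μ₂) s = charFun μ₁ s + charFun μ₂ s := by
    simp only [charFun_apply_real]
    have hi (μ : Measure ℝ) [IsFiniteMeasure μ] :
        Integrable (fun x : ℝ => Complex.exp (s * x * Complex.I)) μ := by
      simpa using integrable_exp_mul_I μ s
    exact integral_add_measure (hi _) (hi _)
  have hs {μ : Measure ℝ} (c : NNReal) : charFun (c • μ) s = (c : ℝ) * charFun μ s := by
    simp only [charFun_apply_real]
    rw [integral_smul_nnreal_measure]
    rfl
  rw [leftMeasure, rightMeasure, ha, ha, ha, hs, hs, hs, hs, charFun_conv, charFun_sqGaussian,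
    charFun_gaussianReal_zero_one]
  push_cast
  ring

lemma exists_one_add_pow_six_mul_exp_le :
    ∃ K : ℝ, 0 < K ∧ ∀ s, 0 ≤ s → (1 + s) ^ 6 * Real.exp (-s / 20) ≤ K * Real.exp (-s / 40) := by
  refine ⟨720 * 40 ^ 6 * Real.exp (1 / 40), by positivity, fun s hs => ?_⟩
  have h := Real.pow_div_factorial_le_exp ((1 + s) / 40) (by positivity) 6
  have h1 : (1 + s) ^ 6 ≤ 720 * 40 ^ 6 * Real.exp ((1 + s) / 40) := by
    have e : (Nat.factorial 6 : ℝ) = 720 := by norm_num [Nat.factorial]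
    rw [e, div_le_iff₀ (by norm_num), div_pow, div_le_iff₀ (by norm_num)] at h
    linarith
  calc _ ≤ 720 * 40 ^ 6 * Real.exp ((1 + s) / 40) * Real.exp (-s / 20) := by gcongr
    _ = _ := by
      rw [mul_assoc, mul_assoc _ (Real.exp (1 / 40)), ← Real.exp_add, ← Real.exp_add]
      congr 2
      ring

lemma integral_exp_neg_div_le (T : ℝ) : ∫ s in 0..T, Real.exp (-s / 40) ≤ 40 := by
  have h : ∀ s ∈ Set.uIcc 0 T, HasDerivAt (fun s : ℝ => -40 * Real.exp (-s / 40))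
      (Real.exp (-s / 40)) s := fun s _ => by
    refine ((((hasDerivAt_id s).neg).div_const 40).exp.const_mul (-40)).congr_deriv ?_
    simp
    ring
  rw [intervalIntegral.integral_eq_sub_of_hasDerivAt h
    ((by fun_prop : Continuous fun s : ℝ => Real.exp (-s / 40)).intervalIntegrable _ _)]
  have := Real.exp_pos (-T / 40)
  simp
  linarith

/-- The error of the expansion for triangular arrays: `ν` is the law of a normalised summand, and
`μS` that of the sum of `n` summands. -/
lemma exists_abs_measureReal_Iic_sub_expansion_le :
    ∃ C : ℝ, 0 < C ∧ ∀ (μS ν : Measure ℝ) [IsProbabilityMeasure μS] [IsProbabilityMeasure ν]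
      (n : ℕ) (T : ℝ), 2 ≤ n → 0 < T → Integrable id μS → Integrable id ν → ∫ u, u ∂ν = 0 →
      n * unitMoment ν 2 = 1 → (∀ s, charFun μS s = charFun ν s ^ n) →
      (∀ s ∈ Set.Ioc 0 T, ∃ q, ‖charFun ν s - 1‖ ≤ 4 * q ∧ (charFun ν s - 1).re ≤ -(2 / 5) * q ∧
        q ≤ 1 / 40 ∧ ‖charFun ν s‖ ≤ Real.exp (-q / 5) ∧ s / 2 - 1 / 2 ≤ n * q ∧
        n * q ≤ 2 * s + s ^ 2) →
      ∀ x, |μS.real (Set.Iic x) - (Phi x + scaledLeading ν n x)| ≤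
        C * (1 / n + scaledRate ν n * (n * (tailFirst ν 1 + truncThird ν 1)) +
          (1 + scaledRate ν n) / T) := by
  obtain ⟨C, hC, hsm⟩ := exists_abs_measureReal_Iic_sub_le
  obtain ⟨K, hK, hexp⟩ := exists_one_add_pow_six_mul_exp_le
  refine ⟨C * (40 * K * 128 + 200), by positivity, ?_⟩
  intro μS ν _ _ n T hn hT hiS hi hmean h2 hpow hq x
  have hn0 : (0 : ℝ) ≤ n := by positivity
  set R := scaledRate ν n with hR
  set ε := (n : ℝ) * (tailFirst ν 1 + truncThird ν 1) with hε
  have hε0 : 0 ≤ ε := by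
    have := tailFirst_nonneg ν 1
    have := truncThird_nonneg ν 1
    positivity
  have hR0 : 0 ≤ R := by
    have := unitMoment_nonneg ν (k := 4) (by decide)
    rw [hR, scaledRate]
    positivity
  -- after division by `s`, the difference of the characteristic functions is at most
  -- `A * (1 + s) ^ 6 * exp (-s / 20)`
  set A := 128 / (n : ℝ) + 24 * R * ε with hA
  have hA0 : 0 ≤ A := by positivity
  have hγ : Integrable id (gaussianReal 0 1) := by
    simpa [Function.id_def] using integrable_pow_gaussianReal 1
  have hmass : (leftMeasure μS n).real Set.univ = (rightMeasure ν n).real Set.univ := by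
    have h := charFun_leftMeasure_sub (μS := μS) (ν := ν) (n := n) 0
    rw [hpow, charFun_zero, charFun_zero, charFun_zero] at h
    simp only [probReal_univ] at h
    norm_num at h
    exact_mod_cast sub_eq_zero.mp h
  have hmain := hsm (leftMeasure μS n) (rightMeasure ν n) (200 * (1 + R)) T (40 * K * A)
    (fun s => A * (K * Real.exp (-s / 40)))
    ((hiS.add_measure (hγ.smul_measure_nnreal)).add_measure
      (integrable_id_sqGaussian.smul_measure_nnreal))
    ((hγ.smul_measure_nnreal).add_measure ((integrable_id_conv hi hγ).smul_measure_nnreal))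
    hmass (by positivity) hT ?_
    ((by fun_prop : Continuous fun s : ℝ => A * (K * Real.exp (-s / 40))).intervalIntegrable _ _)
    ?_ ?_ x
  · rw [measureReal_leftMeasure_sub] at hmain
    refine hmain.trans ?_
    have h1 : 0 ≤ 1 / (n : ℝ) := by positivity
    have h2 : 0 ≤ R * ε := by positivity
    have h3 : 0 ≤ (1 + R) / T := by positivity
    have e : 40 * K * A + 200 * (1 + R) / T =
        40 * K * 128 * (1 / n) + 40 * K * 24 * (R * ε) + 200 * ((1 + R) / T) := by
      rw [hA]; ring
    rw [e, mul_assoc C]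
    refine mul_le_mul_of_nonneg_left ?_ hC.le
    nlinarith [mul_nonneg hK.le h1, mul_nonneg hK.le h2, mul_nonneg hK.le h3]
  · intro x y hy
    rw [measureReal_leftMeasure_sub, measureReal_leftMeasure_sub]
    have h1 := Phi_add_scaledLeading_sub_le hn0 h2 x hy
    have h3 : μS.real (Set.Iic x) ≤ μS.real (Set.Iic (x + y)) :=
      measureReal_mono (Set.Iic_subset_Iic.mpr (by linarith))
    linarith
  · intro s hs
    obtain ⟨q, q1, q2, q3, q4, q5, q6⟩ := hq s hs
    have hs0 := hs.1
    rw [charFun_leftMeasure_sub, hpow]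
    refine (norm_pow_sub_exp_mul_le hn hs0 q1 q2 q3 q4 q5 q6).trans ?_
    have d1 := norm_defect_le_scaledRate hn0 h2 hs0.le
    have d2 := norm_defect_le_mul hn0 h2 hi hmean hs0.le
    simp only [Complex.ofReal_natCast] at d1 d2
    rw [← hR] at d1
    rw [← hε] at d2
    have d0 := norm_nonneg (n * (charFun ν s - 1) + s ^ 2 / 2 : ℂ)
    generalize ‖(n * (charFun ν s - 1) + s ^ 2 / 2 : ℂ)‖ = d at d0 d1 d2 ⊢
    have hd : d ^ 2 ≤ 3 * (1 + s ^ 4) * R * (s * (2 * (1 + s ^ 2) * ε)) := by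
      -- one factor is of the order of the rate, the other is small and vanishes at `s = 0`
      rw [sq]
      exact mul_le_mul d1 d2 d0 (by positivity)
    have e1 : (1 + s ^ 4) * (1 + s ^ 2) ≤ (1 + s) ^ 6 := by
      have : 0 ≤ 6 * s + 14 * s ^ 2 + 20 * s ^ 3 + 14 * s ^ 4 + 6 * s ^ 5 := by positivity
      linarith
    have e2 : s * (2 + s) ^ 2 ≤ 4 * (1 + s) ^ 6 := by
      have : 0 ≤ 4 + 20 * s + 56 * s ^ 2 + 79 * s ^ 3 + 60 * s ^ 4 + 24 * s ^ 5 + 4 * s ^ 6 := by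
        positivity
      linarith
    have h3 : 32 / (n : ℝ) * (2 * s + s ^ 2) ^ 2 + 4 * d ^ 2 ≤ s * A * (1 + s) ^ 6 := by
      calc 32 / (n : ℝ) * (2 * s + s ^ 2) ^ 2 + 4 * d ^ 2
          ≤ 32 / (n : ℝ) * (2 * s + s ^ 2) ^ 2 +
            4 * (3 * (1 + s ^ 4) * R * (s * (2 * (1 + s ^ 2) * ε))) := by gcongr
        _ = 32 / (n : ℝ) * s * (s * (2 + s) ^ 2) +
            24 * R * ε * s * ((1 + s ^ 4) * (1 + s ^ 2)) := by ring
        _ ≤ 32 / (n : ℝ) * s * (4 * (1 + s) ^ 6) + 24 * R * ε * s * (1 + s) ^ 6 := by gcongr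
        _ = s * A * (1 + s) ^ 6 := by rw [hA]; ring
    calc _ ≤ s * A * (1 + s) ^ 6 * Real.exp (-s / 20) := by gcongr
      _ = s * A * ((1 + s) ^ 6 * Real.exp (-s / 20)) := by ring
      _ ≤ s * A * (K * Real.exp (-s / 40)) :=
        mul_le_mul_of_nonneg_left (hexp s hs0.le) (by positivity)
      _ = _ := by ring
  · rw [intervalIntegral.integral_const_mul, intervalIntegral.integral_const_mul]
    have := mul_le_mul_of_nonneg_left (integral_exp_neg_div_le T) (by positivity : 0 ≤ A * K)
    linarith

end Expansion

/-! ### Scaled laws -/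

section Scaling

variable {μ : Measure ℝ} {b : ℝ}

/-- The law of `X / b`, where `μ` is the law of `X`. -/
noncomputable def scaledLaw (μ : Measure ℝ) (b : ℝ) : Measure ℝ := μ.map fun u => u / b

instance [IsProbabilityMeasure μ] : IsProbabilityMeasure (scaledLaw μ b) :=
  Measure.isProbabilityMeasure_map (by fun_prop)

lemma preimage_div_Icc (hb : 0 < b) :
    (fun u : ℝ => u / b) ⁻¹' Set.Icc (-1) 1 = Set.Icc (-b) b := by
  ext u
  simp [le_div_iff₀ hb, div_le_iff₀ hb]

lemma unitMoment_scaledLaw (hb : 0 < b) (k : ℕ) :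
    unitMoment (scaledLaw μ b) k = (∫ u in Set.Icc (-b) b, u ^ k ∂μ) / b ^ k := by
  rw [unitMoment, scaledLaw, setIntegral_map measurableSet_Icc (by fun_prop) (by fun_prop),
    preimage_div_Icc hb, ← integral_div]
  simp only [div_pow]

lemma measureReal_compl_scaledLaw (hb : 0 < b) :
    (scaledLaw μ b).real (Set.Icc (-1) 1)ᶜ = μ.real (Set.Icc (-b) b)ᶜ := by
  rw [scaledLaw, map_measureReal_apply (by fun_prop) measurableSet_Icc.compl, Set.preimage_compl,
    preimage_div_Icc hb]

lemma tailFirst_scaledLaw (hb : 0 < b) : tailFirst (scaledLaw μ b) 1 = tailFirst μ b / b := by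
  rw [tailFirst, scaledLaw, setIntegral_map measurableSet_Icc.compl (by fun_prop) (by fun_prop),
    Set.preimage_compl, preimage_div_Icc hb, tailFirst, ← integral_div]
  simp only [abs_div, abs_of_pos hb]

lemma truncThird_scaledLaw (hb : 0 < b) :
    truncThird (scaledLaw μ b) 1 = truncThird μ b / b ^ 3 := by
  rw [truncThird, scaledLaw, setIntegral_map measurableSet_Icc (by fun_prop) (by fun_prop),
    preimage_div_Icc hb, truncThird, ← integral_div]
  simp only [abs_div, abs_of_pos hb, div_pow]

lemma charFun_scaledLaw (s : ℝ) : charFun (scaledLaw μ b) s = charFun μ (s / b) := by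
  have h := charFun_map_mul (μ := μ) b⁻¹ s
  rw [inv_mul_eq_div] at h
  rw [← h, scaledLaw]
  simp only [div_eq_inv_mul]

lemma integrable_id_scaledLaw (hint : Integrable id μ) : Integrable id (scaledLaw μ b) := by
  rw [scaledLaw, integrable_map_measure (by fun_prop) (by fun_prop)]
  exact hint.div_const b

lemma integral_scaledLaw (hmean : ∫ u, u ∂μ = 0) : ∫ u, u ∂scaledLaw μ b = 0 := by
  rw [scaledLaw, integral_map (by fun_prop) (by fun_prop), integral_div, hmean, zero_div]

end Scaling

/-! ### The norming constants -/

section NormScale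

variable {μ : Measure ℝ}

/-- The norming constant `b_n` in terms of the law `μ` of `X`. -/
noncomputable def normScale (μ : Measure ℝ) (n : ℝ) : ℝ :=
  sSup {x : ℝ | 1 ≤ n * (x ^ 2)⁻¹ * truncSecond μ x}

lemma truncSecond_of_nonpos {x : ℝ} (hx : x ≤ 0) : truncSecond μ x = 0 := by
  rw [truncSecond, setIntegral_congr_fun (g := fun _ => 0) measurableSet_Icc, integral_zero]
  intro u hu
  have : u = 0 := le_antisymm (hu.2.trans hx) (by linarith [hu.1])
  simp [this]

lemma mem_normScale_set {n x : ℝ} :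
    1 ≤ n * (x ^ 2)⁻¹ * truncSecond μ x ↔ 0 < x ∧ x ^ 2 ≤ n * truncSecond μ x := by
  rcases le_or_gt x 0 with hx | hx
  · simp only [truncSecond_of_nonpos hx, mul_zero, hx.not_gt, false_and, iff_false]
    norm_num
  · rw [mul_right_comm, ← div_eq_mul_inv, one_le_div (by positivity)]
    simp [hx]

lemma normScale_nonneg (μ : Measure ℝ) (n : ℝ) : 0 ≤ normScale μ n :=
  Real.sSup_nonneg fun _ hx => (mem_normScale_set.mp hx).1.le

variable [IsProbabilityMeasure μ]

lemma bddAbove_normScale_set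
    (htail : ∀ ε > 0, ∀ᶠ x in atTop, x ^ 2 * μ.real (Set.Icc (-x) x)ᶜ ≤ ε * truncSecond μ x)
    {n : ℝ} (hn : 0 ≤ n) : BddAbove {x : ℝ | 1 ≤ n * (x ^ 2)⁻¹ * truncSecond μ x} := by
  have hn1 : 0 < n + 1 := by linarith
  obtain ⟨x₀, hx₀⟩ := eventually_atTop.mp
    (eventually_truncSecond_le_mul_sq htail (ε := 1 / (n + 1)) (by positivity))
  refine ⟨x₀, fun x hx => ?_⟩
  obtain ⟨hx1, hx2⟩ := mem_normScale_set.mp hx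
  by_contra! hlt
  have h := mul_le_mul_of_nonneg_left (hx₀ x hlt.le) hn
  have e : n * (1 / (n + 1) * x ^ 2) = x ^ 2 - x ^ 2 / (n + 1) := by
    field_simp
    ring
  have : 0 < x ^ 2 / (n + 1) := by positivity
  linarith

/-- The supremum defining `b_n` is attained in the sense that the defining inequality becomes an
equality at `b_n`. -/
lemma mul_truncSecond_normScale
    (htail : ∀ ε > 0, ∀ᶠ x in atTop, x ^ 2 * μ.real (Set.Icc (-x) x)ᶜ ≤ ε * truncSecond μ x)
    {n : ℝ} (hn : 0 ≤ n) : n * truncSecond μ (normScale μ n) = normScale μ n ^ 2 := by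
  have hbdd := bddAbove_normScale_set htail hn
  set b := normScale μ n with hb
  have hb0 : 0 ≤ b := normScale_nonneg μ n
  have hV0 := truncSecond_nonneg μ b
  refine le_antisymm ?_ ?_
  -- by monotonicity of the truncated moment, continuity of `x ^ 2` alone suffices here
  · have h (x : ℝ) (hx : b < x) : n * truncSecond μ b ≤ x ^ 2 := by
      have hxm : ¬ 1 ≤ n * (x ^ 2)⁻¹ * truncSecond μ x := fun hmem =>
        (le_csSup hbdd hmem).not_gt hx
      rw [mem_normScale_set] at hxm
      push Not at hxm
      exact (mul_le_mul_of_nonneg_left (truncSecond_mono μ hx.le) hn).trans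
        (hxm (hb0.trans_lt hx)).le
    have ht : Tendsto (fun x : ℝ => x ^ 2) (𝓝[>] b) (𝓝 (b ^ 2)) :=
      ((continuous_pow 2).tendsto b).mono_left nhdsWithin_le_nhds
    exact ge_of_tendsto ht (eventually_nhdsWithin_of_forall h)
  · by_contra! hlt
    have h1 : √(n * truncSecond μ b) < b := by
      rw [Real.sqrt_lt' (by nlinarith [mul_nonneg hn hV0])]
      exact hlt
    -- if the set is empty, its supremum is `0` by convention
    have hne : {x : ℝ | 1 ≤ n * (x ^ 2)⁻¹ * truncSecond μ x}.Nonempty := by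
      by_contra hemp
      rw [Set.not_nonempty_iff_eq_empty] at hemp
      rw [hb, normScale, hemp, Real.sSup_empty] at h1
      exact h1.not_ge (Real.sqrt_nonneg _)
    obtain ⟨x, hx, hx1⟩ := exists_lt_of_lt_csSup hne h1
    have hxb : x ≤ b := le_csSup hbdd hx
    obtain ⟨hx2, hx3⟩ := mem_normScale_set.mp hx
    rw [Real.sqrt_lt' hx2] at hx1
    have := mul_le_mul_of_nonneg_left (truncSecond_mono μ hxb) hn
    linarith

lemma tendsto_normScale
    (htail : ∀ ε > 0, ∀ᶠ x in atTop, x ^ 2 * μ.real (Set.Icc (-x) x)ᶜ ≤ ε * truncSecond μ x)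
    (hpos : ∀ᶠ x in atTop, 0 < truncSecond μ x) :
    Tendsto (fun n : ℕ => normScale μ n) atTop atTop := by
  rw [tendsto_atTop]
  intro M
  obtain ⟨x, hx0, hxM, hx⟩ :=
    ((eventually_gt_atTop 0).and ((eventually_ge_atTop M).and hpos)).exists
  filter_upwards [tendsto_natCast_atTop_atTop.eventually_ge_atTop (x ^ 2 / truncSecond μ x)]
    with n hn
  refine hxM.trans (le_csSup (bddAbove_normScale_set htail n.cast_nonneg)
    (mem_normScale_set.mpr ⟨hx0, ?_⟩))
  rwa [div_le_iff₀ hx] at hn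

end NormScale

/-! ### The expansion for the normalised sums -/

section Main

variable {μ : Measure ℝ} [IsProbabilityMeasure μ]

/-- The quantity that controls the expansion tends to zero. Combined with the defect bounds, it
makes the squared defect negligible compared with the rate. -/
lemma tendsto_tailFirst_add_truncThird
    (htail : ∀ ε > 0, ∀ᶠ x in atTop, x ^ 2 * μ.real (Set.Icc (-x) x)ᶜ ≤ ε * truncSecond μ x)
    (hpos : ∀ᶠ x in atTop, 0 < truncSecond μ x) (hint : Integrable id μ) :
    Tendsto (fun n : ℕ => (n : ℝ) * (tailFirst (scaledLaw μ (normScale μ n)) 1 +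
      truncThird (scaledLaw μ (normScale μ n)) 1)) atTop (𝓝 0) := by
  have h0 : Tendsto (fun x => (x * tailFirst μ x + truncThird μ x / x) / truncSecond μ x)
      atTop (𝓝 0) := by
    rw [Metric.tendsto_nhds]
    intro ε hε
    filter_upwards [eventually_mul_tailFirst_le htail hint (ε := ε / 4) (by positivity),
      eventually_truncThird_le htail (ε := ε / 4) (by positivity), hpos, eventually_gt_atTop 0]
      with x h1 h2 h3 h4
    have h5 : truncThird μ x / x ≤ ε / 4 * truncSecond μ x := by
      rw [div_le_iff₀ h4]
      linarith
    have h6 : 0 ≤ (x * tailFirst μ x + truncThird μ x / x) / truncSecond μ x := by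
      have := tailFirst_nonneg μ x
      have := truncThird_nonneg μ x
      positivity
    rw [Real.dist_0_eq_abs, abs_of_nonneg h6, div_lt_iff₀ h3]
    nlinarith
  refine (h0.comp (tendsto_normScale htail hpos)).congr' ?_
  filter_upwards [(tendsto_normScale htail hpos).eventually_gt_atTop 0,
    (tendsto_normScale htail hpos).eventually hpos] with n hb hV
  have h := mul_truncSecond_normScale htail n.cast_nonneg
  rw [tailFirst_scaledLaw hb, truncThird_scaledLaw hb, Function.comp_apply, div_eq_iff hV.ne']
  set b := normScale μ n
  have e : (n : ℝ) * (tailFirst μ b / b + truncThird μ b / b ^ 3) * truncSecond μ b =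
      (n * truncSecond μ b) * (tailFirst μ b / b + truncThird μ b / b ^ 3) := by ring
  rw [e, h]
  field_simp

lemma mul_unitMoment_two_scaledLaw
    (htail : ∀ ε > 0, ∀ᶠ x in atTop, x ^ 2 * μ.real (Set.Icc (-x) x)ᶜ ≤ ε * truncSecond μ x)
    {n : ℝ} (hn : 0 ≤ n) (hb : 0 < normScale μ n) :
    n * unitMoment (scaledLaw μ (normScale μ n)) 2 = 1 := by
  rw [unitMoment_scaledLaw hb, ← mul_div_assoc, div_eq_one_iff_eq (by positivity)]
  exact mul_truncSecond_normScale htail hn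

/-- The bounds on the characteristic function that the expansion needs hold on an interval whose
length is of the order of `√n`. -/
lemma exists_eventually_charFun_scaledLaw_bounds
    (htail : ∀ ε > 0, ∀ᶠ x in atTop, x ^ 2 * μ.real (Set.Icc (-x) x)ᶜ ≤ ε * truncSecond μ x)
    (hpos : ∀ᶠ x in atTop, 0 < truncSecond μ x) (hint : Integrable id μ)
    (hmean : ∫ u, u ∂μ = 0) :
    ∃ η : ℝ, 0 < η ∧ ∀ᶠ n : ℕ in atTop, ∀ s ∈ Set.Ioc 0 (η * √n), ∃ q,
      ‖charFun (scaledLaw μ (normScale μ n)) s - 1‖ ≤ 4 * q ∧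
      (charFun (scaledLaw μ (normScale μ n)) s - 1).re ≤ -(2 / 5) * q ∧ q ≤ 1 / 40 ∧
      ‖charFun (scaledLaw μ (normScale μ n)) s‖ ≤ Real.exp (-q / 5) ∧
      s / 2 - 1 / 2 ≤ n * q ∧ n * q ≤ 2 * s + s ^ 2 := by
  obtain ⟨x₁, hx₁⟩ := eventually_atTop.mp
    ((eventually_charFun_bounds htail hint hmean).and
      ((eventually_truncSecond_two_mul_le htail one_pos).and (hpos.and (eventually_gt_atTop 0))))
  obtain ⟨-, -, hV₁, hx₁0⟩ := hx₁ x₁ le_rfl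
  have hdouble : ∀ x ≥ x₁, truncSecond μ (2 * x) ≤ 2 * truncSecond μ x := fun x hx => by
    have := (hx₁ x hx).2.1
    linarith
  refine ⟨√(truncSecond μ x₁) / x₁, by positivity, ?_⟩
  filter_upwards [(tendsto_normScale htail hpos).eventually_ge_atTop x₁] with n hb s hs
  have hid := mul_truncSecond_normScale htail n.cast_nonneg
  set b := normScale μ n with hbdef
  have hb0 : 0 < b := hx₁0.trans_le hb
  have hs0 : 0 < s := hs.1
  have hVb : 0 < truncSecond μ b := (hx₁ b hb).2.2.1
  -- `b / s` stays in the range where the asymptotics of the truncated moments are effective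
  have hx : x₁ ≤ b / s := by
    rw [le_div_iff₀ hs0]
    have h1 : x₁ * s ≤ √(truncSecond μ x₁) * √n := by
      calc x₁ * s ≤ x₁ * (√(truncSecond μ x₁) / x₁ * √n) := by gcongr; exact hs.2
        _ = _ := by field_simp
    refine h1.trans ?_
    rw [← Real.sqrt_mul hV₁.le, Real.sqrt_le_left hb0.le, ← hid, mul_comm]
    exact mul_le_mul_of_nonneg_left (truncSecond_mono μ hb) n.cast_nonneg
  obtain ⟨⟨h1, h2, h3, h4⟩, -, hVx, hx0⟩ := hx₁ (b / s) hx
  rw [inv_div] at h1 h2 h4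
  refine ⟨truncSecond μ (b / s) / (b / s) ^ 2, ?_⟩
  rw [charFun_scaledLaw]
  refine ⟨h1, h2, h3, h4, ?_⟩
  have hnq : n * (truncSecond μ (b / s) / (b / s) ^ 2) =
      s ^ 2 * (truncSecond μ (b / s) / truncSecond μ b) := by
    have hn : (n : ℝ) = b ^ 2 / truncSecond μ b := by
      rw [eq_div_iff hVb.ne', hid]
    rw [hn]
    field_simp
  rw [hnq]
  -- compare `b` with `b / s` by slow variation, in whichever direction makes the quotient `≥ 1`
  rcases le_or_gt 1 s with h1s | h1s
  · have h5 : truncSecond μ b ≤ 2 * s * truncSecond μ (b / s) := by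
      have := truncSecond_mul_le hx₁0 hdouble hx h1s
      rwa [mul_div_cancel₀ _ hs0.ne'] at this
    have h6 : truncSecond μ (b / s) ≤ truncSecond μ b :=
      truncSecond_mono μ (div_le_self hb0.le h1s)
    have h7 : 1 / (2 * s) ≤ truncSecond μ (b / s) / truncSecond μ b := by
      rw [div_le_div_iff₀ (by positivity) hVb]
      linarith
    have h8 : truncSecond μ (b / s) / truncSecond μ b ≤ 1 := (div_le_one hVb).mpr h6
    have e : s ^ 2 * (1 / (2 * s)) = s / 2 := by field_simp
    have h9 := mul_le_mul_of_nonneg_left h7 (sq_nonneg s)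
    have h10 := mul_le_mul_of_nonneg_left h8 (sq_nonneg s)
    constructor <;> linarith
  · have h5 : truncSecond μ (b / s) ≤ 2 * (1 / s) * truncSecond μ b := by
      have := truncSecond_mul_le hx₁0 hdouble hb (t := 1 / s) (by
        rw [le_div_iff₀ hs0]; linarith)
      rwa [one_div_mul_eq_div] at this
    have h6 : truncSecond μ (b / s) / truncSecond μ b ≤ 2 * (1 / s) := (div_le_iff₀ hVb).mpr h5
    have h7 : 0 ≤ s ^ 2 * (truncSecond μ (b / s) / truncSecond μ b) := by positivity
    have e : s ^ 2 * (2 * (1 / s)) = 2 * s := by field_simp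
    have h10 := mul_le_mul_of_nonneg_left h6 (sq_nonneg s)
    constructor <;> nlinarith

/-- The error of the expansion: a sequence tending to zero times the rate, plus a multiple
of `n ^ (-1 / 2)`. -/
lemma exists_eventually_abs_sub_expansion_le
    (htail : ∀ ε > 0, ∀ᶠ x in atTop, x ^ 2 * μ.real (Set.Icc (-x) x)ᶜ ≤ ε * truncSecond μ x)
    (hpos : ∀ᶠ x in atTop, 0 < truncSecond μ x) (hint : Integrable id μ)
    (hmean : ∫ u, u ∂μ = 0) (μS : ℕ → Measure ℝ) [∀ n, IsProbabilityMeasure (μS n)]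
    (hS : ∀ n, Integrable id (μS n))
    (hchar : ∀ n s, charFun (μS n) s = charFun (scaledLaw μ (normScale μ n)) s ^ n) :
    ∃ (C : ℝ) (ε : ℕ → ℝ), 0 < C ∧ Tendsto ε atTop (𝓝 0) ∧ ∀ᶠ n : ℕ in atTop, ∀ x,
      |(μS n).real (Set.Iic x) - (Phi x + scaledLeading (scaledLaw μ (normScale μ n)) n x)| ≤
        ε n * scaledRate (scaledLaw μ (normScale μ n)) n + C * (√n)⁻¹ := by
  obtain ⟨C, hC, hmain⟩ := exists_abs_measureReal_Iic_sub_expansion_le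
  obtain ⟨η, hη, hev⟩ := exists_eventually_charFun_scaledLaw_bounds htail hpos hint hmean
  have hlim := tendsto_tailFirst_add_truncThird htail hpos hint
  refine ⟨C * (1 + 2 / η), _, by positivity, by simpa using hlim.const_mul C, ?_⟩
  filter_upwards [hev, eventually_ge_atTop 2, hlim.eventually_le_const (u := 1 / 2) (by norm_num),
    (tendsto_normScale htail hpos).eventually_gt_atTop 0] with n h1 h2 h3 hb x
  have hn2 : (2 : ℝ) ≤ n := by exact_mod_cast h2
  have hid := integrable_id_scaledLaw (b := normScale μ n) hint
  have hm := integral_scaledLaw (b := normScale μ n) hmean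
  have h := hmain (μS n) (scaledLaw μ (normScale μ n)) n (η * √n) h2 (by positivity) (hS n) hid hm
    (mul_unitMoment_two_scaledLaw htail n.cast_nonneg hb) (hchar n) h1 x
  have hR := scaledRate_le n.cast_nonneg hid hm
  refine h.trans ?_
  set R := scaledRate (scaledLaw μ (normScale μ n)) n
  set E := (n : ℝ) * (tailFirst (scaledLaw μ (normScale μ n)) 1 +
    truncThird (scaledLaw μ (normScale μ n)) 1)
  have h4 : 1 / (n : ℝ) ≤ (√n)⁻¹ := by
    rw [one_div]
    refine inv_anti₀ (by positivity) ?_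
    rw [Real.sqrt_le_left (by positivity)]
    nlinarith
  have h5 : (1 + R) / (η * √n) ≤ 2 / η * (√n)⁻¹ := by
    rw [← div_div, div_eq_mul_inv]
    gcongr
    linarith
  calc C * (1 / n + R * E + (1 + R) / (η * √n))
      ≤ C * ((√n)⁻¹ + R * E + 2 / η * (√n)⁻¹) := by gcongr
    _ = C * E * R + C * (1 + 2 / η) * (√n)⁻¹ := by ring

end Main

/-! ### Orders of magnitude of suprema -/

lemma supSameOrder_of_bounds {f : ℕ → ℝ → ℝ} {d : ℕ → ℝ}
    (hbdd : ∀ n, BddAbove (Set.range fun x => |f n x|)) {C₁ C₂ : ℝ} (hC₁ : 0 < C₁)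
    (hd : ∀ᶠ n in atTop, 0 < d n) (h₁ : ∀ᶠ n in atTop, d n ≤ C₁ * ⨆ x, |f n x|)
    (h₂ : ∀ᶠ n in atTop, ∀ x, |f n x| ≤ C₂ * d n) : SupSameOrder f d := by
  refine ⟨hbdd, ?_, ?_⟩
  · have h : ((C₁⁻¹ : ℝ) : EReal) ≤
        liminf (fun n => (((⨆ x, |f n x|) / d n : ℝ) : EReal)) atTop := by
      refine le_liminf_of_le (by isBoundedDefault) ?_
      filter_upwards [hd, h₁] with n hn h
      rw [EReal.coe_le_coe_iff, le_div_iff₀ hn, inv_mul_le_iff₀ hC₁]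
      exact h
    exact lt_of_lt_of_le (by exact_mod_cast inv_pos.mpr hC₁) h
  · have h : limsup (fun n => (((⨆ x, |f n x|) / d n : ℝ) : EReal)) atTop ≤ (C₂ : EReal) := by
      refine limsup_le_of_le (by isBoundedDefault) ?_
      filter_upwards [hd, h₂] with n hn h
      rw [EReal.coe_le_coe_iff, div_le_iff₀ hn]
      exact ciSup_le h
    exact lt_of_le_of_lt h (EReal.coe_lt_top C₂)

lemma supLittleOAddBigO_of_bound {f : ℕ → ℝ → ℝ} {d e : ℕ → ℝ}
    (hbdd : ∀ n, BddAbove (Set.range fun x => |f n x|)) {C : ℝ} {ε : ℕ → ℝ} (hC : 0 ≤ C)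
    (hε : Tendsto ε atTop (𝓝 0)) (he : ∀ n, 0 ≤ e n)
    (h : ∀ᶠ n in atTop, ∀ x, |f n x| ≤ ε n * d n + C * e n) : SupLittleOAddBigO f d e := by
  have h0 (n : ℕ) : 0 ≤ ⨆ x, |f n x| := Real.iSup_nonneg fun _ => abs_nonneg _
  -- the supremum is split at `C * e n`: what exceeds this is at most `ε n * d n`
  refine ⟨hbdd, fun n => (⨆ x, |f n x|) - min (⨆ x, |f n x|) (C * e n),
    fun n => min (⨆ x, |f n x|) (C * e n), ?_, ?_, fun n => by ring⟩
  · rw [isLittleO_iff]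
    intro c hc
    filter_upwards [h, (tendsto_order.mp hε.abs).2 c (by simpa using hc)] with n hn hεn
    have h1 : (⨆ x, |f n x|) ≤ ε n * d n + C * e n := ciSup_le hn
    have h2 : ε n * d n ≤ c * |d n| := by
      refine (le_abs_self _).trans ?_
      rw [abs_mul]
      exact mul_le_mul_of_nonneg_right hεn.le (abs_nonneg _)
    have h3 : 0 ≤ c * |d n| := by positivity
    rw [Real.norm_of_nonneg (sub_nonneg.mpr (min_le_left _ _)), Real.norm_eq_abs]
    rcases min_cases (⨆ x, |f n x|) (C * e n) with h4 | h4 <;> rw [h4.1] <;> linarith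
  · refine IsBigO.of_bound C (Eventually.of_forall fun n => ?_)
    rw [Real.norm_of_nonneg (le_min (h0 n) (mul_nonneg hC (he n))), Real.norm_of_nonneg (he n)]
    exact min_le_right _ _

lemma scaledRate_pos {ν : Measure ℝ} [IsFiniteMeasure ν] {n : ℝ} (hn : 0 ≤ n)
    (h2 : n * unitMoment ν 2 = 1) : 0 < scaledRate ν n := by
  have hn0 : 0 < n := hn.lt_of_ne fun h => by simp [← h] at h2
  have h4 : 0 < unitMoment ν 4 := by
    refine (unitMoment_nonneg ν (by decide)).lt_of_ne fun h => ?_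
    have hi : IntegrableOn (fun u : ℝ => u ^ 4) (Set.Icc (-1) 1) ν :=
      (continuous_pow 4).continuousOn.integrableOn_compact isCompact_Icc
    have h0 : (fun u : ℝ => u ^ 4) =ᵐ[ν.restrict (Set.Icc (-1) 1)] 0 :=
      (integral_eq_zero_iff_of_nonneg (fun u => by positivity) hi).mp h.symm
    have h3 : unitMoment ν 2 = 0 := by
      refine integral_eq_zero_of_ae (h0.mono fun u hu => ?_)
      have : u = 0 := by simpa using hu
      simp [this]
    rw [h3, mul_zero] at h2
    exact zero_ne_one h2
  rw [scaledRate]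
  positivity

/-! ### Random variables and their laws -/

section Bridge

variable {Ω : Type*} [MeasurableSpace Ω] {P : Measure Ω} {Y : Ω → ℝ}

lemma truncMoment_eq (hY : AEMeasurable Y P) (k : ℕ) (t : ℝ) :
    truncMoment P Y k t = ∫ u in Set.Icc (-t) t, u ^ k ∂P.map Y := by
  have hm : Measurable ((Set.Icc (-t) t).indicator fun u : ℝ => u ^ k) :=
    (measurable_id.pow_const k).indicator measurableSet_Icc
  rw [← integral_indicator measurableSet_Icc, integral_map hY hm.aestronglyMeasurable, truncMoment]
  congr 1 with ω
  simp only [Set.indicator, Set.mem_ofPred_eq, Set.mem_Icc, abs_le]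

lemma bScale_eq (hY : AEMeasurable Y P) (n : ℕ) : bScale P Y n = normScale (P.map Y) n := by
  simp only [bScale, normScale, truncMoment_eq hY, truncSecond]

lemma measureReal_lt_abs (hY : AEMeasurable Y P) (b : ℝ) :
    P.real {ω | b < |Y ω|} = (P.map Y).real (Set.Icc (-b) b)ᶜ := by
  rw [map_measureReal_apply_of_aemeasurable hY measurableSet_Icc.compl]
  congr 1
  ext ω
  simp only [Set.mem_ofPred_eq, Set.mem_preimage, Set.mem_compl_iff, Set.mem_Icc, ← abs_le, not_le]

lemma delta_eq (hY : AEMeasurable Y P) {n : ℕ} (hb : 0 < normScale (P.map Y) n) :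
    delta P Y n = scaledRate (scaledLaw (P.map Y) (normScale (P.map Y) n)) n := by
  simp only [delta, scaledRate, bScale_eq hY, truncMoment_eq hY, measureReal_lt_abs hY,
    measureReal_compl_scaledLaw hb, unitMoment_scaledLaw hb, abs_div, abs_pow, abs_of_pos hb]
  ring

lemma sigma_sq (hY : AEMeasurable Y P) (n : ℕ) :
    sigma P Y n ^ 2 = truncSecond (P.map Y) (normScale (P.map Y) n) := by
  rw [sigma, bScale_eq hY, truncMoment_eq hY]
  exact Real.sq_sqrt (truncSecond_nonneg _ _)

lemma sumCDF_eq {X : ℕ → Ω → ℝ} (hX : ∀ i, AEMeasurable (X i) P) (n : ℕ) (s x : ℝ) :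
    sumCDF P X n s x =
      (P.map fun ω => s⁻¹ * ∑ i ∈ Finset.range n, X i ω).real (Set.Iic x) := by
  have h : AEMeasurable (fun ω => s⁻¹ * ∑ i ∈ Finset.range n, X i ω) P :=
    (Finset.aemeasurable_fun_sum _ fun i _ => hX i).const_mul _
  rw [map_measureReal_apply_of_aemeasurable h measurableSet_Iic]
  rfl

variable [IsProbabilityMeasure P]

lemma sqrt_mul_sigma (hY : AEMeasurable Y P)
    (htail : ∀ ε > 0, ∀ᶠ x in atTop,
      x ^ 2 * (P.map Y).real (Set.Icc (-x) x)ᶜ ≤ ε * truncSecond (P.map Y) x) (n : ℕ) :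
    √n * sigma P Y n = bScale P Y n := by
  have := Measure.isProbabilityMeasure_map hY
  have h : √(n : ℝ) * sigma P Y n = √(n * truncSecond (P.map Y) (normScale (P.map Y) n)) := by
    have h0 : 0 ≤ sigma P Y n := Real.sqrt_nonneg _
    rw [← sigma_sq hY, Real.sqrt_mul n.cast_nonneg, Real.sqrt_sq h0]
  rw [h, mul_truncSecond_normScale htail n.cast_nonneg, Real.sqrt_sq (normScale_nonneg _ _),
    bScale_eq hY]

lemma leadingTerm_eq (hY : AEMeasurable Y P)
    (htail : ∀ ε > 0, ∀ᶠ x in atTop,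
      x ^ 2 * (P.map Y).real (Set.Icc (-x) x)ᶜ ≤ ε * truncSecond (P.map Y) x) {n : ℕ}
    (hb : 0 < normScale (P.map Y) n) (x : ℝ) :
    leadingTerm P Y n (bScale P Y n) x =
      scaledLeading (scaledLaw (P.map Y) (normScale (P.map Y) n)) n x := by
  have := Measure.isProbabilityMeasure_map hY
  have hid := mul_truncSecond_normScale htail n.cast_nonneg
  rw [leadingTerm, scaledLeading, sigma_sq hY, bScale_eq hY, deriv_phi, scaledLaw]
  set b := normScale (P.map Y) n with hbdef
  have hc : Continuous fun u => Phi (x - u) - Phi x :=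
    (continuous_Phi.comp (by fun_prop)).sub continuous_const
  have hc' : Continuous fun u => Phi (x - u / b) - Phi x := hc.comp (continuous_id.div_const b)
  rw [integral_map (by fun_prop) hc.aestronglyMeasurable, integral_map hY hc'.aestronglyMeasurable]
  have e : 1 / 2 * (n : ℝ) * (b ^ 2)⁻¹ * truncSecond (P.map Y) b = 1 / 2 := by
    have : 1 / 2 * (n : ℝ) * (b ^ 2)⁻¹ * truncSecond (P.map Y) b =
        1 / 2 * ((n * truncSecond (P.map Y) b) * (b ^ 2)⁻¹) := by ring
    rw [this, hid, mul_inv_cancel₀ (by positivity), mul_one]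
  rw [e]

lemma abs_leadingTerm_le (Y : Ω → ℝ) (n : ℕ) (s x : ℝ) :
    |leadingTerm P Y n s x| ≤ n + |1 / 2 * n * (s ^ 2)⁻¹ * sigma P Y n ^ 2| * 36 := by
  have h1 : |∫ ω, (Phi (x - Y ω / s) - Phi x) ∂P| ≤ 1 := by
    simpa using norm_integral_le_of_norm_le_const (μ := P) (C := 1)
      (f := fun ω => Phi (x - Y ω / s) - Phi x) (ae_of_all _ fun ω => abs_Phi_sub_le _ _)
  rw [leadingTerm, deriv_phi]
  refine (abs_sub _ _).trans (add_le_add ?_ ?_)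
  · rw [abs_mul, Nat.abs_cast]
    exact mul_le_of_le_one_right n.cast_nonneg h1
  · rw [abs_mul]
    exact mul_le_mul_of_nonneg_left (abs_neg_mul_phi_le x) (abs_nonneg _)

end Bridge

end NormalApprox

theorem mainTheorem4 {Ω : Type*} [MeasurableSpace Ω] (P : Measure Ω) [IsProbabilityMeasure P]
    (X : ℕ → Ω → ℝ)
    (hindep : iIndepFun X P)
    (hident : ∀ i, IdentDistrib (X i) (X 0) P P)
    (hdom : NormalApprox.InNormalDomainOfAttraction P X)
    (hint : Integrable (X 0) P)
    (hmean : ∫ ω, X 0 ω ∂P = 0) :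
    -- scaling by `b_n`
    (NormalApprox.SupSameOrder
        (fun n x => NormalApprox.leadingTerm P (X 0) n (NormalApprox.bScale P (X 0) n) x)
        (NormalApprox.delta P (X 0)) ∧
      NormalApprox.SupLittleOAddBigO
        (fun n x => NormalApprox.sumCDF P X n (NormalApprox.bScale P (X 0) n) x
          - (NormalApprox.Phi x
            + NormalApprox.leadingTerm P (X 0) n (NormalApprox.bScale P (X 0) n) x))
        (NormalApprox.delta P (X 0)) (fun n => (n : ℝ) ^ (-(1 / 2) : ℝ))) ∧
    -- scaling by `n^{1/2} σ_n`
    (NormalApprox.SupSameOrder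
        (fun n x => NormalApprox.leadingTerm P (X 0) n (√n * NormalApprox.sigma P (X 0) n) x)
        (NormalApprox.delta P (X 0)) ∧
      NormalApprox.SupLittleOAddBigO
        (fun n x => NormalApprox.sumCDF P X n (√n * NormalApprox.sigma P (X 0) n) x
          - (NormalApprox.Phi x
            + NormalApprox.leadingTerm P (X 0) n (√n * NormalApprox.sigma P (X 0) n) x))
        (NormalApprox.delta P (X 0)) (fun n => (n : ℝ) ^ (-(1 / 2) : ℝ))) := by
  open NormalApprox in
  have hY : AEMeasurable (X 0) P := hint.aemeasurable
  have hX (i : ℕ) : AEMeasurable (X i) P := (hident i).aemeasurable_fst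
  have hXi (i : ℕ) : Integrable (X i) P := (hident i).integrable_iff.mpr hint
  obtain ⟨htail, hpos⟩ := hdom.tail hindep hident
  have := Measure.isProbabilityMeasure_map hY
  have hintμ : Integrable id (P.map (X 0)) := by
    rw [integrable_map_measure (by fun_prop) hY]
    exact hint
  have hmeanμ : ∫ u, u ∂P.map (X 0) = 0 := by
    rw [integral_map hY (by fun_prop)]
    exact hmean
  have hbpos := (tendsto_normScale htail hpos).eventually_gt_atTop 0
  -- both scalings are the same
  simp only [sqrt_mul_sigma hY htail, and_self]
  obtain ⟨C₁, hC₁, hlow⟩ := exists_scaledRate_le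
  have hbdd (n : ℕ) : BddAbove (Set.range fun x =>
      |leadingTerm P (X 0) n (bScale P (X 0) n) x|) := by
    refine ⟨_, Set.forall_mem_range.mpr fun x => abs_leadingTerm_le (X 0) n _ x⟩
  refine ⟨supSameOrder_of_bounds (C₂ := 36) hbdd hC₁ ?_ ?_ ?_, ?_⟩
  · filter_upwards [hbpos] with n hb
    rw [delta_eq hY hb]
    exact scaledRate_pos n.cast_nonneg (mul_unitMoment_two_scaledLaw htail n.cast_nonneg hb)
  · filter_upwards [hbpos] with n hb
    rw [delta_eq hY hb]
    refine hlow _ _ _ n.cast_nonneg (mul_unitMoment_two_scaledLaw htail n.cast_nonneg hb)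
      fun x => ?_
    rw [← leadingTerm_eq hY htail hb]
    exact le_ciSup (hbdd n) x
  · filter_upwards [hbpos] with n hb x
    rw [delta_eq hY hb, leadingTerm_eq hY htail hb]
    exact abs_scaledLeading_le n.cast_nonneg
      (mul_unitMoment_two_scaledLaw htail n.cast_nonneg hb) x
  · let μS : ℕ → Measure ℝ := fun n =>
      P.map fun ω => (normScale (P.map (X 0)) n)⁻¹ * ∑ i ∈ Finset.range n, X i ω
    have hSm (n : ℕ) : AEMeasurable (fun ω => ∑ i ∈ Finset.range n, X i ω) P :=
      Finset.aemeasurable_fun_sum _ fun i _ => hX i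
    have hSp (n : ℕ) : IsProbabilityMeasure (μS n) :=
      Measure.isProbabilityMeasure_map ((hSm n).const_mul _)
    have hSi (n : ℕ) : Integrable id (μS n) := by
      rw [integrable_map_measure (by fun_prop) ((hSm n).const_mul _)]
      exact (integrable_finsetSum _ fun i _ => hXi i).const_mul _
    have hSc (n : ℕ) (s : ℝ) : charFun (μS n) s =
        charFun (scaledLaw (P.map (X 0)) (normScale (P.map (X 0)) n)) s ^ n := by
      rw [charFun_scaledLaw, ← charFun_map_sum hindep hident, charFun_map_mul_comp (hSm n),
        inv_mul_eq_div]
    obtain ⟨C, ε, hC, hε, hmain⟩ :=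
      exists_eventually_abs_sub_expansion_le htail hpos hintμ hmeanμ μS hSi hSc
    refine supLittleOAddBigO_of_bound (fun n => ?_) hC.le hε
      (fun n => Real.rpow_nonneg n.cast_nonneg _) ?_
    · obtain ⟨M, hM⟩ := hbdd n
      refine ⟨1 + (1 + M), ?_⟩
      rintro _ ⟨x, rfl⟩
      have h1 : |sumCDF P X n (bScale P (X 0) n) x| ≤ 1 := by
        rw [sumCDF, abs_of_nonneg measureReal_nonneg]
        exact measureReal_le_one
      have h2 : |Phi x| ≤ 1 := by
        rw [abs_of_nonneg (Phi_nonneg x)]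
        exact Phi_le_one x
      exact (abs_sub _ _).trans (add_le_add h1 ((abs_add_le _ _).trans
        (add_le_add h2 (hM ⟨x, rfl⟩))))
    · filter_upwards [hbpos, hmain] with n hb h x
      rw [sumCDF_eq hX, leadingTerm_eq hY htail hb, delta_eq hY hb, bScale_eq hY,
        Real.rpow_neg n.cast_nonneg, ← Real.sqrt_eq_rpow]
      exact h x
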